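/- \textbf{Theorem (convergence of DPPG-TD).} \emph{Setting.} Consider an MDP with state space $\mathcal S$, arbitrary action space $\mathcal A$, transition densities $p(s'|s,a)$ with respect to a finite measure on $\mathcal S$ of total mass $|\mathcal S|$ (counting measure if $\mathcal S$ is finite), initial distribution $d_0$, random rewards given $(s,a)$ bounded by $R_{\max}$, and discount $\gamma\in[0,1)$. Let $\mathcal U\subseteq\mathbb R^k$ be contained in the closure of its interior, and for each $u$ let $f(\cdot|u)$ be a distribution on $\mathcal A$, depending measurably on $u$. The parameter-space MDP has actions $u\in\mathcal U$, transitions $\tilde p(s'|s,u)=\int p(s'|s,a)f(da|u)$ and mean rewards $\tilde r(s,u)=\int r(s,a)f(da|u)$. Let $\tilde\pi_\theta:\mathcal S\to\mathcal U$, $\theta\in\mathbb R^d$, be deterministic policies, measurable in $s$ and differentiable in $\theta$, with action-value functions $\tilde q_\theta$. Let $J(\theta)=\sum_{t\ge0}\mathbb E_{\tilde\pi_\theta}[\gamma^tR_{t+1}]$, let $\nu_\theta=\sum_{t\ge 0}\gamma^t\,\mathbb P_{\tilde\pi_\theta}(S_t\in\cdot)$ be the discounted occupancy measure (total mass $1/(1-\gamma)$),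 and let $d_\theta=\lim_{T}\frac1T\sum_{t<T}\mathbb P_{\tilde\pi_\theta}(S_t\in\cdot)$ (setwise limit, assumed to exist as a probability measure) be the stationary distribution. $\nabla_\theta\tilde\pi_\theta(s)$ denotes the $d\times k$ transposed Jacobian. Let $\phi:\mathcal S\times\mathcal U\to\mathbb R^d$ be a measurable feature function. \emph{Assumptions.} With positive constants $L_\pi,L_\psi,\lambda_\Psi,L_p,L_r,L_q,C_\phi,\lambda_A$, for all $\theta,\theta_1,\theta_2\in\mathbb R^d$, $u_1,u_2\in\mathcal U$, $s,s'\in\mathcal S$: (1) $\|\tilde\pi_{\theta_1}(s)-\tilde\pi_{\theta_2}(s)\|\le L_\pi\|\theta_1-\theta_2\|$, $\|\nabla_\theta\tilde\pi_{\theta_1}(s)-\nabla_\theta\tilde\pi_{\theta_2}(s)\|\le L_\psi\|\theta_1-\theta_2\|$, and $\Psi_\theta=\int\nabla_\theta\tilde\pi_\theta\nabla_\theta\tilde\pi_\theta^\top d\nu_\theta$ has least eigenvalue at least $\lambda_\Psi$; (2) $|\tilde p(s'|s,u_1)-\tilde p(s'|s,u_2)|\le L_p\|u_1-u_2\|$ and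 $|\tilde r(s,u_1)-\tilde r(s,u_2)|\le L_r\|u_1-u_2\|$; (3) $\tilde q_\theta(s,\cdot)$ is differentiable on $\mathcal U$ and $\|\nabla_u\tilde q_\theta(s,u_1)-\nabla_u\tilde q_\theta(s,u_2)\|\le L_q\|u_1-u_2\|$; (4) $\|\phi\|\le C_\phi$ on $\mathcal S\times\mathcal U$; with $x=(s,\tilde\pi_\theta(s))$, $s\sim d_\theta$, and $x'=(s',\tilde\pi_\theta(s'))$ the successor pair, the matrices $A_\theta=\mathbb E_{d_\theta}[\phi(x)(\gamma\phi(x')-\phi(x))^\top]$ and $D_\theta=\mathbb E_{d_\theta}[\phi(x)\phi(x)^\top]$ are non-singular, and every complex eigenvalue of $A_\theta$ has absolute value at least $\lambda_A$. \emph{Algorithm DPPG-TD.} Start from $w_0,\theta_0\in\mathbb R^d$. In iteration $t$, given the past, draw independently $M$ transitions $(s_j,r_j,s_j^+)$, $s_j\sim d_{\theta_t}$, under $\tilde\pi_{\theta_t}$, and $M$ states $s'_j$ from the probability measure $(1-\gamma)\nu_{\theta_t}$, and set, with $x_j=(s_j,\tilde\pi_{\theta_t}(s_j))$ and $x_j^+=(s_j^+,\tilde\pi_{\theta_t}(s_j^+))$,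 $$w_{t+1}=w_t+\tfrac{\alpha_w}{M}\sum_j\big(r_j+\gamma\phi(x_j^+)^\top w_t-\phi(x_j)^\top w_t\big)\phi(x_j),\qquad \theta_{t+1}=\theta_t+\tfrac{\alpha_\theta}{M}\sum_j\nabla_\theta\tilde\pi_{\theta_t}(s'_j)\nabla_\theta\tilde\pi_{\theta_t}(s'_j)^\top w_t .$$ \emph{Conclusion.} $J$ is differentiable; there is $\lambda>0$ with $x^\top(A_\theta+A_\theta^\top)x\le-\lambda\|x\|^2$ for all $\theta,x$; for every $\theta$ there is a unique TD fixed point $w^*_\theta$ (the zero of the mean TD update $\mathbb E_{d_\theta}[(r+\gamma\phi(x')^\top w-\phi(x)^\top w)\phi(x)]$) and a unique vector of compatible critic weights $w^*_{\xi_\theta}$ (the minimizer over $w$ of $\int\|\nabla_\theta\tilde\pi_\theta(s)^\top w-\nabla_u\tilde q_\theta(s,u)|_{u=\tilde\pi_\theta(s)}\|^2d\nu_\theta(s)$); and $\kappa=\sup_\theta\|w^*_\theta-w^*_{\xi_\theta}\|<\infty$. Put $L_P=|\mathcal S|L_p$, $C_\nu=\frac{2\gamma}{(1-\gamma)^2}$,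 $L_\nu=\frac12C_\nu L_PL_\pi$, $C_q=L_r+L_P\frac{\gamma R_{\max}}{1-\gamma}$, $C_A=2C_\phi^2$, $C_b=R_{\max}C_\phi$, $C_w=\frac{R_{\max}C_\phi}{\lambda_A}$, $C_{w_\xi}=\frac{L_\pi C_q}{\lambda_\Psi(1-\gamma)}$, $L_h=L_\pi^2$, $$L_J=\Big(\tfrac12L_PL_\pi^2L_\nu C_\nu+\tfrac{L_\psi}{1-\gamma}\Big)\Big(L_r+\tfrac{\gamma R_{\max}L_P}{1-\gamma}\Big)+\tfrac{L_\pi}{1-\gamma}\Big(L_qL_\pi+\tfrac\gamma2L_P^2R_{\max}L_\pi C_\nu+\tfrac{\gamma L_PL_rL_\pi}{1-\gamma}\Big),$$ $$L_w=\tfrac{L_J}{\lambda_\Psi}+\tfrac{L_\pi C_q}{\lambda_\Psi^2(1-\gamma)}\Big(L_\pi^2L_\nu+\tfrac{2L_\pi L_\psi}{1-\gamma}\Big).$$ For every such $\lambda$, all step sizes $0<\alpha_w\le\frac{\lambda}{2C_A^2}$ and $0<\alpha_\theta\le\min\{\frac1{4L_J},\frac{\lambda\alpha_w}{24\sqrt6L_hL_w}\}$,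 every integer $M\ge1$ with $M\ge\frac{48\alpha_wC_A^2}{\lambda}$, and every $T\ge1$, the expectations below are finite and $$\min_{1\le t\le T}\mathbb E\|\nabla J(\theta_t)\|^2\le\frac1{(1-\gamma)^2}\Big(\frac{c_1}T+\frac{c_2}M+c_3\kappa^2\Big),$$ where $c_1=\frac{8R_{\max}}{\alpha_\theta}+\frac{144L_h^2}{\lambda\alpha_w}\|w_0-w^*_{\theta_0}\|^2$, $c_2=\Big[48\alpha_w^2(C_A^2C_w^2+C_b^2)+\frac{96L_w^2L_\pi^4C_{w_\xi}^2\alpha_\theta^2}{\lambda\alpha_w}\Big]\frac{144L_h^2}{\lambda\alpha_w}+72L_\pi^4C_{w_\xi}^2$, $c_3=18L_h^2+\Big[\frac{24L_w^2L_h^2\alpha_\theta^2}{\lambda\alpha_w}+\frac{24}{\lambda\alpha_w}\Big]\frac{144L_h^2}{\lambda\alpha_w}$. -/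

import Mathlib

open MeasureTheory ProbabilityTheory Filter Topology

noncomputable section

namespace DPPG

/-- Real `n`-dimensional Euclidean space. -/
abbrev Vec (n : ℕ) : Type := EuclideanSpace ℝ (Fin n)

/-! ### Markov decision processes -/

/-- A discounted Markov decision process with state space `S` and an arbitrary action space `A`.
The transition probabilities are given by densities `p s a` with respect to a finite reference
measure `ref` on `S`: counting measure on a finite state space (then `p s a s'` is the probability
of `s'`), or for instance Lebesgue measure on a compact state space. -/
structure MDP (S A : Type*) [MeasurableSpace S] [MeasurableSpace A] where
  /-- reference measure on the state space -/
  ref : Measure S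
  ref_finite : IsFiniteMeasure ref
  /-- transition density: `p s a s'` is the density of moving from `s` to `s'` under action `a` -/
  p : S → A → S → ℝ
  p_measurable : Measurable fun x : (S × A) × S => p x.1.1 x.1.2 x.2
  p_nonneg : ∀ s a s', 0 ≤ p s a s'
  p_integral : ∀ s a, ∫ s', p s a s' ∂ref = 1
  /-- initial state distribution -/
  d0 : Measure S
  d0_prob : IsProbabilityMeasure d0
  /-- reward distribution given state and action -/
  rew : Kernel (S × A) ℝ
  rew_markov : IsMarkovKernel rew
  /-- discount factor -/
  γ : ℝ
  γ_nonneg : 0 ≤ γ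
  γ_lt_one : γ < 1

attribute [instance] MDP.ref_finite MDP.d0_prob MDP.rew_markov

/-- A deterministic policy `θ ↦ (s ↦ π θ s)` of the parameter-space MDP, with parameter
`θ ∈ ℝ^d` and values in the set `U ⊆ ℝ^k` of distribution parameters. -/
structure ParamPolicy (S : Type*) [MeasurableSpace S] {k : ℕ} (U : Set (Vec k)) (d : ℕ) where
  toFun : Vec d → S → Vec k
  mem : ∀ θ s, toFun θ s ∈ U
  measurable : ∀ θ, Measurable (toFun θ)
  differentiable : ∀ s, Differentiable ℝ fun θ => toFun θ s

instance {S : Type*} [MeasurableSpace S] {k : ℕ} (U : Set (Vec k)) (d : ℕ) :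
    CoeFun (ParamPolicy S U d) fun _ => Vec d → S → Vec k := ⟨ParamPolicy.toFun⟩

/-- The Jacobian of `θ ↦ π_θ(s)`, as a linear map `ℝ^d → ℝ^k`. The matrix written
`∇_θ π_θ(s)` (of size `d × k`) is its adjoint. -/
def ParamPolicy.jac {S : Type*} [MeasurableSpace S] {k d : ℕ} {U : Set (Vec k)}
    (π : ParamPolicy S U d) (θ : Vec d) (s : S) : Vec d →L[ℝ] Vec k :=
  fderiv ℝ (fun θ' => π θ' s) θ

namespace MDP

variable {S A : Type*} [MeasurableSpace S] [MeasurableSpace A] (mdp : MDP S A)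

/-- Total mass of the reference measure: the cardinality of a finite state space, or the volume
of a compact one. -/
def vol : ℝ := mdp.ref.real Set.univ

/-- Transition kernel of the original MDP. -/
def trans : Kernel (S × A) S :=
  Kernel.withDensity (Kernel.const (S × A) mdp.ref) fun x s' => ENNReal.ofReal (mdp.p x.1 x.2 s')

/-- Rewards are bounded by `Rmax`. -/
def RewardBounded (Rmax : ℝ) : Prop :=
  ∀ x : S × A, ∀ᵐ ρ ∂(mdp.rew x), |ρ| ≤ Rmax

variable {k : ℕ} (f : Kernel (Vec k) A)

/-! ### The parameter-space MDP

`f u` is the distribution over actions with distribution parameters `u`. -/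

/-- Parameter-space transition density `p̃(s'|s,u) = ∫ p(s'|s,a) f(da|u)`. -/
def pTilde (s : S) (u : Vec k) (s' : S) : ℝ := ∫ a, mdp.p s a s' ∂(f u)

/-- Parameter-space (mean) reward `r̃(s,u) = ∫ r(s,a) f(da|u)`. -/
def rTilde (s : S) (u : Vec k) : ℝ := ∫ a, (∫ ρ, ρ ∂(mdp.rew (s, a))) ∂(f u)

/-- One step of the parameter-space MDP from `(s, u)`: the joint law of (reward, next state) when
an action `a ∼ f(·|u)` is drawn, then the reward and the next state given `(s, a)`. -/
def paramStep : Kernel (S × Vec k) (ℝ × S) :=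
  (mdp.rew ×ₖ mdp.trans) ∘ₖ
    (Kernel.deterministic Prod.fst measurable_fst ×ₖ f.comap Prod.snd measurable_snd)

variable {d : ℕ} {U : Set (Vec k)} (π : ParamPolicy S U d)

/-- Joint law of (reward, next state) from state `s` under `π_θ`. -/
def policyStep (θ : Vec d) : Kernel S (ℝ × S) :=
  (mdp.paramStep f).comap (fun s => (s, π θ s)) (measurable_id.prodMk (π.measurable θ))

/-- Law of the state `S_t` under `π_θ` when `S_0` has law `μ`. -/
def stateLaw (θ : Vec d) (μ : Measure S) : ℕ → Measure S
  | 0 => μ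
  | t + 1 => (stateLaw θ μ t).bind fun s => (mdp.policyStep f π θ s).map Prod.snd

/-- `E[R_{t+1}]` under `π_θ` when `S_0` has law `μ`. -/
def meanReward (θ : Vec d) (μ : Measure S) (t : ℕ) : ℝ :=
  ∫ s, mdp.rTilde f s (π θ s) ∂(mdp.stateLaw f π θ μ t)

/-- State-value function of `π_θ`. -/
def v (θ : Vec d) (s : S) : ℝ :=
  ∑' t : ℕ, mdp.γ ^ t * mdp.meanReward f π θ (Measure.dirac s) t

/-- Action-value function of `π_θ` in the parameter-space MDP:
`q(s,u) = E[R_1 + γ v(S_1) | S_0 = s, U_0 = u]`. -/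
def q (θ : Vec d) (s : S) (u : Vec k) : ℝ :=
  ∫ y, (y.1 + mdp.γ * mdp.v f π θ y.2) ∂(mdp.paramStep f (s, u))

/-- `∇_u q(s,u)`, for `u` in the set `U` of distribution parameters. -/
def gradQ (θ : Vec d) (s : S) (u : Vec k) : Vec k := gradientWithin (mdp.q f π θ s) U u

/-- The objective `J(θ) = ∑_t γ^t E[R_{t+1}]`, with `S_0 ∼ d0`. -/
def J (θ : Vec d) : ℝ := ∑' t : ℕ, mdp.γ ^ t * mdp.meanReward f π θ mdp.d0 t

/-- Discounted occupancy measure `ν_θ = ∑_t γ^t P(S_t ∈ ·)`, of total mass `1/(1-γ)`. -/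
def occ (θ : Vec d) : Measure S :=
  Measure.sum fun t : ℕ => ENNReal.ofReal (mdp.γ ^ t) • mdp.stateLaw f π θ mdp.d0 t

/-- The probability measure `(1-γ) ν_θ`, from which states are drawn. -/
def occProb (θ : Vec d) : Measure S := ENNReal.ofReal (1 - mdp.γ) • mdp.occ f π θ

/-- `μ` is the stationary distribution
`d_θ(B) = lim_{T → ∞} (1/T) ∑_{t<T} P(S_t ∈ B)` of `π_θ`. -/
structure IsStationaryDistribution (θ : Vec d) (μ : Measure S) : Prop where
  prob : IsProbabilityMeasure μ
  limit : ∀ B : Set S, MeasurableSet B →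
    Tendsto (fun T : ℕ => (1 / (T : ℝ)) *
        ∑ t ∈ Finset.range T, (mdp.stateLaw f π θ mdp.d0 t).real B)
      atTop (𝓝 (μ.real B))

/-- Law of one transition `(s, (r, s'))`, where `s ∼ μ` and `(r, s')` is one step under `π_θ`. -/
def tdLaw (θ : Vec d) (μ : Measure S) : Measure (S × (ℝ × S)) := μ ⊗ₘ mdp.policyStep f π θ

/-! ### Linear critic and compatible weights -/

/-- `Ψ_θ = E_{ν_θ}[∇_θ π_θ(s) ∇_θ π_θ(s)ᵀ]`. -/
def Psi (θ : Vec d) : Vec d →L[ℝ] Vec d :=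
  ∫ s, (ContinuousLinearMap.adjoint (π.jac θ s)).comp (π.jac θ s) ∂(mdp.occ f π θ)

/-- Mean square error `E_{ν_θ}‖∇_u Q_w(s,u) - ∇_u q(s,u)‖²` at `u = π_θ(s)` of a compatible critic,
that is, of one with `∇_u Q_w(s,u) = ∇_θ π_θ(s)ᵀ w` at `u = π_θ(s)`. -/
def compatError (θ w : Vec d) : ℝ :=
  ∫ s, ‖π.jac θ s w - mdp.gradQ f π θ s (π θ s)‖ ^ 2 ∂(mdp.occ f π θ)

/-- `w` is the vector of compatible critic weights `w*_ξ` of `π_θ`. -/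
def IsCompatibleWeight (θ w : Vec d) : Prop := IsMinOn (mdp.compatError f π θ) Set.univ w

variable (φ : S → Vec k → Vec d)

/-- TD error `r + γ φ(x')ᵀ w - φ(x)ᵀ w` of the transition `z = (s, (r, s'))`, with
`x = (s, π_θ(s))` and `x' = (s', π_θ(s'))`. -/
def tdError (θ w : Vec d) (z : S × (ℝ × S)) : ℝ :=
  z.2.1 + mdp.γ * inner ℝ (φ z.2.2 (π θ z.2.2)) w - inner ℝ (φ z.1 (π θ z.1)) w

/-- `w` is a TD fixed point `w*` for `π_θ`: `E_{d_θ}[δ φ(x)] = 0`. -/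
def IsTDFixedPoint (θ : Vec d) (μ : Measure S) (w : Vec d) : Prop :=
  ∫ z, mdp.tdError π φ θ w z • φ z.1 (π θ z.1) ∂(mdp.tdLaw f π θ μ) = 0

/-- The matrix `A = E_{d_θ}[φ(x)(γ φ(x') - φ(x))ᵀ]`. -/
def matA (θ : Vec d) (μ : Measure S) : Matrix (Fin d) (Fin d) ℝ := fun i j =>
  ∫ z, φ z.1 (π θ z.1) i * (mdp.γ * φ z.2.2 (π θ z.2.2) j - φ z.1 (π θ z.1) j)
    ∂(mdp.tdLaw f π θ μ)

/-- The matrix `D = E_{d_θ}[φ(x) φ(x)ᵀ]`. -/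
def matD (θ : Vec d) (μ : Measure S) : Matrix (Fin d) (Fin d) ℝ := fun i j =>
  ∫ s, φ s (π θ s) i * φ s (π θ s) j ∂μ

/-- `lam` bounds the curvature of the TD update from below, uniformly in `θ`:
`xᵀ (A + Aᵀ) x ≤ - lam ‖x‖²`. -/
def IsCurvature (stat : Vec d → Measure S) (lam : ℝ) : Prop :=
  ∀ θ (x : Fin d → ℝ),
    x ⬝ᵥ ((mdp.matA f π φ θ (stat θ) + (mdp.matA f π φ θ (stat θ)).transpose).mulVec x)
      ≤ -lam * (x ⬝ᵥ x)

end MDP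

/-! ### Assumptions and constants -/

/-- The constants named in the assumptions. -/
structure Consts where
  Rmax : ℝ
  Lπ : ℝ
  Lψ : ℝ
  lamΨ : ℝ
  Lp : ℝ
  Lr : ℝ
  Lq : ℝ
  Cφ : ℝ
  lamA : ℝ

namespace MDP

variable {S A : Type*} [MeasurableSpace S] [MeasurableSpace A] (mdp : MDP S A)
variable {k d : ℕ} {U : Set (Vec k)}

/-- Lipschitz and smooth policy; the least eigenvalue of the symmetric matrix `Ψ_θ` is at least
`lamΨ > 0`. -/
structure PolicyAssumption (f : Kernel (Vec k) A) (π : ParamPolicy S U d) (K : Consts) : Prop where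
  Lπ_pos : 0 < K.Lπ
  Lψ_pos : 0 < K.Lψ
  lamΨ_pos : 0 < K.lamΨ
  lipschitz : ∀ θ₁ θ₂ s, ‖π θ₁ s - π θ₂ s‖ ≤ K.Lπ * ‖θ₁ - θ₂‖
  smooth : ∀ θ₁ θ₂ s, ‖π.jac θ₁ s - π.jac θ₂ s‖ ≤ K.Lψ * ‖θ₁ - θ₂‖
  eigenvalue : ∀ θ (μ : ℝ),
    Module.End.HasEigenvalue (mdp.Psi f π θ : Vec d →ₗ[ℝ] Vec d) μ → K.lamΨ ≤ μ

/-- Lipschitz parameter-space transitions and rewards. -/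
structure EnvAssumption (f : Kernel (Vec k) A) (U : Set (Vec k)) (K : Consts) : Prop where
  Lp_pos : 0 < K.Lp
  Lr_pos : 0 < K.Lr
  trans : ∀ u₁ ∈ U, ∀ u₂ ∈ U, ∀ s s',
    |mdp.pTilde f s u₁ s' - mdp.pTilde f s u₂ s'| ≤ K.Lp * ‖u₁ - u₂‖
  reward : ∀ u₁ ∈ U, ∀ u₂ ∈ U, ∀ s,
    |mdp.rTilde f s u₁ - mdp.rTilde f s u₂| ≤ K.Lr * ‖u₁ - u₂‖

/-- The action-value functions are differentiable in `u`, with Lipschitz gradients. -/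
structure QAssumption (f : Kernel (Vec k) A) (π : ParamPolicy S U d) (K : Consts) : Prop where
  Lq_pos : 0 < K.Lq
  differentiable : ∀ θ s, DifferentiableOn ℝ (mdp.q f π θ s) U
  smooth : ∀ θ s, ∀ u₁ ∈ U, ∀ u₂ ∈ U,
    ‖mdp.gradQ f π θ s u₁ - mdp.gradQ f π θ s u₂‖ ≤ K.Lq * ‖u₁ - u₂‖

/-- Bounded features; `A` and `D` are non-singular and all (complex) eigenvalues of `A` have
absolute value at least `lamA > 0`, uniformly in `θ`. -/
structure FeatureAssumption (f : Kernel (Vec k) A) (π : ParamPolicy S U d)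
    (φ : S → Vec k → Vec d) (stat : Vec d → Measure S) (K : Consts) : Prop where
  Cφ_pos : 0 < K.Cφ
  lamA_pos : 0 < K.lamA
  bounded : ∀ s, ∀ u ∈ U, ‖φ s u‖ ≤ K.Cφ
  A_nonsing : ∀ θ, (mdp.matA f π φ θ (stat θ)).det ≠ 0
  D_nonsing : ∀ θ, (matD π φ θ (stat θ)).det ≠ 0
  eigenvalue : ∀ θ, ∀ z ∈ spectrum ℂ ((mdp.matA f π φ θ (stat θ)).map (algebraMap ℝ ℂ)),
    K.lamA ≤ ‖z‖

variable (K : Consts)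

/-- Lipschitz constant in total mass (`L¹` norm) of the transition density. -/
def LP : ℝ := mdp.vol * K.Lp

/-- Perturbation constant of the discounted occupancy measure. -/
def Cν : ℝ := 2 * mdp.γ / (1 - mdp.γ) ^ 2

def Lν : ℝ := 1 / 2 * mdp.Cν * mdp.LP K * K.Lπ

def Cq : ℝ := K.Lr + mdp.LP K * (mdp.γ * K.Rmax / (1 - mdp.γ))

def LJ : ℝ :=
  (1 / 2 * mdp.LP K * K.Lπ ^ 2 * mdp.Lν K * mdp.Cν + K.Lψ / (1 - mdp.γ))
      * (K.Lr + mdp.γ * K.Rmax * mdp.LP K / (1 - mdp.γ))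
    + K.Lπ / (1 - mdp.γ) *
      (K.Lq * K.Lπ + mdp.γ / 2 * mdp.LP K ^ 2 * K.Rmax * K.Lπ * mdp.Cν
        + mdp.γ * mdp.LP K * K.Lr * K.Lπ / (1 - mdp.γ))

def CA : ℝ := 2 * K.Cφ ^ 2

def Cb : ℝ := K.Rmax * K.Cφ

def Cw : ℝ := K.Rmax * K.Cφ / K.lamA

def Cwξ : ℝ := K.Lπ * mdp.Cq K / (K.lamΨ * (1 - mdp.γ))

def Lw : ℝ :=
  mdp.LJ K / K.lamΨ
    + K.Lπ * mdp.Cq K / (K.lamΨ ^ 2 * (1 - mdp.γ))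
      * (K.Lπ ^ 2 * mdp.Lν K + 2 * K.Lπ * K.Lψ / (1 - mdp.γ))

def Lh : ℝ := K.Lπ ^ 2

/-- `e0` stands for `‖w_0 - w*_{θ_0}‖`. -/
def c1 (lam αw αθ e0 : ℝ) : ℝ :=
  8 * K.Rmax / αθ + 144 * Lh K ^ 2 / (lam * αw) * e0 ^ 2

def c2 (lam αw αθ : ℝ) : ℝ :=
  (48 * αw ^ 2 * (CA K ^ 2 * Cw K ^ 2 + Cb K ^ 2)
      + 96 * mdp.Lw K ^ 2 * K.Lπ ^ 4 * mdp.Cwξ K ^ 2 * αθ ^ 2 / (lam * αw))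
      * (144 * Lh K ^ 2 / (lam * αw))
    + 72 * K.Lπ ^ 4 * mdp.Cwξ K ^ 2

def c3 (lam αw αθ : ℝ) : ℝ :=
  18 * Lh K ^ 2
    + (24 * mdp.Lw K ^ 2 * Lh K ^ 2 * αθ ^ 2 / (lam * αw) + 24 / (lam * αw))
      * (144 * Lh K ^ 2 / (lam * αw))

/-! ### The algorithm -/

/-- Joint law of the samples drawn in one iteration with current policy parameter `θ`: `M`
independent transitions started from `μ = d_θ`, and independently of these, `M` independent states
drawn from the normalised occupancy measure. -/
def batchLaw (f : Kernel (Vec k) A) (π : ParamPolicy S U d) (M : ℕ) (θ : Vec d) (μ : Measure S) :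
    Measure ((Fin M → S × (ℝ × S)) × (Fin M → S)) :=
  (Measure.pi fun _ => mdp.tdLaw f π θ μ).prod (Measure.pi fun _ => mdp.occProb f π θ)

/-- A run of the on-policy actor-critic algorithm with linear TD critic: `θ t` and `w t` are the
iterates, `X t` are the samples drawn in iteration `t`, and `ℱ t` is the information available
before they are drawn. -/
structure IsRun {Ω : Type*} {mΩ : MeasurableSpace Ω} (P : Measure Ω) (ℱ : Filtration ℕ mΩ)
    (f : Kernel (Vec k) A) (π : ParamPolicy S U d) (φ : S → Vec k → Vec d)
    (stat : Vec d → Measure S) (M : ℕ) (αw αθ : ℝ) (w0 θ0 : Vec d)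
    (X : ℕ → Ω → (Fin M → S × (ℝ × S)) × (Fin M → S)) (w θ : ℕ → Ω → Vec d) : Prop where
  adapted : ∀ t, Measurable[ℱ (t + 1)] (X t)
  law : ∀ t B, MeasurableSet B →
    P⟦X t ⁻¹' B | ℱ t⟧ =ᵐ[P] fun ω => (mdp.batchLaw f π M (θ t ω) (stat (θ t ω))).real B
  w_zero : ∀ ω, w 0 ω = w0
  θ_zero : ∀ ω, θ 0 ω = θ0
  w_succ : ∀ t ω, w (t + 1) ω = w t ω + (αw / M) •
    ∑ j, mdp.tdError π φ (θ t ω) (w t ω) ((X t ω).1 j) •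
      φ ((X t ω).1 j).1 (π (θ t ω) ((X t ω).1 j).1)
  θ_succ : ∀ t ω, θ (t + 1) ω = θ t ω + (αθ / M) •
    ∑ j, ContinuousLinearMap.adjoint (π.jac (θ t ω) ((X t ω).2 j))
      (π.jac (θ t ω) ((X t ω).2 j) (w t ω))

end MDP

end DPPG

end

open DPPG

/-! The joint iteration is controlled by one Lyapunov function, `lyap`: a multiple of `Rmax/(1-γ) -
J θ` plus a multiple of `‖w - wξ θ‖²`. The critic error is measured from the compatible weights `wξ
θ` and not from the TD fixed point. The compatible weights solve the normal equation `Ψ_θ wξ_θ =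
∇J(θ)`; since `Ψ` is coercive, and `Ψ` and `∇J` are bounded and Lipschitz, `wξ` is bounded and
Lipschitz in `θ` (`norm_compatibleWeight_sub_le`). No regularity of the stationary distribution in
`θ`, and hence of the TD fixed point, is then needed: the fixed point enters only through a
perturbation `A (wTD - wξ)` of the mean critic step, of size at most `CA κ`.

Regularity of `J`: the occupancy measure inverts `1 - γ P`. This gives its Lipschitz dependence on
the policy and the performance difference lemma `J_sub_eq`, from which the deterministic policy
gradient follows by a second-order expansion (`hasGradientAt_J`). The Lipschitz constants found for
`∇J` and `wξ` are at most `2 LJ` and `2 Lw`; the step-size conditions leave room for this factor.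

Curvature: a setwise Cesàro limit is invariant (`bind_stationary`), so `vᵀ A v ≤ -(1-γ) E⟨φ,v⟩²`.
Moreover `‖Aᵀ v‖² ≤ (2 Cφ)² E⟨φ,v⟩²`, and `Aᵀ` is uniformly invertible because its entries are
bounded and its determinant is at least `lamA ^ d` in absolute value. Together these make `A + Aᵀ`
uniformly negative definite (`exists_isCurvature`).

One iteration: the mean actor direction is `H = (1-γ) Ψ w`, within `Lπ² ‖w - wξ‖` of `(1-γ) ∇J`.
Ascent along `H` gains both `‖(1-γ)∇J‖²` and `‖H‖²`, and loses the squared distance between the two.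
The `‖H‖²` pays for the curvature of `J` and for the drift of `wξ`; the contraction of the critic
pays for the distance and for the part of the actor noise that grows with `‖w - wξ‖²`; the remaining
noise is of order `1/M` (`actor_critic_combine`, `lintegral_lyap_next_le`). Telescoping over `T + 1`
iterations bounds the sum of the expected squared gradients, and some term is at most the average.
The stated `c1`, `c2`, `c3` dominate the constants so obtained. -/

set_option linter.unusedSectionVars false

noncomputable section
namespace DPPG

/-! ### Bounded measurable functions and Markov operators -/

/-- `h` is measurable and bounded by `C`. -/
structure BddMeas {S : Type*} [MeasurableSpace S] (h : S → ℝ) (C : ℝ) : Prop where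
  meas : Measurable h
  bound : ∀ s, |h s| ≤ C

section Markov

variable {S : Type*} [MeasurableSpace S]

namespace BddMeas

variable {h g : S → ℝ} {C D : ℝ}

theorem integrable (hh : BddMeas h C) (μ : Measure S) [IsFiniteMeasure μ] : Integrable h μ :=
  Integrable.of_bound hh.meas.aestronglyMeasurable C (ae_of_all _ fun s => hh.bound s)

theorem abs_integral_le (hh : BddMeas h C) (μ : Measure S) [IsFiniteMeasure μ] :
    |∫ s, h s ∂μ| ≤ C * μ.real Set.univ := by
  exact norm_integral_le_of_norm_le_const (μ := μ) (f := h) (C := C)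
    (ae_of_all _ fun s => hh.bound s)

theorem add (hh : BddMeas h C) (hg : BddMeas g D) : BddMeas (fun s => h s + g s) (C + D) :=
  ⟨hh.meas.add hg.meas, fun s => (abs_add_le _ _).trans (add_le_add (hh.bound s) (hg.bound s))⟩

theorem sub (hh : BddMeas h C) (hg : BddMeas g D) : BddMeas (fun s => h s - g s) (C + D) :=
  ⟨hh.meas.sub hg.meas, fun s => (abs_sub _ _).trans (add_le_add (hh.bound s) (hg.bound s))⟩

theorem const_mul (hh : BddMeas h C) (c : ℝ) : BddMeas (fun s => c * h s) (|c| * C) :=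
  ⟨hh.meas.const_mul c, fun s => by
    rw [abs_mul]; exact mul_le_mul_of_nonneg_left (hh.bound s) (abs_nonneg c)⟩

theorem nonneg [Nonempty S] (hh : BddMeas h C) : 0 ≤ C :=
  (abs_nonneg _).trans (hh.bound (Classical.arbitrary S))

end BddMeas

/-- The action of a kernel on functions. -/
def kop (P : Kernel S S) (h : S → ℝ) : S → ℝ := fun s => ∫ s', h s' ∂(P s)

/-- Law of the `t`-th state of the chain with kernel `P` and initial law `μ`. -/
def iterLaw (P : Kernel S S) (μ : Measure S) : ℕ → Measure S
  | 0 => μ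
  | t + 1 => (iterLaw P μ t).bind P

/-- Discounted value of the running payoff `h` along the chain with kernel `P`. -/
def discValue (γ : ℝ) (P : Kernel S S) (h : S → ℝ) (s : S) : ℝ :=
  ∑' t : ℕ, γ ^ t * ((kop P)^[t] h) s

/-- Discounted occupancy measure of the chain. -/
def discOcc (γ : ℝ) (P : Kernel S S) (μ : Measure S) : Measure S :=
  Measure.sum fun t : ℕ => ENNReal.ofReal (γ ^ t) • iterLaw P μ t

variable {P : Kernel S S} [IsMarkovKernel P] {h g : S → ℝ} {C D γ : ℝ} {μ : Measure S}
  [IsProbabilityMeasure μ]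

theorem BddMeas.kop (hh : BddMeas h C) : BddMeas (kop P h) C where
  meas := (hh.meas.stronglyMeasurable.integral_kernel (κ := P)).measurable
  bound s := by simpa [DPPG.kop] using hh.abs_integral_le (P s)

theorem BddMeas.iterate_kop (hh : BddMeas h C) (t : ℕ) : BddMeas ((DPPG.kop P)^[t] h) C := by
  induction t with
  | zero => exact hh
  | succ t ih => rw [Function.iterate_succ']; exact ih.kop

instance isProbabilityMeasure_iterLaw (t : ℕ) : IsProbabilityMeasure (iterLaw P μ t) := by
  induction t with
  | zero => assumption
  | succ t ih => exact inferInstanceAs (IsProbabilityMeasure (P ∘ₘ iterLaw P μ t))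

theorem integral_bind_bddMeas (hh : BddMeas h C) (μ : Measure S) [IsProbabilityMeasure μ] :
    ∫ s, h s ∂(μ.bind P) = ∫ s, kop P h s ∂μ := by
  have : IsProbabilityMeasure (μ.bind P) := inferInstanceAs (IsProbabilityMeasure (P ∘ₘ μ))
  have h1 := Kernel.integral_comp (η := P) (κ := Kernel.const Unit μ) (a := ()) (f := h)
    (hh.integrable _)
  simpa [Kernel.comp_apply, kop] using h1

theorem integral_iterLaw (hh : BddMeas h C) (t : ℕ) :
    ∫ s, h s ∂(iterLaw P μ t) = ∫ s, ((kop P)^[t] h) s ∂μ := by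
  induction t generalizing h with
  | zero => rfl
  | succ t ih =>
    rw [iterLaw, integral_bind_bddMeas hh, ih hh.kop, Function.iterate_succ_apply]

theorem integral_iterLaw_dirac (hh : BddMeas h C) (t : ℕ) (s : S) :
    ∫ s', h s' ∂(iterLaw P (Measure.dirac s) t) = ((kop P)^[t] h) s := by
  rw [integral_iterLaw hh, integral_dirac' _ _ (hh.iterate_kop t).meas.stronglyMeasurable]

theorem hasSum_geometric_mul (hγ : 0 ≤ γ) (hγ1 : γ < 1) (C : ℝ) :
    HasSum (fun t : ℕ => γ ^ t * C) (C / (1 - γ)) := by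
  simpa [div_eq_inv_mul] using (hasSum_geometric_of_lt_one hγ hγ1).mul_right C

theorem summable_discValue (hγ : 0 ≤ γ) (hγ1 : γ < 1) (hh : BddMeas h C) (s : S) :
    Summable fun t : ℕ => γ ^ t * ((kop P)^[t] h) s := by
  refine Summable.of_norm_bounded (hasSum_geometric_mul hγ hγ1 C).summable fun t => ?_
  rw [norm_mul, norm_pow, Real.norm_of_nonneg hγ]
  exact mul_le_mul_of_nonneg_left ((hh.iterate_kop t).bound s) (pow_nonneg hγ t)

theorem BddMeas.discValue (hγ : 0 ≤ γ) (hγ1 : γ < 1) (hh : BddMeas h C) :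
    BddMeas (discValue γ P h) (C / (1 - γ)) where
  meas := by
    refine measurable_of_tendsto_metrizable (f := fun n s =>
      ∑ t ∈ Finset.range n, γ ^ t * ((DPPG.kop P)^[t] h) s) (fun n => ?_) ?_
    · exact Finset.measurable_sum _ fun t _ => (hh.iterate_kop t).meas.const_mul _
    · rw [tendsto_pi_nhds]
      exact fun s => (summable_discValue hγ hγ1 hh s).hasSum.tendsto_sum_nat
  bound s := by
    rw [DPPG.discValue, ← Real.norm_eq_abs]
    refine tsum_of_norm_bounded (hasSum_geometric_mul hγ hγ1 C) fun t => ?_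
    rw [norm_mul, norm_pow, Real.norm_of_nonneg hγ]
    exact mul_le_mul_of_nonneg_left ((hh.iterate_kop t).bound s) (pow_nonneg hγ t)

/-- The terms are dominated by `γ ^ t * C`, so sum and integral commute. With `μ = P s` this yields
the Bellman equation, with `μ = d0` the formula for `J`. -/
theorem hasSum_integral_discValue (hγ : 0 ≤ γ) (hγ1 : γ < 1) (hh : BddMeas h C) (μ : Measure S)
    [IsProbabilityMeasure μ] :
    HasSum (fun t : ℕ => γ ^ t * ∫ s, ((kop P)^[t] h) s ∂μ) (∫ s, discValue γ P h s ∂μ) := by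
  have := hasSum_integral_of_summable_integral_norm (μ := μ)
    (F := fun (t : ℕ) s => γ ^ t * ((kop P)^[t] h) s)
    (fun t => ((hh.iterate_kop t).integrable μ).const_mul _) ?_
  · simpa [integral_const_mul] using! this
  · refine Summable.of_nonneg_of_le (fun t => integral_nonneg fun s => norm_nonneg _) (fun t => ?_)
      (hasSum_geometric_mul hγ hγ1 C).summable
    have : ∀ s, ‖γ ^ t * ((kop P)^[t] h) s‖ ≤ γ ^ t * C := fun s => by
      rw [norm_mul, norm_pow, Real.norm_of_nonneg hγ]
      exact mul_le_mul_of_nonneg_left ((hh.iterate_kop t).bound s) (pow_nonneg hγ t)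
    calc ∫ s, ‖γ ^ t * ((kop P)^[t] h) s‖ ∂μ ≤ ∫ s, γ ^ t * C ∂μ :=
          integral_mono (((hh.iterate_kop t).integrable μ).const_mul _).norm
            (integrable_const _) this
      _ = γ ^ t * C := by simp

/-- Bellman equation. -/
theorem discValue_eq (hγ : 0 ≤ γ) (hγ1 : γ < 1) (hh : BddMeas h C) (s : S) :
    discValue γ P h s = h s + γ * kop P (discValue γ P h) s := by
  have h1 := (hasSum_integral_discValue (P := P) hγ hγ1 hh (P s)).mul_left γ
  rw [discValue, (summable_discValue hγ hγ1 hh s).tsum_eq_zero_add]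
  simp only [pow_zero, Function.iterate_zero, id, one_mul]
  congr 1
  rw [show kop P (discValue γ P h) s = ∫ s', discValue γ P h s' ∂(P s) from rfl, ← h1.tsum_eq]
  refine tsum_congr fun t => ?_
  rw [Function.iterate_succ', Function.comp, kop]
  ring

/-- The counterpart of the Bellman equation in which the kernel acts on the payoff; it is the form
that integrates to the inversion of `1 - γ P` by the occupancy measure. -/
theorem discValue_add (hγ : 0 ≤ γ) (hγ1 : γ < 1) (hh : BddMeas h C) (s : S) :
    discValue γ P h s = h s + γ * discValue γ P (kop P h) s := by
  rw [discValue, (summable_discValue (P := P) hγ hγ1 hh s).tsum_eq_zero_add]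
  simp only [pow_zero, Function.iterate_zero, id, one_mul]
  rw [discValue, ← tsum_mul_left]
  congr 1
  refine tsum_congr fun t => ?_
  rw [Function.iterate_succ, Function.comp]
  ring

theorem isFiniteMeasure_discOcc (hγ : 0 ≤ γ) (hγ1 : γ < 1) :
    discOcc γ P μ Set.univ = ENNReal.ofReal (1 / (1 - γ)) := by
  rw [discOcc, Measure.sum_apply _ MeasurableSet.univ]
  simp only [Measure.smul_apply, measure_univ, smul_eq_mul, mul_one]
  have := hasSum_geometric_of_lt_one hγ hγ1
  rw [← ENNReal.ofReal_tsum_of_nonneg (fun n => pow_nonneg hγ n) this.summable, this.tsum_eq,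
    one_div]

theorem integral_discOcc (hγ : 0 ≤ γ) (hγ1 : γ < 1) (hh : BddMeas h C) :
    ∫ s, h s ∂(discOcc γ P μ) = ∫ s, discValue γ P h s ∂μ := by
  have : IsFiniteMeasure (discOcc γ P μ) := ⟨by rw [isFiniteMeasure_discOcc hγ hγ1]; simp⟩
  have h1 := hasSum_integral_measure (hh.integrable (discOcc γ P μ))
  refine h1.unique ?_
  have h2 := hasSum_integral_discValue (P := P) hγ hγ1 hh μ
  have h3 : ∀ t : ℕ, ∫ x, h x ∂(ENNReal.ofReal (γ ^ t) • iterLaw P μ t) =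
      γ ^ t * ∫ s, ((kop P)^[t] h) s ∂μ := fun t => by
    rw [integral_smul_measure, ENNReal.toReal_ofReal (pow_nonneg hγ t), integral_iterLaw hh,
      smul_eq_mul]
  simp_rw [← h3] at h2
  exact h2

/-- The occupancy measure inverts `1 - γ P`. -/
theorem integral_discOcc_sub (hγ : 0 ≤ γ) (hγ1 : γ < 1) (hh : BddMeas h C) :
    ∫ s, (h s - γ * kop P h s) ∂(discOcc γ P μ) = ∫ s, h s ∂μ := by
  have : IsFiniteMeasure (discOcc γ P μ) := ⟨by rw [isFiniteMeasure_discOcc hγ hγ1]; simp⟩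
  have hk : BddMeas (kop P h) C := hh.kop
  rw [integral_sub (hh.integrable _) ((hk.integrable _).const_mul _), integral_const_mul,
    integral_discOcc hγ hγ1 hh, integral_discOcc hγ hγ1 hk, ← integral_const_mul,
    ← integral_sub ((hh.discValue hγ hγ1).integrable _)
      (((hk.discValue hγ hγ1).integrable _).const_mul _)]
  refine integral_congr_ae (ae_of_all _ fun s => ?_)
  simp only [discValue_add hγ hγ1 hh s]
  ring

variable {Q : Kernel S S} [IsMarkovKernel Q]

/-- Perturbation of the occupancy measure. -/
theorem abs_integral_discOcc_sub_le (hγ : 0 ≤ γ) (hγ1 : γ < 1) (hh : BddMeas h C) {ε : ℝ}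
    (hPQ : ∀ (h : S → ℝ) (C : ℝ), BddMeas h C → ∀ s, |kop P h s - kop Q h s| ≤ ε * C) :
    |∫ s, h s ∂(discOcc γ P μ) - ∫ s, h s ∂(discOcc γ Q μ)| ≤ γ / (1 - γ) ^ 2 * ε * C := by
  have hf : IsFiniteMeasure (discOcc γ P μ) := ⟨by rw [isFiniteMeasure_discOcc hγ hγ1]; simp⟩
  have hV : BddMeas (discValue γ Q h) (C / (1 - γ)) := hh.discValue hγ hγ1
  have hg : 0 < 1 - γ := by linarith
  rw [integral_discOcc (P := Q) hγ hγ1 hh, ← integral_discOcc_sub (P := P) hγ hγ1 hV,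
    ← integral_sub (hh.integrable _) ((hV.sub (hV.kop.const_mul γ)).integrable _)]
  -- As `h = (1 - γ Q) V` with `V` the value under `Q`, the difference of the two integrals is that
  -- of `γ (P - Q) V`. The bound on `V` and the total mass of the occupancy measure each give one
  -- factor `1 / (1 - γ)`.
  have h1 : ∀ s, h s - (discValue γ Q h s - γ * kop P (discValue γ Q h) s) =
      γ * (kop P (discValue γ Q h) s - kop Q (discValue γ Q h) s) := fun s => by
    rw [discValue_eq hγ hγ1 hh s]; ring
  simp_rw [h1]
  have h2 : BddMeas (fun s => γ * (kop P (discValue γ Q h) s - kop Q (discValue γ Q h) s))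
      (γ * (ε * (C / (1 - γ)))) :=
    ⟨(hV.kop.meas.sub hV.kop.meas).const_mul _, fun s => by
      rw [abs_mul, abs_of_nonneg hγ]
      exact mul_le_mul_of_nonneg_left (hPQ _ _ hV s) hγ⟩
  refine (h2.abs_integral_le _).trans (le_of_eq ?_)
  rw [measureReal_def, isFiniteMeasure_discOcc hγ hγ1, ENNReal.toReal_ofReal (by positivity)]
  field_simp

/-- Perturbation of the discounted value. -/
theorem abs_discValue_sub_le (hγ : 0 ≤ γ) (hγ1 : γ < 1) (hh : BddMeas h C) (hg : BddMeas g C)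
    {ε δ : ℝ} (hhg : ∀ s, |h s - g s| ≤ δ)
    (hPQ : ∀ (h : S → ℝ) (C : ℝ), BddMeas h C → ∀ s, |kop P h s - kop Q h s| ≤ ε * C) (s : S) :
    |discValue γ P h s - discValue γ Q g s| ≤ (δ + γ * (ε * (C / (1 - γ)))) / (1 - γ) := by
  have hV : BddMeas (discValue γ Q g) (C / (1 - γ)) := hg.discValue hγ hγ1
  have hW : BddMeas (discValue γ P h) (C / (1 - γ)) := hh.discValue hγ hγ1
  have e1 : discValue γ P h s = ∫ s', h s' ∂(discOcc γ P (Measure.dirac s)) := by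
    rw [integral_discOcc hγ hγ1 hh, integral_dirac' _ _ hW.meas.stronglyMeasurable]
  have e2 : discValue γ Q g s =
      ∫ s', (discValue γ Q g s' - γ * kop P (discValue γ Q g) s')
        ∂(discOcc γ P (Measure.dirac s)) := by
    rw [integral_discOcc_sub hγ hγ1 hV, integral_dirac' _ _ hV.meas.stronglyMeasurable]
  have hf : IsFiniteMeasure (discOcc γ P (Measure.dirac s)) :=
    ⟨by rw [isFiniteMeasure_discOcc hγ hγ1]; simp⟩
  have hg : 0 < 1 - γ := by linarith
  rw [e1, e2, ← integral_sub (hh.integrable _)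
    ((hV.sub (hV.kop.const_mul γ)).integrable _)]
  -- The residual left when the value of the chain `Q` is put into the Bellman equation of the chain
  -- `P`; the difference of the values is its integral against the occupancy measure of `P` started
  -- at `s`.
  have h1 : ∀ s, h s - (discValue γ Q g s - γ * kop P (discValue γ Q g) s) =
      (h s - g s) + γ * (kop P (discValue γ Q g) s - kop Q (discValue γ Q g) s) := fun s => by
    rw [discValue_eq hγ hγ1 ‹BddMeas g C› s]; ring
  simp_rw [h1]
  have h2 : BddMeas (fun s => (h s - g s) +
      γ * (kop P (discValue γ Q g) s - kop Q (discValue γ Q g) s))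
      (δ + γ * (ε * (C / (1 - γ)))) := by
    refine BddMeas.add ⟨hh.meas.sub ‹BddMeas g C›.meas, hhg⟩
      ⟨(hV.kop.meas.sub hV.kop.meas).const_mul _, fun s => ?_⟩
    rw [abs_mul, abs_of_nonneg hγ]
    exact mul_le_mul_of_nonneg_left (hPQ _ _ hV s) hγ
  refine (h2.abs_integral_le _).trans (le_of_eq ?_)
  rw [measureReal_def, isFiniteMeasure_discOcc hγ hγ1, ENNReal.toReal_ofReal (by positivity)]
  ring

end Markov
end DPPG
end

noncomputable section
namespace DPPG
namespace MDP

/-! ### Kernels of the parameter-space MDP -/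

section Kernels

variable {S A : Type*} [MeasurableSpace S] [MeasurableSpace A] (mdp : MDP S A)

theorem vol_nonneg : 0 ≤ mdp.vol := measureReal_nonneg

theorem one_sub_γ_pos : 0 < 1 - mdp.γ := sub_pos.2 mdp.γ_lt_one

theorem p_integrable (s : S) (a : A) : Integrable (mdp.p s a) mdp.ref := by
  -- The integral of a non-integrable function is `0` by convention, which contradicts total mass
  -- one.
  by_contra h
  have := mdp.p_integral s a
  rw [integral_undef h] at this
  exact zero_ne_one this

theorem lintegral_p (s : S) (a : A) : ∫⁻ s', ENNReal.ofReal (mdp.p s a s') ∂mdp.ref = 1 := by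
  rw [← ofReal_integral_eq_lintegral_ofReal (mdp.p_integrable s a)
    (ae_of_all _ (mdp.p_nonneg s a)), mdp.p_integral]
  simp

theorem measurable_ofReal_p :
    Measurable (Function.uncurry fun (x : S × A) s' => ENNReal.ofReal (mdp.p x.1 x.2 s')) :=
  mdp.p_measurable.ennreal_ofReal

theorem trans_apply (x : S × A) :
    mdp.trans x = mdp.ref.withDensity fun s' => ENNReal.ofReal (mdp.p x.1 x.2 s') := by
  rw [trans, Kernel.withDensity_apply _ mdp.measurable_ofReal_p]
  simp

instance : IsMarkovKernel mdp.trans where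
  isProbabilityMeasure x := ⟨by
    rw [trans_apply, withDensity_apply _ MeasurableSet.univ, Measure.restrict_univ, lintegral_p]⟩

variable {k : ℕ} (f : Kernel (Vec k) A) [IsMarkovKernel f]

instance : IsMarkovKernel (mdp.paramStep f) := by unfold paramStep; infer_instance

theorem paramStep_apply (s : S) (u : Vec k) :
    mdp.paramStep f (s, u) = (mdp.rew ×ₖ mdp.trans) ∘ₘ ((f u).map (Prod.mk s)) := by
  rw [paramStep, Kernel.comp_apply, Kernel.prod_apply, Kernel.deterministic_apply,
    Kernel.comap_apply, Measure.dirac_prod]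

theorem integral_paramStep {F : ℝ × S → ℝ} (hF : Measurable F) (s : S) (u : Vec k)
    (hFi : Integrable F (mdp.paramStep f (s, u))) :
    ∫ y, F y ∂(mdp.paramStep f (s, u)) =
      ∫ a, (∫ y, F y ∂((mdp.rew (s, a)).prod (mdp.trans (s, a)))) ∂(f u) := by
  rw [paramStep, Kernel.integral_comp hFi, Kernel.prod_apply, Kernel.deterministic_apply,
    Kernel.comap_apply, Measure.dirac_prod, integral_map (by fun_prop)]
  · simp [Kernel.prod_apply]
  · exact (hF.stronglyMeasurable.integral_kernel).aestronglyMeasurable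

theorem ae_reward_paramStep {Rmax : ℝ} (hR : mdp.RewardBounded Rmax) (x : S × Vec k) :
    ∀ᵐ y ∂(mdp.paramStep f x), |y.1| ≤ Rmax := by
  obtain ⟨s, u⟩ := x
  have hm : MeasurableSet {y : ℝ × S | |y.1| ≤ Rmax} :=
    measurableSet_le (by fun_prop) measurable_const
  rw [paramStep_apply]
  refine Measure.ae_comp_of_ae_ae hm (ae_of_all _ fun x => ?_)
  rw [Kernel.prod_apply]
  exact (Measure.quasiMeasurePreserving_fst (μ := mdp.rew x) (ν := mdp.trans x)).ae (hR x)

theorem integrable_reward_paramStep {Rmax : ℝ} (hR : mdp.RewardBounded Rmax) (x : S × Vec k) :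
    Integrable (fun y : ℝ × S => y.1) (mdp.paramStep f x) :=
  Integrable.of_bound measurable_fst.aestronglyMeasurable Rmax
    (mdp.ae_reward_paramStep f hR x)

theorem integral_reward_paramStep {Rmax : ℝ} (hR : mdp.RewardBounded Rmax) (s : S) (u : Vec k) :
    ∫ y, y.1 ∂(mdp.paramStep f (s, u)) = mdp.rTilde f s u := by
  rw [mdp.integral_paramStep f measurable_fst s u (mdp.integrable_reward_paramStep f hR _), rTilde]
  refine integral_congr_ae (ae_of_all _ fun a => ?_)
  simp [integral_fun_fst (f := fun ρ : ℝ => ρ)]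

theorem measurable_rTilde {Rmax : ℝ} (hR : mdp.RewardBounded Rmax) :
    Measurable fun x : S × Vec k => mdp.rTilde f x.1 x.2 := by
  simp_rw [← mdp.integral_reward_paramStep f hR]
  exact ((measurable_fst (α := ℝ) (β := S)).stronglyMeasurable.integral_kernel
    (κ := mdp.paramStep f)).measurable

theorem abs_rTilde_le {Rmax : ℝ} (hR : mdp.RewardBounded Rmax) (s : S) (u : Vec k) :
    |mdp.rTilde f s u| ≤ Rmax := by
  rw [← mdp.integral_reward_paramStep f hR]
  have := norm_integral_le_of_norm_le_const (f := fun y : ℝ × S => y.1) (C := Rmax)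
    (mdp.ae_reward_paramStep f hR (s, u))
  simpa using! this

theorem integrable_p_prod (s : S) (u : Vec k) :
    Integrable (fun x : A × S => mdp.p s x.1 x.2) ((f u).prod mdp.ref) := by
  have hm : Measurable fun x : A × S => mdp.p s x.1 x.2 :=
    mdp.p_measurable.comp ((measurable_const.prodMk measurable_fst).prodMk measurable_snd)
  rw [integrable_prod_iff hm.aestronglyMeasurable]
  refine ⟨ae_of_all _ fun a => mdp.p_integrable s a, ?_⟩
  simp [abs_of_nonneg (mdp.p_nonneg _ _ _), mdp.p_integral]

theorem pTilde_integrable (s : S) (u : Vec k) : Integrable (mdp.pTilde f s u) mdp.ref :=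
  (mdp.integrable_p_prod f s u).integral_prod_right

/-- Fubini over action and next state. It ties the sampled step to the density `pTilde`, on which
the Lipschitz assumption is made. -/
theorem integral_next_paramStep {h : S → ℝ} {C : ℝ} (hh : BddMeas h C) (s : S) (u : Vec k) :
    ∫ y, h y.2 ∂(mdp.paramStep f (s, u)) = ∫ s', mdp.pTilde f s u s' * h s' ∂mdp.ref := by
  have hi : Integrable (fun y : ℝ × S => h y.2) (mdp.paramStep f (s, u)) :=
    Integrable.of_bound (hh.meas.comp measurable_snd).aestronglyMeasurable C
      (ae_of_all _ fun y => hh.bound _)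
  rw [mdp.integral_paramStep f (F := fun y => h y.2) (hh.meas.comp measurable_snd) s u hi]
  have h1 : ∀ a, ∫ y : ℝ × S, h y.2 ∂((mdp.rew (s, a)).prod (mdp.trans (s, a))) =
      ∫ s', mdp.p s a s' * h s' ∂mdp.ref := fun a => by
    rw [integral_fun_snd (f := h), trans_apply, integral_withDensity_eq_integral_toReal_smul]
    · simp [ENNReal.toReal_ofReal (mdp.p_nonneg _ _ _)]
    · exact (mdp.p_measurable.comp (measurable_const.prodMk measurable_id)).ennreal_ofReal
    · exact ae_of_all _ fun _ => ENNReal.ofReal_lt_top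
  simp_rw [h1]
  have hi2 : Integrable (fun x : A × S => mdp.p s x.1 x.2 * h x.2) ((f u).prod mdp.ref) :=
    (mdp.integrable_p_prod f s u).mul_bdd (c := C)
      (hh.meas.comp measurable_snd).aestronglyMeasurable (ae_of_all _ fun y => hh.bound _)
  rw [integral_integral_swap hi2]
  simp [pTilde, integral_mul_const]

theorem integrable_pTilde_mul {h : S → ℝ} {C : ℝ} (hh : BddMeas h C) (s : S) (u : Vec k) :
    Integrable (fun s' => mdp.pTilde f s u s' * h s') mdp.ref :=
  (mdp.pTilde_integrable f s u).mul_bdd (c := C) hh.meas.aestronglyMeasurable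
    (ae_of_all _ fun _ => hh.bound _)

variable {U : Set (Vec k)} {K : Consts}

theorem abs_integral_pTilde_sub_le (henv : mdp.EnvAssumption f U K) {h : S → ℝ} {C : ℝ}
    (hh : BddMeas h C) (s : S) {u₁ u₂ : Vec k} (h₁ : u₁ ∈ U) (h₂ : u₂ ∈ U) :
    |∫ s', mdp.pTilde f s u₁ s' * h s' ∂mdp.ref - ∫ s', mdp.pTilde f s u₂ s' * h s' ∂mdp.ref|
      ≤ mdp.LP K * ‖u₁ - u₂‖ * C := by
  rw [← integral_sub (mdp.integrable_pTilde_mul f hh s u₁) (mdp.integrable_pTilde_mul f hh s u₂)]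
  have h1 := norm_integral_le_of_norm_le_const (μ := mdp.ref) (C := K.Lp * ‖u₁ - u₂‖ * C)
    (f := fun s' => mdp.pTilde f s u₁ s' * h s' - mdp.pTilde f s u₂ s' * h s')
    (ae_of_all _ fun s' => by
      rw [← sub_mul, norm_mul]
      exact mul_le_mul (henv.trans _ h₁ _ h₂ s s') (hh.bound s') (norm_nonneg _)
        (mul_nonneg henv.Lp_pos.le (norm_nonneg _)))
  refine h1.trans (le_of_eq ?_)
  rw [LP, vol]; ring

theorem integral_paramStep_affine {Rmax : ℝ} (hR : mdp.RewardBounded Rmax) {h : S → ℝ} {C : ℝ}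
    (hh : BddMeas h C) (c : ℝ) (s : S) (u : Vec k) :
    ∫ y, (y.1 + c * h y.2) ∂(mdp.paramStep f (s, u)) =
      mdp.rTilde f s u + c * ∫ s', mdp.pTilde f s u s' * h s' ∂mdp.ref := by
  rw [integral_add (mdp.integrable_reward_paramStep f hR _), integral_const_mul,
    mdp.integral_reward_paramStep f hR, mdp.integral_next_paramStep f hh]
  exact (Integrable.of_bound (hh.meas.comp measurable_snd).aestronglyMeasurable C
      (ae_of_all _ fun y => hh.bound _)).const_mul c

/-! ### The chain of a policy -/

variable {d : ℕ} (π : ParamPolicy S U d)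

instance (θ : Vec d) : IsMarkovKernel (mdp.policyStep f π θ) := by
  unfold policyStep; infer_instance

/-- State transition kernel of `π_θ`. -/
def polKernel (θ : Vec d) : Kernel S S := (mdp.policyStep f π θ).map Prod.snd

instance (θ : Vec d) : IsMarkovKernel (mdp.polKernel f π θ) := by
  unfold polKernel; exact Kernel.IsMarkovKernel.map _ measurable_snd

theorem polKernel_apply (θ : Vec d) (s : S) :
    mdp.polKernel f π θ s = (mdp.policyStep f π θ s).map Prod.snd :=
  Kernel.map_apply _ measurable_snd _

/-- Mean reward of `π_θ` in a state. -/
def polReward (θ : Vec d) (s : S) : ℝ := mdp.rTilde f s (π θ s)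

theorem polReward_bddMeas {Rmax : ℝ} (hR : mdp.RewardBounded Rmax) (θ : Vec d) :
    BddMeas (mdp.polReward f π θ) Rmax :=
  ⟨(mdp.measurable_rTilde f hR).comp (measurable_id.prodMk (π.measurable θ)),
    fun s => mdp.abs_rTilde_le f hR s _⟩

theorem kop_polKernel (θ : Vec d) {h : S → ℝ} {C : ℝ} (hh : BddMeas h C) (s : S) :
    kop (mdp.polKernel f π θ) h s = ∫ s', mdp.pTilde f s (π θ s) s' * h s' ∂mdp.ref := by
  rw [kop, polKernel_apply, integral_map measurable_snd.aemeasurable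
    hh.meas.aestronglyMeasurable]
  exact mdp.integral_next_paramStep f hh s (π θ s)

theorem abs_kop_polKernel_sub_le (henv : mdp.EnvAssumption f U K)
    (hpolicy : mdp.PolicyAssumption f π K) (θ₁ θ₂ : Vec d) (h : S → ℝ) (C : ℝ)
    (hh : BddMeas h C) (s : S) :
    |kop (mdp.polKernel f π θ₁) h s - kop (mdp.polKernel f π θ₂) h s|
      ≤ mdp.LP K * K.Lπ * ‖θ₁ - θ₂‖ * C := by
  rw [mdp.kop_polKernel f π θ₁ hh, mdp.kop_polKernel f π θ₂ hh]
  have hne : Nonempty S := ⟨s⟩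
  refine (mdp.abs_integral_pTilde_sub_le f henv hh s (π.mem _ _) (π.mem _ _)).trans ?_
  refine mul_le_mul_of_nonneg_right ?_ hh.nonneg
  rw [mul_assoc]
  exact mul_le_mul_of_nonneg_left (hpolicy.lipschitz _ _ _)
    (mul_nonneg mdp.vol_nonneg henv.Lp_pos.le)

theorem stateLaw_eq (θ : Vec d) (μ : Measure S) (t : ℕ) :
    mdp.stateLaw f π θ μ t = iterLaw (mdp.polKernel f π θ) μ t := by
  induction t with
  | zero => rfl
  | succ t ih =>
    rw [stateLaw, iterLaw, ih]
    congr 1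
    exact funext fun s => (mdp.polKernel_apply f π θ s).symm

theorem occ_eq (θ : Vec d) :
    mdp.occ f π θ = discOcc mdp.γ (mdp.polKernel f π θ) mdp.d0 := by
  simp only [occ, discOcc, stateLaw_eq]

theorem v_eq {Rmax : ℝ} (hR : mdp.RewardBounded Rmax) (θ : Vec d) :
    mdp.v f π θ = discValue mdp.γ (mdp.polKernel f π θ) (mdp.polReward f π θ) := by
  funext s
  simp only [v, discValue, meanReward, stateLaw_eq]
  refine tsum_congr fun t => ?_
  rw [← integral_iterLaw_dirac (mdp.polReward_bddMeas f π hR θ)]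
  rfl

theorem v_bddMeas {Rmax : ℝ} (hR : mdp.RewardBounded Rmax) (θ : Vec d) :
    BddMeas (mdp.v f π θ) (Rmax / (1 - mdp.γ)) := by
  rw [mdp.v_eq f π hR]
  exact (mdp.polReward_bddMeas f π hR θ).discValue mdp.γ_nonneg mdp.γ_lt_one

theorem J_eq {Rmax : ℝ} (hR : mdp.RewardBounded Rmax) (θ : Vec d) :
    mdp.J f π θ = ∫ s, mdp.v f π θ s ∂mdp.d0 := by
  rw [mdp.v_eq f π hR, ← (hasSum_integral_discValue mdp.γ_nonneg mdp.γ_lt_one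
    (mdp.polReward_bddMeas f π hR θ) mdp.d0).tsum_eq, J]
  refine tsum_congr fun t => ?_
  rw [← integral_iterLaw (mdp.polReward_bddMeas f π hR θ), meanReward, stateLaw_eq]
  rfl

theorem abs_J_le {Rmax : ℝ} (hR : mdp.RewardBounded Rmax) (θ : Vec d) :
    |mdp.J f π θ| ≤ Rmax / (1 - mdp.γ) := by
  rw [mdp.J_eq f π hR]
  simpa using (mdp.v_bddMeas f π hR θ).abs_integral_le mdp.d0

theorem q_eq {Rmax : ℝ} (hR : mdp.RewardBounded Rmax) (θ : Vec d) (s : S) (u : Vec k) :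
    mdp.q f π θ s u = mdp.rTilde f s u +
      mdp.γ * ∫ s', mdp.pTilde f s u s' * mdp.v f π θ s' ∂mdp.ref :=
  mdp.integral_paramStep_affine f hR (mdp.v_bddMeas f π hR θ) _ s u

theorem q_self {Rmax : ℝ} (hR : mdp.RewardBounded Rmax) (θ : Vec d) (s : S) :
    mdp.q f π θ s (π θ s) = mdp.v f π θ s := by
  have h := discValue_eq (P := mdp.polKernel f π θ) mdp.γ_nonneg mdp.γ_lt_one
    (mdp.polReward_bddMeas f π hR θ) s
  rw [← mdp.v_eq f π hR, mdp.kop_polKernel f π θ (mdp.v_bddMeas f π hR θ)] at h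
  rw [h, mdp.q_eq f π hR]
  rfl

theorem occ_univ (θ : Vec d) : mdp.occ f π θ Set.univ = ENNReal.ofReal (1 / (1 - mdp.γ)) := by
  rw [occ_eq, isFiniteMeasure_discOcc mdp.γ_nonneg mdp.γ_lt_one]

instance (θ : Vec d) : IsFiniteMeasure (mdp.occ f π θ) := ⟨by rw [occ_univ]; simp⟩

theorem occ_real_univ (θ : Vec d) : (mdp.occ f π θ).real Set.univ = 1 / (1 - mdp.γ) := by
  rw [measureReal_def, occ_univ,
    ENNReal.toReal_ofReal (one_div_nonneg.2 mdp.one_sub_γ_pos.le)]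

instance (θ : Vec d) : IsProbabilityMeasure (mdp.occProb f π θ) := ⟨by
  rw [occProb, Measure.smul_apply, occ_univ, smul_eq_mul,
    ← ENNReal.ofReal_mul mdp.one_sub_γ_pos.le, mul_one_div_cancel mdp.one_sub_γ_pos.ne']
  simp⟩

theorem abs_integral_occ_le {h : S → ℝ} {C : ℝ} (hh : BddMeas h C) (θ : Vec d) :
    |∫ s, h s ∂(mdp.occ f π θ)| ≤ C / (1 - mdp.γ) := by
  have := hh.abs_integral_le (mdp.occ f π θ)
  rwa [occ_real_univ, mul_one_div] at this

theorem abs_integral_occ_sub_le (henv : mdp.EnvAssumption f U K)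
    (hpolicy : mdp.PolicyAssumption f π K) {h : S → ℝ} {C : ℝ} (hh : BddMeas h C)
    (θ₁ θ₂ : Vec d) :
    |∫ s, h s ∂(mdp.occ f π θ₁) - ∫ s, h s ∂(mdp.occ f π θ₂)|
      ≤ mdp.Lν K * ‖θ₁ - θ₂‖ * C := by
  rw [occ_eq, occ_eq]
  refine (abs_integral_discOcc_sub_le mdp.γ_nonneg mdp.γ_lt_one hh
    (mdp.abs_kop_polKernel_sub_le f π henv hpolicy θ₁ θ₂)).trans (le_of_eq ?_)
  rw [Lν, Cν]
  ring

theorem abs_v_sub_le (hR : mdp.RewardBounded K.Rmax) (henv : mdp.EnvAssumption f U K)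
    (hpolicy : mdp.PolicyAssumption f π K) (θ₁ θ₂ : Vec d) (s : S) :
    |mdp.v f π θ₁ s - mdp.v f π θ₂ s| ≤ K.Lπ * mdp.Cq K / (1 - mdp.γ) * ‖θ₁ - θ₂‖ := by
  rw [mdp.v_eq f π hR, mdp.v_eq f π hR]
  have h1 : ∀ s, |mdp.polReward f π θ₁ s - mdp.polReward f π θ₂ s|
      ≤ K.Lr * (K.Lπ * ‖θ₁ - θ₂‖) := fun s =>
    (henv.reward _ (π.mem _ _) _ (π.mem _ _) s).trans
      (mul_le_mul_of_nonneg_left (hpolicy.lipschitz _ _ _) henv.Lr_pos.le)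
  refine (abs_discValue_sub_le mdp.γ_nonneg mdp.γ_lt_one (mdp.polReward_bddMeas f π hR θ₁)
    (mdp.polReward_bddMeas f π hR θ₂) h1
    (mdp.abs_kop_polKernel_sub_le f π henv hpolicy θ₁ θ₂) s).trans (le_of_eq ?_)
  rw [Cq]
  ring

/-- Performance difference lemma. -/
theorem J_sub_eq {Rmax : ℝ} (hR : mdp.RewardBounded Rmax) (θ θ' : Vec d) :
    mdp.J f π θ' - mdp.J f π θ =
      ∫ s, (mdp.q f π θ s (π θ' s) - mdp.q f π θ s (π θ s)) ∂(mdp.occ f π θ') := by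
  have hv := mdp.v_bddMeas f π hR θ
  have hr := mdp.polReward_bddMeas f π hR θ'
  -- `J θ = ∫ v_θ ∂d0` becomes an integral of `v_θ - γ P_θ' v_θ` against the occupancy measure of
  -- `θ'`. Subtracted from the reward of `π_θ'`, this integrand leaves the advantage of `π_θ'` over
  -- `π_θ`.
  rw [mdp.J_eq f π hR, mdp.J_eq f π hR θ, mdp.v_eq f π hR θ',
    ← integral_discOcc mdp.γ_nonneg mdp.γ_lt_one hr,
    ← integral_discOcc_sub (P := mdp.polKernel f π θ') mdp.γ_nonneg mdp.γ_lt_one hv, ← occ_eq,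
    ← integral_sub (hr.integrable _) ((hv.sub (hv.kop.const_mul _)).integrable _)]
  refine integral_congr_ae (ae_of_all _ fun s => ?_)
  simp only [mdp.q_self f π hR, mdp.q_eq f π hR θ s (π θ' s), mdp.kop_polKernel f π θ' hv,
    polReward]
  ring

end Kernels
end MDP
end DPPG
end

noncomputable section
namespace DPPG

/-! ### Calculus and measurability preliminaries -/

theorem measurable_of_inner {X : Type*} [MeasurableSpace X] {n : ℕ} {g : X → Vec n}
    (h : ∀ x : Vec n, Measurable fun t => inner ℝ (g t) x) : Measurable g := by
  have e : g = fun t => ∑ i, (inner ℝ (g t) (EuclideanSpace.basisFun (Fin n) ℝ i)) •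
      EuclideanSpace.basisFun (Fin n) ℝ i := by
    funext t
    conv_lhs => rw [← (EuclideanSpace.basisFun (Fin n) ℝ).sum_repr' (g t)]
    exact Finset.sum_congr rfl fun i _ => by rw [real_inner_comm]
  rw [e]
  exact Finset.measurable_sum _ fun i _ => (h _).smul_const _

/-- In finite dimension an operator is a continuous function of its values on an orthonormal basis.
-/
theorem measurable_clm_of_apply {X : Type*} [MeasurableSpace X] {m n : ℕ}
    {T : X → Vec m →L[ℝ] Vec n} (h : ∀ x : Vec m, Measurable fun t => T t x) :
    Measurable T := by
  have e : T = fun t => ∑ i, ContinuousLinearMap.smulRightL ℝ (Vec m) (Vec n)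
      (innerSL ℝ (EuclideanSpace.basisFun (Fin m) ℝ i)) (T t (EuclideanSpace.basisFun (Fin m) ℝ i)) := by
    funext t
    ext1 x
    conv_lhs => rw [← (EuclideanSpace.basisFun (Fin m) ℝ).sum_repr' x, map_sum]
    simp only [sum_apply]
    exact Finset.sum_congr rfl fun i _ => by simp
  rw [e]
  exact Finset.measurable_sum _ fun i _ =>
    (ContinuousLinearMap.continuous _).measurable.comp (h _)

/-- A gradient that is continuous on a set contained in the closure of its interior inherits the
Lipschitz bound of the function. -/
theorem norm_gradient_le_of_lipschitz {n : ℕ} {U : Set (Vec n)} (hU : U ⊆ closure (interior U))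
    {F : Vec n → ℝ} {G : Vec n → Vec n} {c : ℝ} (hc : 0 ≤ c)
    (hG : ∀ u ∈ U, HasGradientWithinAt F (G u) U u) (hGc : ContinuousOn G U)
    (hF : ∀ u₁ ∈ U, ∀ u₂ ∈ U, |F u₁ - F u₂| ≤ c * ‖u₁ - u₂‖) {u : Vec n} (hu : u ∈ U) :
    ‖G u‖ ≤ c := by
  have h1 : ∀ x ∈ interior U, ‖G x‖ ≤ c := fun x hx => by
    have hd : HasGradientAt F (G x) x :=
      (hG x (interior_subset hx)).hasFDerivWithinAt.hasFDerivAt (mem_interior_iff_mem_nhds.1 hx)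
    have := HasFDerivAt.le_of_lip' hd.hasFDerivAt hc
      (by
        filter_upwards [mem_interior_iff_mem_nhds.1 hx] with y hy
        exact hF y hy x (interior_subset hx))
    simpa using this
  have : (𝓝[interior U] u).NeBot := mem_closure_iff_nhdsWithin_neBot.1 (hU hu)
  have h2 : Tendsto (fun x => ‖G x‖) (𝓝[interior U] u) (𝓝 ‖G u‖) :=
    ((hGc u hu).mono interior_subset).norm
  exact le_of_tendsto h2 (eventually_nhdsWithin_of_forall h1)

theorem hasGradientAt_of_quadratic {E : Type*} [NormedAddCommGroup E] [InnerProductSpace ℝ E]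
    [CompleteSpace E] {F : E → ℝ} {G x : E} {C : ℝ}
    (h : ∀ y, |F y - F x - inner ℝ G (y - x)| ≤ C * ‖y - x‖ ^ 2) : HasGradientAt F G x := by
  rw [hasGradientAt_iff_isLittleO]
  refine Asymptotics.IsBigO.trans_isLittleO (g := fun y => ‖y - x‖ ^ 2) ?_
    (Asymptotics.isLittleO_pow_sub_sub x one_lt_two)
  refine Asymptotics.IsBigO.of_bound C (Eventually.of_forall fun y => ?_)
  simpa using h y

/-- First-order expansion with Lipschitz derivative, coarse constant. -/
theorem abs_sub_sub_inner_le {E : Type*} [NormedAddCommGroup E] [InnerProductSpace ℝ E]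
    [CompleteSpace E] {F : E → ℝ} {G : E → E} {C : ℝ}
    (hF : ∀ x, HasGradientAt F (G x) x) (x : E) (hG : ∀ y, ‖G y - G x‖ ≤ C * ‖y - x‖) (y : E) :
    |F y - F x - inner ℝ (G x) (y - x)| ≤ C * ‖y - x‖ ^ 2 := by
  have hC : ∀ z ∈ Metric.closedBall x ‖y - x‖,
      ‖InnerProductSpace.toDual ℝ E (G z) - InnerProductSpace.toDual ℝ E (G x)‖
        ≤ |C| * ‖y - x‖ := fun z hz => by
    rw [← map_sub, LinearIsometryEquiv.norm_map]
    refine (hG z).trans ?_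
    have := mem_closedBall_iff_norm.1 hz
    exact mul_le_mul (le_abs_self C) this (norm_nonneg _) (abs_nonneg C)
  rcases eq_or_ne y x with rfl | hne
  · simp
  have hC0 : 0 ≤ C := by
    have := (norm_nonneg _).trans (hG y)
    exact nonneg_of_mul_nonneg_left this (norm_pos_iff.2 (sub_ne_zero.2 hne))
  -- The gradient is compared only with its value at the centre of the ball, by the worst case on
  -- the ball; this costs the factor `1/2` of the sharp remainder.
  have := (convex_closedBall x ‖y - x‖).norm_image_sub_le_of_norm_hasFDerivWithin_le'
    (fun z _ => (hF z).hasFDerivAt.hasFDerivWithinAt) hC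
    (Metric.mem_closedBall_self (norm_nonneg _)) (mem_closedBall_iff_norm.2 le_rfl)
  rw [abs_of_nonneg hC0] at this
  simpa [pow_two, mul_assoc] using this

/-- Ascent inequality for a function with Lipschitz gradient. -/
theorem sub_sub_inner_ge {E : Type*} [NormedAddCommGroup E] [InnerProductSpace ℝ E]
    [CompleteSpace E] {F : E → ℝ} {G : E → E} {L : ℝ}
    (hF : ∀ x, HasGradientAt F (G x) x) (hG : ∀ x y, ‖G x - G y‖ ≤ L * ‖x - y‖) (x h : E) :
    F x + inner ℝ (G x) h - L / 2 * ‖h‖ ^ 2 ≤ F (x + h) := by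
  -- The quadratic term compensates the largest possible loss of slope `L t ‖h‖²`, so `ψ` is
  -- monotone on `[0, 1]`; the claim is `ψ 0 ≤ ψ 1`.
  let ψ : ℝ → ℝ := fun t => F (x + t • h) - t * inner ℝ (G x) h + L / 2 * ‖h‖ ^ 2 * t ^ 2
  have hψ : ∀ t, HasDerivAt ψ (inner ℝ (G (x + t • h)) h - inner ℝ (G x) h
      + L / 2 * ‖h‖ ^ 2 * (2 * t)) t := fun t => by
    have h1 : HasDerivAt (fun t : ℝ => x + t • h) h t := by
      simpa using ((hasDerivAt_id t).smul_const h).const_add x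
    have h2 := (hF (x + t • h)).hasFDerivAt.comp_hasDerivAt t h1
    have h3 := (h2.sub ((hasDerivAt_id t).mul_const (inner ℝ (G x) h))).add
      (((hasDerivAt_pow 2 t)).const_mul (L / 2 * ‖h‖ ^ 2))
    refine HasDerivAt.congr_deriv h3 ?_
    simp [InnerProductSpace.toDual_apply_apply]
  have hmono : MonotoneOn ψ (Set.Icc 0 1) := by
    refine monotoneOn_of_deriv_nonneg (convex_Icc 0 1)
      (fun t _ => (hψ t).continuousAt.continuousWithinAt)
      (fun t _ => (hψ t).differentiableAt.differentiableWithinAt) fun t ht => ?_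
    rw [interior_Icc] at ht
    rw [(hψ t).deriv, ← inner_sub_left]
    have h4 : ‖G (x + t • h) - G x‖ ≤ L * (t * ‖h‖) := by
      have := hG (x + t • h) x
      rwa [add_sub_cancel_left, norm_smul, Real.norm_of_nonneg ht.1.le] at this
    have h5 := abs_real_inner_le_norm (G (x + t • h) - G x) h
    have h6 := neg_abs_le (inner ℝ (G (x + t • h) - G x) h)
    have h7 := mul_le_mul_of_nonneg_right h4 (norm_nonneg h)
    nlinarith
  have := hmono (Set.left_mem_Icc.2 zero_le_one) (Set.right_mem_Icc.2 zero_le_one) zero_le_one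
  simp only [ψ, zero_smul, add_zero, one_smul, zero_mul, sub_zero] at this
  linarith

namespace MDP

variable {S A : Type*} [MeasurableSpace S] [MeasurableSpace A] (mdp : MDP S A)
  {k d : ℕ} {U : Set (Vec k)} (f : Kernel (Vec k) A) [IsMarkovKernel f] (π : ParamPolicy S U d)
  {K : Consts}

/-! ### The Jacobian of the policy -/

theorem hasFDerivAt_policy (θ : Vec d) (s : S) :
    HasFDerivAt (fun θ' => π θ' s) (π.jac θ s) θ :=
  (π.differentiable s θ).hasFDerivAt

theorem measurable_jac (θ : Vec d) : Measurable (π.jac θ) := by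
  refine measurable_clm_of_apply fun x => ?_
  -- Difference quotients with step `1/n`; the term `n = 0` vanishes and is harmless.
  refine measurable_of_tendsto_metrizable
    (f := fun (n : ℕ) s => (n : ℝ) • (π (θ + (n : ℝ)⁻¹ • x) s - π θ s)) (fun n => ?_) ?_
  · exact ((π.measurable _).sub (π.measurable _)).const_smul (n : ℝ)
  · rw [tendsto_pi_nhds]
    intro s
    exact (hasFDerivAt_policy π θ s).lim x (c := fun n : ℕ => (n : ℝ))
      (by simpa using tendsto_natCast_atTop_atTop)

section Policy

variable (hpolicy : mdp.PolicyAssumption f π K)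
include hpolicy

theorem norm_jac_le (θ : Vec d) (s : S) : ‖π.jac θ s‖ ≤ K.Lπ :=
  HasFDerivAt.le_of_lip' (hasFDerivAt_policy π θ s) hpolicy.Lπ_pos.le
    (Eventually.of_forall fun θ' => hpolicy.lipschitz θ' θ s)

theorem norm_adjoint_jac_le (θ : Vec d) (s : S) :
    ‖ContinuousLinearMap.adjoint (π.jac θ s)‖ ≤ K.Lπ := by
  rw [LinearIsometryEquiv.norm_map]; exact norm_jac_le mdp f π hpolicy θ s

theorem continuous_jac (s : S) : Continuous fun θ => π.jac θ s :=
  (LipschitzWith.of_dist_le_mul (K := ⟨K.Lψ, hpolicy.Lψ_pos.le⟩) fun θ₁ θ₂ => by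
    rw [dist_eq_norm, dist_eq_norm]; exact hpolicy.smooth θ₁ θ₂ s).continuous

theorem measurable_uncurry_jac : Measurable fun x : Vec d × S => π.jac x.1 x.2 :=
  measurable_uncurry_of_continuous_of_measurable (u := fun θ s => π.jac θ s)
    (continuous_jac mdp f π hpolicy) (measurable_jac π)

end Policy

theorem measurable_uncurry_policy : Measurable fun x : Vec d × S => π x.1 x.2 :=
  measurable_uncurry_of_continuous_of_measurable (u := fun θ s => π θ s)
    (fun s => (π.differentiable s).continuous) π.measurable

/-! ### Gradients of the action-value function -/

section GradQ

variable (hU : U ⊆ closure (interior U)) (hR : mdp.RewardBounded K.Rmax)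
  (henv : mdp.EnvAssumption f U K) (hq : mdp.QAssumption f π K)
  (hpolicy : mdp.PolicyAssumption f π K)

theorem hasGradientWithinAt_q (hq : mdp.QAssumption f π K) (θ : Vec d) (s : S) {u : Vec k}
    (hu : u ∈ U) : HasGradientWithinAt (mdp.q f π θ s) (mdp.gradQ f π θ s u) U u :=
  (hq.differentiable θ s u hu).hasGradientWithinAt

theorem continuousOn_gradQ (hq : mdp.QAssumption f π K) (θ : Vec d) (s : S) :
    ContinuousOn (mdp.gradQ f π θ s) U :=
  (LipschitzOnWith.of_dist_le_mul (K := ⟨K.Lq, hq.Lq_pos.le⟩) fun u₁ h₁ u₂ h₂ => by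
    rw [dist_eq_norm, dist_eq_norm]; exact hq.smooth θ s u₁ h₁ u₂ h₂).continuousOn

include hR henv in
theorem abs_q_sub_le (θ : Vec d) (s : S) {u₁ u₂ : Vec k} (h₁ : u₁ ∈ U) (h₂ : u₂ ∈ U) :
    |mdp.q f π θ s u₁ - mdp.q f π θ s u₂| ≤ mdp.Cq K * ‖u₁ - u₂‖ := by
  rw [mdp.q_eq f π hR, mdp.q_eq f π hR]
  have e1 := henv.reward u₁ h₁ u₂ h₂ s
  have e2 := mdp.abs_integral_pTilde_sub_le f henv (mdp.v_bddMeas f π hR θ) s h₁ h₂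
  have e3 := mul_le_mul_of_nonneg_left e2 mdp.γ_nonneg
  rw [← abs_of_nonneg mdp.γ_nonneg, ← abs_mul, abs_of_nonneg mdp.γ_nonneg] at e3
  calc _ = |(mdp.rTilde f s u₁ - mdp.rTilde f s u₂) + mdp.γ *
        (∫ s', mdp.pTilde f s u₁ s' * mdp.v f π θ s' ∂mdp.ref -
          ∫ s', mdp.pTilde f s u₂ s' * mdp.v f π θ s' ∂mdp.ref)| := by ring_nf
    _ ≤ _ := (abs_add_le _ _).trans (add_le_add e1 e3)
    _ = _ := by rw [Cq]; ring

include mdp in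
theorem nonempty_state : Nonempty S := mdp.d0.nonempty_of_neZero

include f in
theorem Rmax_nonneg (hR : mdp.RewardBounded K.Rmax) : 0 ≤ K.Rmax := by
  obtain ⟨s⟩ := mdp.nonempty_state
  exact (abs_nonneg _).trans (mdp.abs_rTilde_le f hR s (0 : Vec k))

include hR henv in
theorem Cq_pos : 0 < mdp.Cq K := by
  have h0 : 0 ≤ K.Rmax := Rmax_nonneg mdp f hR
  have h1 := mdp.one_sub_γ_pos
  have h2 : 0 ≤ mdp.LP K := mul_nonneg mdp.vol_nonneg henv.Lp_pos.le
  have h3 := mdp.γ_nonneg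
  have := henv.Lr_pos
  rw [Cq]
  positivity

include hU hR henv hq in
theorem norm_gradQ_le (θ : Vec d) (s : S) {u : Vec k} (hu : u ∈ U) :
    ‖mdp.gradQ f π θ s u‖ ≤ mdp.Cq K :=
  norm_gradient_le_of_lipschitz hU (Cq_pos mdp f hR henv).le
    (fun _ hu => hasGradientWithinAt_q mdp f π hq θ s hu) (continuousOn_gradQ mdp f π hq θ s)
    (fun _ h₁ _ h₂ => abs_q_sub_le mdp f π hR henv θ s h₁ h₂) hu

include hU hR henv hq hpolicy in
-- The rewards cancel in `q_θ₁ - q_θ₂`, which leaves `γ ∫ pTilde (v_θ₁ - v_θ₂)`. This is Lipschitz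
-- in `u` with constant `γ LP sup |v_θ₁ - v_θ₂|`, and that constant bounds the gradient; no
-- differentiability of `pTilde` in `u` is needed.
theorem norm_gradQ_sub_le (θ₁ θ₂ : Vec d) (s : S) {u : Vec k} (hu : u ∈ U) :
    ‖mdp.gradQ f π θ₁ s u - mdp.gradQ f π θ₂ s u‖ ≤
      mdp.γ * mdp.LP K * (K.Lπ * mdp.Cq K / (1 - mdp.γ)) * ‖θ₁ - θ₂‖ := by
  have hLP : 0 ≤ mdp.LP K := mul_nonneg mdp.vol_nonneg henv.Lp_pos.le
  have hγ := mdp.γ_nonneg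
  have hg := mdp.one_sub_γ_pos
  have hC := Cq_pos mdp f hR henv
  have hL := hpolicy.Lπ_pos
  refine norm_gradient_le_of_lipschitz hU
    (F := fun u => mdp.q f π θ₁ s u - mdp.q f π θ₂ s u)
    (G := fun u => mdp.gradQ f π θ₁ s u - mdp.gradQ f π θ₂ s u) (by positivity)
    (fun u hu => ?_)
    ((continuousOn_gradQ mdp f π hq θ₁ s).sub (continuousOn_gradQ mdp f π hq θ₂ s))
    (fun u₁ h₁ u₂ h₂ => ?_) hu
  · have := (hasGradientWithinAt_q mdp f π hq θ₁ s hu).hasFDerivWithinAt.sub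
      (hasGradientWithinAt_q mdp f π hq θ₂ s hu).hasFDerivWithinAt
    rw [hasGradientWithinAt_iff_hasFDerivWithinAt, map_sub]
    exact this
  · have hv : BddMeas (fun s => mdp.v f π θ₁ s - mdp.v f π θ₂ s)
        (K.Lπ * mdp.Cq K / (1 - mdp.γ) * ‖θ₁ - θ₂‖) :=
      ⟨(mdp.v_bddMeas f π hR θ₁).meas.sub (mdp.v_bddMeas f π hR θ₂).meas,
        mdp.abs_v_sub_le f π hR henv hpolicy θ₁ θ₂⟩
    have h1 : ∀ u, mdp.q f π θ₁ s u - mdp.q f π θ₂ s u =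
        mdp.γ * ∫ s', mdp.pTilde f s u s' * (mdp.v f π θ₁ s' - mdp.v f π θ₂ s') ∂mdp.ref := by
      intro u
      simp_rw [mul_sub]
      rw [integral_sub (mdp.integrable_pTilde_mul f (mdp.v_bddMeas f π hR θ₁) s u)
        (mdp.integrable_pTilde_mul f (mdp.v_bddMeas f π hR θ₂) s u), mdp.q_eq f π hR,
        mdp.q_eq f π hR]
      ring
    rw [h1, h1, ← mul_sub, abs_mul, abs_of_nonneg hγ]
    refine (mul_le_mul_of_nonneg_left
      (mdp.abs_integral_pTilde_sub_le f henv hv s h₁ h₂) hγ).trans (le_of_eq ?_)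
    ring

include hR in
theorem measurable_q (θ : Vec d) (u : Vec k) : Measurable fun s => mdp.q f π θ s u := by
  have h1 : Measurable fun y : ℝ × S => y.1 + mdp.γ * mdp.v f π θ y.2 :=
    measurable_fst.add (((mdp.v_bddMeas f π hR θ).meas.comp measurable_snd).const_mul _)
  exact ((h1.stronglyMeasurable.integral_kernel (κ := mdp.paramStep f)).measurable).comp
    (measurable_id.prodMk measurable_const)

include hU hR hq in
-- At interior points the gradient is a limit of difference quotients. A boundary point is a limit
-- of interior ones, and continuity of the gradient in `u` carries measurability over.
theorem measurable_gradQ (θ : Vec d) {u : Vec k} (hu : u ∈ U) :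
    Measurable fun s => mdp.gradQ f π θ s u := by
  have h1 : ∀ u ∈ interior U, Measurable fun s => mdp.gradQ f π θ s u := fun u hu => by
    refine measurable_of_inner fun x => ?_
    refine measurable_of_tendsto_metrizable
      (f := fun (n : ℕ) s => (n : ℝ) • (mdp.q f π θ s (u + (n : ℝ)⁻¹ • x) - mdp.q f π θ s u))
      (fun n => ?_) ?_
    · exact ((measurable_q mdp f π hR θ _).sub (measurable_q mdp f π hR θ _)).const_smul (n : ℝ)
    · rw [tendsto_pi_nhds]
      intro s
      have hd : HasFDerivAt (mdp.q f π θ s)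
          (InnerProductSpace.toDual ℝ (Vec k) (mdp.gradQ f π θ s u)) u :=
        (hasGradientWithinAt_q mdp f π hq θ s (interior_subset hu)).hasFDerivWithinAt.hasFDerivAt
          (mem_interior_iff_mem_nhds.1 hu)
      simpa using hd.lim x (c := fun n : ℕ => (n : ℝ))
        (by simpa using tendsto_natCast_atTop_atTop)
  obtain ⟨x, hx, hxu⟩ := mem_closure_iff_seq_limit.1 (hU hu)
  refine measurable_of_tendsto_metrizable (f := fun n s => mdp.gradQ f π θ s (x n))
    (fun n => h1 _ (hx n)) ?_
  rw [tendsto_pi_nhds]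
  intro s
  exact (continuousOn_gradQ mdp f π hq θ s u hu).tendsto.comp
    (tendsto_nhdsWithin_iff.2 ⟨hxu, Eventually.of_forall fun n => interior_subset (hx n)⟩)

include hU hR hq in
-- A Carathéodory argument: the gradient is continuous in `u ∈ U` and measurable in `s`, hence
-- jointly measurable, and can be composed with `s ↦ (π_θ(s), s)`.
theorem measurable_gradQ_policy (θ : Vec d) :
    Measurable fun s => mdp.gradQ f π θ s (π θ s) := by
  have h1 : Measurable fun x : U × S => mdp.gradQ f π θ x.2 (x.1 : Vec k) :=
    measurable_uncurry_of_continuous_of_measurable (ι := U) (β := Vec k)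
      (u := fun u s => mdp.gradQ f π θ s (u : Vec k))
      (fun s => continuousOn_iff_continuous_domRestrict.1 (continuousOn_gradQ mdp f π hq θ s))
      (fun u => measurable_gradQ mdp f π hU hR hq θ u.2)
  have h2 : Measurable fun s => ((⟨π θ s, π.mem θ s⟩ : U), s) :=
    Measurable.prodMk (Measurable.subtype_mk (π.measurable θ)) measurable_id
  have h3 : Measurable ((fun x : U × S => mdp.gradQ f π θ x.2 (x.1 : Vec k)) ∘
    fun s => ((⟨π θ s, π.mem θ s⟩ : U), s)) := h1.comp h2
  simp only [Function.comp_def] at h3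
  exact h3

/-! ### The deterministic policy gradient -/

/-- Integrand of the policy gradient. -/
def polGrad (θ : Vec d) (s : S) : Vec d :=
  ContinuousLinearMap.adjoint (π.jac θ s) (mdp.gradQ f π θ s (π θ s))

theorem inner_polGrad (θ : Vec d) (s : S) (x : Vec d) :
    inner ℝ (mdp.polGrad f π θ s) x = inner ℝ (mdp.gradQ f π θ s (π θ s)) (π.jac θ s x) :=
  ContinuousLinearMap.adjoint_inner_left _ _ _

include hU hR hq in
theorem measurable_polGrad (θ : Vec d) : Measurable (mdp.polGrad f π θ) := by
  refine measurable_of_inner fun x => ?_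
  simp_rw [inner_polGrad]
  exact (measurable_gradQ_policy mdp f π hU hR hq θ).inner
    ((ContinuousLinearMap.apply ℝ (Vec k) x).continuous.measurable.comp (measurable_jac π θ))

include hU hR henv hq hpolicy in
theorem norm_polGrad_le (θ : Vec d) (s : S) : ‖mdp.polGrad f π θ s‖ ≤ K.Lπ * mdp.Cq K :=
  (ContinuousLinearMap.le_opNorm _ _).trans
    (mul_le_mul (norm_adjoint_jac_le mdp f π hpolicy θ s)
      (norm_gradQ_le mdp f π hU hR henv hq θ s (π.mem θ s)) (norm_nonneg _) hpolicy.Lπ_pos.le)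

/-- The policy gradient. -/
def gradJ (θ : Vec d) : Vec d := ∫ s, mdp.polGrad f π θ s ∂(mdp.occ f π θ)

include hU hR henv hq hpolicy in
theorem integrable_polGrad (θ : Vec d) (μ : Measure S) [IsFiniteMeasure μ] :
    Integrable (mdp.polGrad f π θ) μ :=
  Integrable.of_bound (measurable_polGrad mdp f π hU hR hq θ).aestronglyMeasurable _
    (ae_of_all _ (norm_polGrad_le mdp f π hU hR henv hq hpolicy θ))

include hU hR henv hq hpolicy in
theorem norm_gradJ_le (θ : Vec d) : ‖mdp.gradJ f π θ‖ ≤ K.Lπ * mdp.Cq K / (1 - mdp.γ) := by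
  have := norm_integral_le_of_norm_le_const (μ := mdp.occ f π θ)
    (ae_of_all _ (norm_polGrad_le mdp f π hU hR henv hq hpolicy θ))
  rwa [occ_real_univ, mul_one_div] at this

/-- The chain rule requires differentiability of `q` only within `U`, because the policy never
leaves `U`. The result is a derivative on all of parameter space, whatever the boundary of `U`. -/
theorem hasGradientAt_q_policy (hq : mdp.QAssumption f π K) (θ₀ θ : Vec d) (s : S) :
    HasGradientAt (fun θ => mdp.q f π θ₀ s (π θ s))
      (ContinuousLinearMap.adjoint (π.jac θ s) (mdp.gradQ f π θ₀ s (π θ s))) θ := by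
  have h1 := (hasGradientWithinAt_q mdp f π hq θ₀ s (π.mem θ s)).hasFDerivWithinAt
  have h2 := h1.comp_hasFDerivAt θ (hasFDerivAt_policy π θ s)
    (Eventually.of_forall fun θ' => π.mem θ' s)
  rw [hasGradientAt_iff_hasFDerivAt]
  refine HasFDerivAt.congr_fderiv h2 ?_
  ext x
  simp [InnerProductSpace.toDual_apply_apply, ContinuousLinearMap.adjoint_inner_left]

include hU hR henv hq hpolicy in
theorem norm_adjoint_gradQ_sub_le (θ₀ θ₁ θ₂ : Vec d) (s : S) :
    ‖ContinuousLinearMap.adjoint (π.jac θ₁ s) (mdp.gradQ f π θ₀ s (π θ₁ s)) -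
      ContinuousLinearMap.adjoint (π.jac θ₂ s) (mdp.gradQ f π θ₀ s (π θ₂ s))‖ ≤
      (K.Lψ * mdp.Cq K + K.Lπ * (K.Lq * K.Lπ)) * ‖θ₁ - θ₂‖ := by
  have e : ContinuousLinearMap.adjoint (π.jac θ₁ s) (mdp.gradQ f π θ₀ s (π θ₁ s)) -
      ContinuousLinearMap.adjoint (π.jac θ₂ s) (mdp.gradQ f π θ₀ s (π θ₂ s)) =
      ContinuousLinearMap.adjoint (π.jac θ₁ s - π.jac θ₂ s) (mdp.gradQ f π θ₀ s (π θ₁ s)) +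
      ContinuousLinearMap.adjoint (π.jac θ₂ s)
        (mdp.gradQ f π θ₀ s (π θ₁ s) - mdp.gradQ f π θ₀ s (π θ₂ s)) := by
    rw [map_sub, map_sub, sub_apply]; abel
  have hLπ := hpolicy.Lπ_pos.le
  rw [e]
  refine (norm_add_le _ _).trans ?_
  rw [add_mul]
  refine add_le_add ?_ ?_
  · refine (ContinuousLinearMap.le_opNorm _ _).trans ?_
    rw [LinearIsometryEquiv.norm_map, mul_right_comm]
    exact mul_le_mul (hpolicy.smooth _ _ _)
      (norm_gradQ_le mdp f π hU hR henv hq θ₀ s (π.mem θ₁ s)) (norm_nonneg _)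
      (mul_nonneg hpolicy.Lψ_pos.le (norm_nonneg _))
  · refine (ContinuousLinearMap.le_opNorm _ _).trans ?_
    rw [mul_assoc, mul_assoc]
    refine mul_le_mul (norm_adjoint_jac_le mdp f π hpolicy θ₂ s) ?_ (norm_nonneg _) hLπ
    exact (hq.smooth _ _ _ (π.mem _ _) _ (π.mem _ _)).trans
      (mul_le_mul_of_nonneg_left (hpolicy.lipschitz _ _ _) hq.Lq_pos.le)

include hU hR henv hq hpolicy in
/-- Deterministic policy gradient theorem. -/
theorem hasGradientAt_J (θ : Vec d) : HasGradientAt (mdp.J f π) (mdp.gradJ f π θ) θ := by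
  refine hasGradientAt_of_quadratic (C := mdp.Lν K * (mdp.Cq K * K.Lπ) +
    (K.Lψ * mdp.Cq K + K.Lπ * (K.Lq * K.Lπ)) / (1 - mdp.γ)) fun θ' => ?_
  have hCq := (Cq_pos mdp f hR henv).le
  have hqm : ∀ θ', Measurable fun s => mdp.q f π θ s (π θ' s) := fun θ' => by
    have h1 : Measurable fun y : ℝ × S => y.1 + mdp.γ * mdp.v f π θ y.2 :=
      measurable_fst.add (((mdp.v_bddMeas f π hR θ).meas.comp measurable_snd).const_mul _)
    exact ((h1.stronglyMeasurable.integral_kernel (κ := mdp.paramStep f)).measurable).comp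
      (measurable_id.prodMk (π.measurable θ'))
  have hD : BddMeas (fun s => mdp.q f π θ s (π θ' s) - mdp.q f π θ s (π θ s))
      (mdp.Cq K * (K.Lπ * ‖θ' - θ‖)) :=
    ⟨(hqm θ').sub (hqm θ), fun s => (abs_q_sub_le mdp f π hR henv θ s (π.mem _ _)
      (π.mem _ _)).trans (mul_le_mul_of_nonneg_left (hpolicy.lipschitz _ _ _) hCq)⟩
  have hi := integrable_polGrad mdp f π hU hR henv hq hpolicy θ (mdp.occ f π θ)
  -- Replacing the occupancy measure of `θ'` by that of `θ` costs `Lν ‖θ' - θ‖` times the bound on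
  -- the integrand, itself of order `‖θ' - θ‖`: a second-order error.
  have h1 := mdp.abs_integral_occ_sub_le f π henv hpolicy hD θ' θ
  have hE : BddMeas (fun s => mdp.q f π θ s (π θ' s) - mdp.q f π θ s (π θ s) -
      inner ℝ (mdp.polGrad f π θ s) (θ' - θ))
      ((K.Lψ * mdp.Cq K + K.Lπ * (K.Lq * K.Lπ)) * ‖θ' - θ‖ ^ 2) :=
    ⟨hD.meas.sub ((measurable_polGrad mdp f π hU hR hq θ).inner measurable_const), fun s =>
      abs_sub_sub_inner_le (fun θ' => hasGradientAt_q_policy mdp f π hq θ θ' s) θ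
        (fun θ' => norm_adjoint_gradQ_sub_le mdp f π hU hR henv hq hpolicy θ θ' θ s) θ'⟩
  have h2 := mdp.abs_integral_occ_le f π hE θ
  rw [integral_sub (hD.integrable _) (hi.inner_const _)] at h2
  simp_rw [real_inner_comm (θ' - θ)] at h2
  rw [integral_inner hi, ← gradJ, real_inner_comm] at h2
  rw [mdp.J_sub_eq f π hR θ θ']
  refine (abs_sub_le _ _ _).trans ((add_le_add h1 h2).trans (le_of_eq ?_))
  ring

end GradQ
end MDP
end DPPG
end

/-! ### Coercivity of symmetric operators with eigenvalues bounded below -/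

noncomputable section
namespace DPPG

/-- A symmetric operator on a Euclidean space whose eigenvalues are at least `c` is coercive. -/
theorem inner_ge_of_eigenvalue_ge {n : ℕ} {T : Vec n →ₗ[ℝ] Vec n} (hT : T.IsSymmetric) {c : ℝ}
    (hc : ∀ μ : ℝ, Module.End.HasEigenvalue T μ → c ≤ μ) (x : Vec n) :
    c * ‖x‖ ^ 2 ≤ inner ℝ (T x) x := by
  have hn : Module.finrank ℝ (Vec n) = n := by simp
  have h1 : ∀ i, inner ℝ (T x) (hT.eigenvectorBasis hn i) =
      hT.eigenvalues hn i * inner ℝ x (hT.eigenvectorBasis hn i) := fun i => by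
    rw [hT, hT.apply_eigenvectorBasis, inner_smul_right]; simp
  rw [← (hT.eigenvectorBasis hn).sum_sq_norm_inner_left x, Finset.mul_sum,
    ← (hT.eigenvectorBasis hn).sum_inner_mul_inner (T x) x]
  refine Finset.sum_le_sum fun i _ => ?_
  rw [h1, real_inner_comm x, Real.norm_eq_abs, sq_abs]
  have h4 := mul_le_mul_of_nonneg_right (hc _ (hT.hasEigenvalue_eigenvalues hn i))
    (sq_nonneg (inner ℝ x (hT.eigenvectorBasis hn i)))
  calc _ ≤ _ := h4
    _ = _ := by simp; ring

theorem norm_le_of_inner_le {E : Type*} [NormedAddCommGroup E] [InnerProductSpace ℝ E] {v : E}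
    {c : ℝ} (hc : 0 ≤ c) (h : ∀ x, inner ℝ v x ≤ c * ‖x‖) : ‖v‖ ≤ c := by
  rcases eq_or_ne v 0 with rfl | hv
  · simpa using hc
  · have := h v
    rw [real_inner_self_eq_norm_sq, pow_two] at this
    exact le_of_mul_le_mul_right this (norm_pos_iff.2 hv)

namespace MDP

variable {S A : Type*} [MeasurableSpace S] [MeasurableSpace A] (mdp : MDP S A)
  {k d : ℕ} {U : Set (Vec k)} (f : Kernel (Vec k) A) [IsMarkovKernel f] (π : ParamPolicy S U d)
  {K : Consts}

/-! ### Lipschitz constants -/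

/-- Lipschitz constant of the policy gradient. -/
def lipGradJ (K : Consts) : ℝ :=
  mdp.Lν K * (K.Lπ * mdp.Cq K) + (K.Lψ * mdp.Cq K + K.Lπ * (K.Lq * K.Lπ) +
    K.Lπ * (mdp.γ * mdp.LP K * (K.Lπ * mdp.Cq K / (1 - mdp.γ)))) / (1 - mdp.γ)

/-- Lipschitz constant of `Ψ`. -/
def lipPsi (K : Consts) : ℝ := K.Lπ ^ 2 * mdp.Lν K + 2 * K.Lπ * K.Lψ / (1 - mdp.γ)

/-- Lipschitz constant of the compatible weights. -/
def lipWeight (K : Consts) : ℝ :=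
  mdp.lipGradJ K / K.lamΨ + K.Lπ * mdp.Cq K / (K.lamΨ ^ 2 * (1 - mdp.γ)) * mdp.lipPsi K

theorem Lν_nonneg (henv : mdp.EnvAssumption f U K) (hpolicy : mdp.PolicyAssumption f π K) :
    0 ≤ mdp.Lν K := by
  have h1 := mdp.one_sub_γ_pos
  have h2 : 0 ≤ mdp.LP K := mul_nonneg mdp.vol_nonneg henv.Lp_pos.le
  have h3 := mdp.γ_nonneg
  have := hpolicy.Lπ_pos
  rw [Lν, Cν]
  positivity

section Lip

variable (hU : U ⊆ closure (interior U)) (hR : mdp.RewardBounded K.Rmax)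
  (henv : mdp.EnvAssumption f U K) (hq : mdp.QAssumption f π K)
  (hpolicy : mdp.PolicyAssumption f π K)

theorem lipPsi_nonneg (henv : mdp.EnvAssumption f U K) (hpolicy : mdp.PolicyAssumption f π K) :
    0 ≤ mdp.lipPsi K := by
  have h1 := mdp.one_sub_γ_pos
  have h2 := mdp.Lν_nonneg f π henv hpolicy
  have := hpolicy.Lπ_pos
  have := hpolicy.Lψ_pos
  rw [lipPsi]
  positivity

include hR henv hq hpolicy

theorem lipGradJ_pos : 0 < mdp.lipGradJ K := by
  have h1 := mdp.one_sub_γ_pos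
  have h2 : 0 ≤ mdp.LP K := mul_nonneg mdp.vol_nonneg henv.Lp_pos.le
  have h3 := mdp.γ_nonneg
  have h4 := mdp.Lν_nonneg f π henv hpolicy
  have h5 := mdp.Cq_pos f hR henv
  have := hpolicy.Lπ_pos
  have := hpolicy.Lψ_pos
  have := hq.Lq_pos
  rw [lipGradJ]
  positivity

/-- By `e3` the term of `lipGradJ` from the occupancy measure equals the one from the change of `q`
with `θ`. By `e2`, `LJ` contains that quantity once, so `2 * LJ` covers both copies, and everything
left over is nonnegative. -/
theorem lipGradJ_le : mdp.lipGradJ K ≤ 2 * mdp.LJ K := by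
  have h1 := mdp.one_sub_γ_pos
  have h2 : 0 ≤ mdp.LP K := mul_nonneg mdp.vol_nonneg henv.Lp_pos.le
  have h3 := mdp.γ_nonneg
  have h4 := mdp.Lν_nonneg f π henv hpolicy
  have h5 := mdp.Cq_pos f hR henv
  have := hpolicy.Lπ_pos
  have := hpolicy.Lψ_pos
  have := hq.Lq_pos
  have hCν : 0 ≤ mdp.Cν := by rw [Cν]; positivity
  have e : 2 * mdp.LJ K - mdp.lipGradJ K =
      mdp.LP K * K.Lπ ^ 2 * mdp.Lν K * mdp.Cν * mdp.Cq K + K.Lψ * mdp.Cq K / (1 - mdp.γ)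
        + K.Lπ * (K.Lq * K.Lπ) / (1 - mdp.γ) := by
    rw [LJ, lipGradJ]
    have e1 : K.Lr + mdp.γ * K.Rmax * mdp.LP K / (1 - mdp.γ) = mdp.Cq K := by rw [Cq]; ring
    have e2 : mdp.γ / 2 * mdp.LP K ^ 2 * K.Rmax * K.Lπ * mdp.Cν
        + mdp.γ * mdp.LP K * K.Lr * K.Lπ / (1 - mdp.γ) =
        mdp.γ * mdp.LP K * K.Lπ * mdp.Cq K / (1 - mdp.γ) := by
      rw [Cq, Cν]
      field_simp
      ring
    have e3 : mdp.Lν K * (K.Lπ * mdp.Cq K) =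
        K.Lπ * (mdp.γ * mdp.LP K * (K.Lπ * mdp.Cq K / (1 - mdp.γ))) / (1 - mdp.γ) := by
      rw [Lν, Cν]
      field_simp
    rw [e1, add_assoc (K.Lq * K.Lπ), e2, e3]
    field_simp
    ring
  have : 0 ≤ 2 * mdp.LJ K - mdp.lipGradJ K := by rw [e]; positivity
  linarith

theorem LJ_pos : 0 < mdp.LJ K := by
  have h1 := mdp.lipGradJ_pos f π hR henv hq hpolicy
  have h2 := mdp.lipGradJ_le f π hR henv hq hpolicy
  linarith

theorem lipWeight_le : mdp.lipWeight K ≤ 2 * mdp.Lw K := by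
  have h1 := mdp.one_sub_γ_pos
  have h2 := mdp.lipPsi_nonneg f π henv hpolicy
  have h3 := mdp.Cq_pos f hR henv
  have h4 := hpolicy.Lπ_pos
  have h5 := hpolicy.lamΨ_pos
  have h6 := mdp.lipGradJ_le f π hR henv hq hpolicy
  have h7 : mdp.lipGradJ K / K.lamΨ ≤ 2 * mdp.LJ K / K.lamΨ := by gcongr
  have h8 : 0 ≤ K.Lπ * mdp.Cq K / (K.lamΨ ^ 2 * (1 - mdp.γ)) * mdp.lipPsi K := by positivity
  rw [lipWeight, Lw, ← lipPsi]
  rw [mul_div_assoc] at h7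
  linarith

theorem lipWeight_pos : 0 < mdp.lipWeight K := by
  have h1 := mdp.one_sub_γ_pos
  have h2 := mdp.lipPsi_nonneg f π henv hpolicy
  have h3 := mdp.Cq_pos f hR henv
  have h4 := hpolicy.Lπ_pos
  have h5 := hpolicy.lamΨ_pos
  have h6 := mdp.lipGradJ_pos f π hR henv hq hpolicy
  rw [lipWeight]
  positivity

theorem Lw_pos : 0 < mdp.Lw K := by
  have h1 := mdp.lipWeight_pos f π hR henv hq hpolicy
  have h2 := mdp.lipWeight_le f π hR henv hq hpolicy
  linarith

omit hR hq in
/-- Perturbation of the integral of a vector-valued function against the occupancy measure. -/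
theorem norm_integral_occ_sub_le {H₁ H₂ : S → Vec d} (hm₁ : Measurable H₁) (hm₂ : Measurable H₂)
    {B δ : ℝ} (hB : 0 ≤ B) (hb₁ : ∀ s, ‖H₁ s‖ ≤ B) (hb₂ : ∀ s, ‖H₂ s‖ ≤ B)
    (θ₁ θ₂ : Vec d) (hδ : ∀ s, ‖H₁ s - H₂ s‖ ≤ δ) :
    ‖∫ s, H₁ s ∂(mdp.occ f π θ₁) - ∫ s, H₂ s ∂(mdp.occ f π θ₂)‖ ≤
      mdp.Lν K * ‖θ₁ - θ₂‖ * B + δ / (1 - mdp.γ) := by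
  have hi₁ : ∀ θ, Integrable H₁ (mdp.occ f π θ) := fun θ =>
    Integrable.of_bound hm₁.aestronglyMeasurable B (ae_of_all _ hb₁)
  have hi₂ : ∀ θ, Integrable H₂ (mdp.occ f π θ) := fun θ =>
    Integrable.of_bound hm₂.aestronglyMeasurable B (ae_of_all _ hb₂)
  have h1 : ‖∫ s, H₁ s ∂(mdp.occ f π θ₁) - ∫ s, H₁ s ∂(mdp.occ f π θ₂)‖ ≤
      mdp.Lν K * ‖θ₁ - θ₂‖ * B := by
    have hL := mdp.Lν_nonneg f π henv hpolicy
    -- Testing against each vector `x` reduces the bound to the scalar perturbation estimate,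
    -- without a dimensional factor.
    refine norm_le_of_inner_le (by positivity) fun x => ?_
    have hx : BddMeas (fun s => inner ℝ x (H₁ s)) (‖x‖ * B) :=
      ⟨measurable_const.inner hm₁, fun s => (abs_real_inner_le_norm _ _).trans
        (mul_le_mul_of_nonneg_left (hb₁ s) (norm_nonneg _))⟩
    have := (le_abs_self _).trans (mdp.abs_integral_occ_sub_le f π henv hpolicy hx θ₁ θ₂)
    rw [integral_inner (hi₁ _), integral_inner (hi₁ _), ← inner_sub_right, real_inner_comm] at this
    linarith
  have h2 : ‖∫ s, H₁ s ∂(mdp.occ f π θ₂) - ∫ s, H₂ s ∂(mdp.occ f π θ₂)‖ ≤ δ / (1 - mdp.γ) := by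
    rw [← integral_sub (hi₁ _) (hi₂ _)]
    have := norm_integral_le_of_norm_le_const (μ := mdp.occ f π θ₂) (ae_of_all _ hδ)
    rwa [occ_real_univ, mul_one_div] at this
  calc _ ≤ _ := norm_sub_le_norm_sub_add_norm_sub _ (∫ s, H₁ s ∂(mdp.occ f π θ₂)) _
    _ ≤ _ := add_le_add h1 h2

include hU in
theorem norm_gradJ_sub_le (θ₁ θ₂ : Vec d) :
    ‖mdp.gradJ f π θ₁ - mdp.gradJ f π θ₂‖ ≤ mdp.lipGradJ K * ‖θ₁ - θ₂‖ := by
  have hC := mdp.Cq_pos f hR henv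
  have hL := hpolicy.Lπ_pos
  refine (mdp.norm_integral_occ_sub_le f π henv hpolicy
    (mdp.measurable_polGrad f π hU hR hq θ₁)
    (mdp.measurable_polGrad f π hU hR hq θ₂) (mul_pos hL hC).le
    (mdp.norm_polGrad_le f π hU hR henv hq hpolicy θ₁)
    (mdp.norm_polGrad_le f π hU hR henv hq hpolicy θ₂) θ₁ θ₂
    (δ := (K.Lψ * mdp.Cq K + K.Lπ * (K.Lq * K.Lπ)) * ‖θ₁ - θ₂‖ +
      K.Lπ * (mdp.γ * mdp.LP K * (K.Lπ * mdp.Cq K / (1 - mdp.γ)) * ‖θ₁ - θ₂‖))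
    fun s => ?_).trans (le_of_eq ?_)
  -- The intermediate term has the policy and Jacobian of `θ₂` but the action-value function of
  -- `θ₁`, so that the two dependences on `θ` are changed one at a time.
  · refine (norm_sub_le_norm_sub_add_norm_sub _
      (ContinuousLinearMap.adjoint (π.jac θ₂ s) (mdp.gradQ f π θ₁ s (π θ₂ s))) _).trans
      (add_le_add (mdp.norm_adjoint_gradQ_sub_le f π hU hR henv hq hpolicy θ₁ θ₁ θ₂ s) ?_)
    rw [polGrad, ← map_sub]
    refine (ContinuousLinearMap.le_opNorm _ _).trans ?_
    exact mul_le_mul (mdp.norm_adjoint_jac_le f π hpolicy θ₂ s)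
      (mdp.norm_gradQ_sub_le f π hU hR henv hq hpolicy θ₁ θ₂ s (π.mem _ _)) (norm_nonneg _) hL.le
  · rw [lipGradJ]; ring

end Lip

/-! ### The matrix `Ψ` and the compatible weights -/

section Psi

variable (hU : U ⊆ closure (interior U)) (hR : mdp.RewardBounded K.Rmax)
  (henv : mdp.EnvAssumption f U K) (hq : mdp.QAssumption f π K)
  (hpolicy : mdp.PolicyAssumption f π K)

include hpolicy

theorem norm_adjoint_jac_comp_jac_le (θ : Vec d) (s : S) :
    ‖(ContinuousLinearMap.adjoint (π.jac θ s)).comp (π.jac θ s)‖ ≤ K.Lπ ^ 2 := by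
  refine (ContinuousLinearMap.opNorm_comp_le _ _).trans ?_
  rw [pow_two]
  exact mul_le_mul (mdp.norm_adjoint_jac_le f π hpolicy θ s) (mdp.norm_jac_le f π hpolicy θ s)
    (norm_nonneg _) hpolicy.Lπ_pos.le

omit hpolicy in
theorem measurable_adjoint_jac_comp_jac (θ : Vec d) : Measurable fun s =>
    (ContinuousLinearMap.adjoint (π.jac θ s)).comp (π.jac θ s) := by
  refine measurable_clm_of_apply fun x => measurable_of_inner fun y => ?_
  simp only [ContinuousLinearMap.comp_apply, ContinuousLinearMap.adjoint_inner_left]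
  have h : ∀ x : Vec d, Measurable fun s => π.jac θ s x := fun x =>
    (ContinuousLinearMap.apply ℝ (Vec k) x).continuous.measurable.comp (measurable_jac π θ)
  exact (h x).inner (h y)

theorem integrable_adjoint_jac_comp_jac (θ : Vec d) (μ : Measure S) [IsFiniteMeasure μ] :
    Integrable (fun s => (ContinuousLinearMap.adjoint (π.jac θ s)).comp (π.jac θ s)) μ :=
  Integrable.of_bound (measurable_adjoint_jac_comp_jac π θ).aestronglyMeasurable _
    (ae_of_all _ (mdp.norm_adjoint_jac_comp_jac_le f π hpolicy θ))

theorem Psi_apply (θ x : Vec d) : mdp.Psi f π θ x =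
    ∫ s, ContinuousLinearMap.adjoint (π.jac θ s) (π.jac θ s x) ∂(mdp.occ f π θ) := by
  rw [Psi, ContinuousLinearMap.integral_apply
    (mdp.integrable_adjoint_jac_comp_jac f π hpolicy θ _)]
  rfl

theorem inner_Psi (θ x y : Vec d) : inner ℝ (mdp.Psi f π θ x) y =
    ∫ s, inner ℝ (π.jac θ s x) (π.jac θ s y) ∂(mdp.occ f π θ) := by
  have hi := (mdp.integrable_adjoint_jac_comp_jac f π hpolicy θ (mdp.occ f π θ)).apply_continuousLinearMap x
  rw [mdp.Psi_apply f π hpolicy, real_inner_comm]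
  have := integral_inner (𝕜 := ℝ) hi y
  simp only [ContinuousLinearMap.comp_apply] at this
  rw [← this]
  refine integral_congr_ae (ae_of_all _ fun s => ?_)
  simp only
  rw [real_inner_comm, ContinuousLinearMap.adjoint_inner_left]

theorem Psi_coercive (θ x : Vec d) :
    K.lamΨ * ‖x‖ ^ 2 ≤ inner ℝ (mdp.Psi f π θ x) x :=
  inner_ge_of_eigenvalue_ge (T := (mdp.Psi f π θ : Vec d →ₗ[ℝ] Vec d)) (fun x y => by
    rw [ContinuousLinearMap.coe_coe, ← real_inner_comm x, mdp.inner_Psi f π hpolicy,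
      mdp.inner_Psi f π hpolicy]
    exact integral_congr_ae (ae_of_all _ fun s => real_inner_comm _ _))
    (hpolicy.eigenvalue θ) x

theorem norm_le_norm_Psi (θ x : Vec d) : K.lamΨ * ‖x‖ ≤ ‖mdp.Psi f π θ x‖ := by
  rcases eq_or_ne x 0 with rfl | hx
  · simp
  have h1 := (mdp.Psi_coercive f π hpolicy θ x).trans (real_inner_le_norm _ _)
  rw [pow_two, ← mul_assoc] at h1
  exact le_of_mul_le_mul_right h1 (norm_pos_iff.2 hx)

theorem norm_Psi_apply_le (θ x : Vec d) :
    ‖mdp.Psi f π θ x‖ ≤ K.Lπ ^ 2 / (1 - mdp.γ) * ‖x‖ := by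
  rw [mdp.Psi_apply f π hpolicy]
  have := norm_integral_le_of_norm_le_const (μ := mdp.occ f π θ) (C := K.Lπ ^ 2 * ‖x‖)
    (f := fun s => ContinuousLinearMap.adjoint (π.jac θ s) (π.jac θ s x))
    (ae_of_all _ fun s => by
      have h := ((ContinuousLinearMap.adjoint (π.jac θ s)).comp (π.jac θ s)).le_opNorm x
      exact h.trans (mul_le_mul_of_nonneg_right
        (mdp.norm_adjoint_jac_comp_jac_le f π hpolicy θ s) (norm_nonneg _)))
  rw [occ_real_univ] at this
  refine this.trans (le_of_eq (by ring))

theorem Psi_surjective (θ : Vec d) : Function.Surjective (mdp.Psi f π θ) := by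
  have hinj : Function.Injective (mdp.Psi f π θ : Vec d →ₗ[ℝ] Vec d) := by
    rw [← LinearMap.ker_eq_bot, LinearMap.ker_eq_bot']
    intro x hx
    have h1 := mdp.norm_le_norm_Psi f π hpolicy θ x
    rw [ContinuousLinearMap.coe_coe] at hx
    rw [hx, norm_zero] at h1
    have := nonpos_of_mul_nonpos_right h1 hpolicy.lamΨ_pos
    exact norm_le_zero_iff.1 this
  exact LinearMap.injective_iff_surjective.1 hinj

include henv in
theorem norm_Psi_sub_le (θ₁ θ₂ x : Vec d) :
    ‖mdp.Psi f π θ₁ x - mdp.Psi f π θ₂ x‖ ≤ mdp.lipPsi K * ‖θ₁ - θ₂‖ * ‖x‖ := by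
  have hL := hpolicy.Lπ_pos
  have hm : ∀ θ, Measurable fun s => ContinuousLinearMap.adjoint (π.jac θ s) (π.jac θ s x) :=
    fun θ => (ContinuousLinearMap.apply ℝ (Vec d) x).continuous.measurable.comp
      (measurable_adjoint_jac_comp_jac π θ)
  have hb : ∀ θ s, ‖ContinuousLinearMap.adjoint (π.jac θ s) (π.jac θ s x)‖ ≤ K.Lπ ^ 2 * ‖x‖ :=
    fun θ s => (((ContinuousLinearMap.adjoint (π.jac θ s)).comp (π.jac θ s)).le_opNorm x).trans
      (mul_le_mul_of_nonneg_right
        (mdp.norm_adjoint_jac_comp_jac_le f π hpolicy θ s) (norm_nonneg _))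
  rw [mdp.Psi_apply f π hpolicy, mdp.Psi_apply f π hpolicy]
  refine (mdp.norm_integral_occ_sub_le f π henv hpolicy (hm θ₁) (hm θ₂)
    (by positivity) (hb θ₁) (hb θ₂) θ₁ θ₂
    (δ := 2 * K.Lπ * K.Lψ * ‖θ₁ - θ₂‖ * ‖x‖) fun s => ?_).trans (le_of_eq ?_)
  · have e : ContinuousLinearMap.adjoint (π.jac θ₁ s) (π.jac θ₁ s x) -
        ContinuousLinearMap.adjoint (π.jac θ₂ s) (π.jac θ₂ s x) =
        ContinuousLinearMap.adjoint (π.jac θ₁ s - π.jac θ₂ s) (π.jac θ₁ s x) +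
        ContinuousLinearMap.adjoint (π.jac θ₂ s) ((π.jac θ₁ s - π.jac θ₂ s) x) := by
      rw [map_sub, sub_apply, sub_apply, map_sub]; abel
    have h1 : ‖π.jac θ₁ s x‖ ≤ K.Lπ * ‖x‖ := (π.jac θ₁ s).le_of_opNorm_le
      (mdp.norm_jac_le f π hpolicy θ₁ s) x
    have h2 : ‖(π.jac θ₁ s - π.jac θ₂ s) x‖ ≤ K.Lψ * ‖θ₁ - θ₂‖ * ‖x‖ :=
      (π.jac θ₁ s - π.jac θ₂ s).le_of_opNorm_le (hpolicy.smooth θ₁ θ₂ s) x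
    have h3 : ‖ContinuousLinearMap.adjoint (π.jac θ₁ s - π.jac θ₂ s) (π.jac θ₁ s x)‖ ≤
        K.Lψ * ‖θ₁ - θ₂‖ * (K.Lπ * ‖x‖) :=
      (ContinuousLinearMap.le_of_opNorm_le _
        (by rw [LinearIsometryEquiv.norm_map]; exact hpolicy.smooth θ₁ θ₂ s) _).trans
        (mul_le_mul_of_nonneg_left h1 (mul_nonneg hpolicy.Lψ_pos.le (norm_nonneg _)))
    have h4 : ‖ContinuousLinearMap.adjoint (π.jac θ₂ s) ((π.jac θ₁ s - π.jac θ₂ s) x)‖ ≤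
        K.Lπ * (K.Lψ * ‖θ₁ - θ₂‖ * ‖x‖) :=
      (ContinuousLinearMap.le_of_opNorm_le _
        (mdp.norm_adjoint_jac_le f π hpolicy θ₂ s) _).trans
        (mul_le_mul_of_nonneg_left h2 hL.le)
    rw [e]
    refine (norm_add_le _ _).trans ((add_le_add h3 h4).trans (le_of_eq (by ring)))
  · rw [lipPsi]; ring

include hU hR henv hq in
-- Completing the square: the cross term is `⟨Ψ w₀ - ∇J, w - w₀⟩` up to a factor, and vanishes by
-- the normal equation. Coercivity of `Ψ` then identifies minimizers with solutions.
theorem compatError_eq {θ w₀ : Vec d} (hw₀ : mdp.Psi f π θ w₀ = mdp.gradJ f π θ) (w : Vec d) :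
    mdp.compatError f π θ w =
      mdp.compatError f π θ w₀ + inner ℝ (mdp.Psi f π θ (w - w₀)) (w - w₀) := by
  have hj : ∀ x : Vec d, Measurable fun s => π.jac θ s x := fun x =>
    (ContinuousLinearMap.apply ℝ (Vec k) x).continuous.measurable.comp (measurable_jac π θ)
  have hjb : ∀ (x : Vec d) s, ‖π.jac θ s x‖ ≤ K.Lπ * ‖x‖ := fun x s =>
    (π.jac θ s).le_of_opNorm_le (mdp.norm_jac_le f π hpolicy θ s) x
  have hg := mdp.measurable_gradQ_policy f π hU hR hq θ
  have hgb : ∀ s, ‖mdp.gradQ f π θ s (π θ s)‖ ≤ mdp.Cq K := fun s =>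
    mdp.norm_gradQ_le f π hU hR henv hq θ s (π.mem θ s)
  have hLπ := hpolicy.Lπ_pos
  have hC := mdp.Cq_pos f hR henv
  have i1 : Integrable (fun s => ‖π.jac θ s w₀ - mdp.gradQ f π θ s (π θ s)‖ ^ 2)
      (mdp.occ f π θ) :=
    Integrable.of_bound (((hj w₀).sub hg).norm.pow_const 2).aestronglyMeasurable
      ((K.Lπ * ‖w₀‖ + mdp.Cq K) ^ 2) (ae_of_all _ fun s => by
        rw [norm_pow, norm_norm]
        exact pow_le_pow_left₀ (norm_nonneg _)
          ((norm_sub_le _ _).trans (add_le_add (hjb _ s) (hgb s))) 2)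
  have i2 : ∀ x y : Vec d, Integrable (fun s => inner ℝ (π.jac θ s x) (π.jac θ s y))
      (mdp.occ f π θ) := fun x y =>
    Integrable.of_bound ((hj x).inner (hj y)).aestronglyMeasurable
      ((K.Lπ * ‖x‖) * (K.Lπ * ‖y‖)) (ae_of_all _ fun s =>
        (norm_inner_le_norm _ _).trans
          (mul_le_mul (hjb _ s) (hjb _ s) (norm_nonneg _) (by positivity)))
  have i3 : ∀ x : Vec d, Integrable (fun s => inner ℝ x (mdp.polGrad f π θ s))
      (mdp.occ f π θ) := fun x =>
    (mdp.integrable_polGrad f π hU hR henv hq hpolicy θ _).const_inner x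
  have e : ∀ s, ‖π.jac θ s w - mdp.gradQ f π θ s (π θ s)‖ ^ 2 =
      ‖π.jac θ s w₀ - mdp.gradQ f π θ s (π θ s)‖ ^ 2 +
      (2 * (inner ℝ (π.jac θ s w₀) (π.jac θ s (w - w₀)) -
        inner ℝ (w - w₀) (mdp.polGrad f π θ s)) +
      inner ℝ (π.jac θ s (w - w₀)) (π.jac θ s (w - w₀))) := fun s => by
    have h1 : π.jac θ s w - mdp.gradQ f π θ s (π θ s) =
        (π.jac θ s w₀ - mdp.gradQ f π θ s (π θ s)) + π.jac θ s (w - w₀) := by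
      rw [map_sub]; abel
    rw [h1, norm_add_sq_real, real_inner_comm (mdp.polGrad f π θ s), inner_polGrad,
      inner_sub_left, real_inner_self_eq_norm_sq]
    ring
  have h4 : ∫ s, inner ℝ (w - w₀) (mdp.polGrad f π θ s) ∂(mdp.occ f π θ) =
      inner ℝ (w - w₀) (mdp.gradJ f π θ) :=
    integral_inner (mdp.integrable_polGrad f π hU hR henv hq hpolicy θ _) _
  rw [compatError, compatError]
  simp_rw [e]
  have i4 := ((i2 w₀ (w - w₀)).sub (i3 (w - w₀))).const_mul 2
  simp only [Pi.sub_apply] at i4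
  rw [integral_add i1 (by exact i4.add (i2 (w - w₀) (w - w₀))), integral_add i4 (i2 (w - w₀) (w - w₀)),
    integral_const_mul, integral_sub (i2 w₀ (w - w₀)) (i3 (w - w₀)), h4,
    ← mdp.inner_Psi f π hpolicy, ← mdp.inner_Psi f π hpolicy, hw₀, real_inner_comm (w - w₀)]
  ring

include hU hR henv hq in
theorem isCompatibleWeight_iff (θ w : Vec d) :
    mdp.IsCompatibleWeight f π θ w ↔ mdp.Psi f π θ w = mdp.gradJ f π θ := by
  constructor
  · intro hw
    obtain ⟨w₀, hw₀⟩ := mdp.Psi_surjective f π hpolicy θ (mdp.gradJ f π θ)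
    have h1 : mdp.compatError f π θ w ≤ mdp.compatError f π θ w₀ := hw (Set.mem_univ w₀)
    rw [mdp.compatError_eq f π hU hR henv hq hpolicy hw₀ w] at h1
    have h2 := mdp.Psi_coercive f π hpolicy θ (w - w₀)
    have h3 : K.lamΨ * ‖w - w₀‖ ^ 2 ≤ 0 := by linarith
    have h4 := nonpos_of_mul_nonpos_right h3 hpolicy.lamΨ_pos
    have h5 : ‖w - w₀‖ = 0 := by
      have := le_antisymm h4 (sq_nonneg _)
      exact pow_eq_zero_iff (two_ne_zero) |>.1 this
    rw [norm_sub_eq_zero_iff.1 h5, hw₀]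
  · intro hw w' _
    show mdp.compatError f π θ w ≤ mdp.compatError f π θ w'
    rw [mdp.compatError_eq f π hU hR henv hq hpolicy hw w']
    have h2 := mdp.Psi_coercive f π hpolicy θ (w' - w)
    have h3 : 0 ≤ K.lamΨ * ‖w' - w‖ ^ 2 := mul_nonneg hpolicy.lamΨ_pos.le (sq_nonneg _)
    linarith

include hU hR henv hq in
theorem existsUnique_compatibleWeight (θ : Vec d) : ∃! w, mdp.IsCompatibleWeight f π θ w := by
  obtain ⟨w₀, hw₀⟩ := mdp.Psi_surjective f π hpolicy θ (mdp.gradJ f π θ)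
  refine ⟨w₀, (mdp.isCompatibleWeight_iff f π hU hR henv hq hpolicy θ w₀).2 hw₀, fun w hw => ?_⟩
  have hw := (mdp.isCompatibleWeight_iff f π hU hR henv hq hpolicy θ w).1 hw
  have h1 := mdp.norm_le_norm_Psi f π hpolicy θ (w - w₀)
  rw [map_sub, hw, hw₀, sub_self, norm_zero] at h1
  have := nonpos_of_mul_nonpos_right h1 hpolicy.lamΨ_pos
  exact norm_sub_eq_zero_iff.1 (le_antisymm this (norm_nonneg _))

variable {wξ : Vec d → Vec d} (hw : ∀ θ, mdp.Psi f π θ (wξ θ) = mdp.gradJ f π θ)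

include hU hR henv hq hw

theorem norm_compatibleWeight_le (θ : Vec d) : ‖wξ θ‖ ≤ mdp.Cwξ K := by
  have h1 := mdp.norm_le_norm_Psi f π hpolicy θ (wξ θ)
  rw [hw] at h1
  have h2 := h1.trans (mdp.norm_gradJ_le f π hU hR henv hq hpolicy θ)
  have hl := hpolicy.lamΨ_pos
  have hg := mdp.one_sub_γ_pos
  rw [mul_comm, ← le_div_iff₀ hl] at h2
  refine h2.trans (le_of_eq ?_)
  rw [Cwξ, div_div, mul_comm K.lamΨ]

/-- Perturbation of a linear system: `Ψ₂ (w₁ - w₂) = (∇J₁ - ∇J₂) - (Ψ₁ - Ψ₂) w₁`, to which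
coercivity of `Ψ₂` and the bound `Cwξ` on `w₁` apply. -/
theorem norm_compatibleWeight_sub_le (θ₁ θ₂ : Vec d) :
    ‖wξ θ₁ - wξ θ₂‖ ≤ mdp.lipWeight K * ‖θ₁ - θ₂‖ := by
  have hl := hpolicy.lamΨ_pos
  have hg := mdp.one_sub_γ_pos
  have h1 := mdp.norm_le_norm_Psi f π hpolicy θ₂ (wξ θ₁ - wξ θ₂)
  have e : mdp.Psi f π θ₂ (wξ θ₁ - wξ θ₂) = (mdp.gradJ f π θ₁ - mdp.gradJ f π θ₂) -
      (mdp.Psi f π θ₁ (wξ θ₁) - mdp.Psi f π θ₂ (wξ θ₁)) := by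
    rw [map_sub, hw, hw]; abel
  rw [e] at h1
  have h2 := h1.trans ((norm_sub_le _ _).trans (add_le_add
    (mdp.norm_gradJ_sub_le f π hU hR henv hq hpolicy θ₁ θ₂)
    (mdp.norm_Psi_sub_le f π henv hpolicy θ₁ θ₂ (wξ θ₁))))
  have h3 := mul_le_mul_of_nonneg_left
    (mdp.norm_compatibleWeight_le f π hU hR henv hq hpolicy hw θ₁)
    (mul_nonneg (mdp.lipPsi_nonneg f π henv hpolicy) (norm_nonneg (θ₁ - θ₂)))
  have h4 : K.lamΨ * ‖wξ θ₁ - wξ θ₂‖ ≤ K.lamΨ * (mdp.lipWeight K * ‖θ₁ - θ₂‖) := by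
    refine (h2.trans (add_le_add_right h3 _)).trans (le_of_eq ?_)
    rw [lipWeight, Cwξ]
    field_simp
  exact le_of_mul_le_mul_left h4 hl

end Psi
end MDP
end DPPG
end

noncomputable section
namespace DPPG

/-! ### Uniform invertibility of bounded matrices with determinant bounded below -/

/-- Cramer's rule, `det M • x = adj(M) (M x)`: the adjugate is continuous in the entries, hence
bounded on the compact cube of admissible matrices. -/
theorem exists_pos_mul_dotProduct_le (n : ℕ) (C c : ℝ) (hc : 0 < c) :
    ∃ κ > 0, ∀ M : Matrix (Fin n) (Fin n) ℝ, (∀ i j, |M i j| ≤ C) → c ≤ |M.det| →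
      ∀ x : Fin n → ℝ, κ * (x ⬝ᵥ x) ≤ (M.mulVec x) ⬝ᵥ (M.mulVec x) := by
  have hcomp : IsCompact (Set.univ.pi fun _ : Fin n => Set.univ.pi fun _ : Fin n =>
      Set.Icc (-C) C) := isCompact_univ_pi fun _ => isCompact_univ_pi fun _ => isCompact_Icc
  have hcont : Continuous fun M : Matrix (Fin n) (Fin n) ℝ =>
      ∑ i, ∑ j, |M.adjugate i j| :=
    continuous_finsetSum _ fun i _ => continuous_finsetSum _ fun j _ =>
      (continuous_abs.comp ((continuous_id.matrix_adjugate).matrix_elem i j))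
  obtain ⟨B, hB⟩ := hcomp.exists_bound_of_continuousOn (f := fun M : Fin n → Fin n → ℝ =>
    ∑ i, ∑ j, |(Matrix.of M).adjugate i j|) hcont.continuousOn
  -- `|B| + 1` bounds every entry of the adjugate, and `n + 1` replaces the dimension; the added
  -- ones keep the denominator positive in all cases.
  refine ⟨(c / ((|B| + 1) * (n + 1))) ^ 2, by positivity, fun M hM hdet x => ?_⟩
  have hadj : ∀ i j, |M.adjugate i j| ≤ |B| + 1 := fun i j => by
    have h1 := hB M (by
      exact fun i _ j _ => abs_le.1 (hM i j))
    have h2 := (le_abs_self _).trans ((Real.norm_eq_abs _ ▸ h1).trans (le_abs_self B))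
    have h3 : |M.adjugate i j| ≤ ∑ i, ∑ j, |M.adjugate i j| :=
      (Finset.single_le_sum (f := fun j => |M.adjugate i j|) (fun _ _ => abs_nonneg _)
        (Finset.mem_univ j)).trans
      (Finset.single_le_sum (f := fun i => ∑ j, |M.adjugate i j|)
        (fun _ _ => Finset.sum_nonneg fun _ _ => abs_nonneg _) (Finset.mem_univ i))
    exact h3.trans (h2.trans (by linarith))
  set y := M.mulVec x with hy
  have hx : M.det • x = M.adjugate.mulVec y := by
    rw [hy, Matrix.mulVec_mulVec, Matrix.adjugate_mul, Matrix.smul_mulVec, Matrix.one_mulVec]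
  have hcs : ∀ i, (c * x i) ^ 2 ≤ (|B| + 1) ^ 2 * n * (y ⬝ᵥ y) := fun i => by
    have h1 : M.det * x i = ∑ j, M.adjugate i j * y j := congrFun hx i
    have h2 : (M.det * x i) ^ 2 ≤ (∑ j, M.adjugate i j ^ 2) * ∑ j, y j ^ 2 := by
      rw [h1]; exact Finset.sum_mul_sq_le_sq_mul_sq _ _ _
    have h3 : (∑ j, M.adjugate i j ^ 2) ≤ n * (|B| + 1) ^ 2 := by
      have := Finset.sum_le_card_nsmul Finset.univ (fun j => M.adjugate i j ^ 2) ((|B| + 1) ^ 2)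
        fun j _ => sq_le_sq' (by have := (abs_le.1 (hadj i j)).1; linarith)
          (abs_le.1 (hadj i j)).2
      simpa using this
    have h4 : (c * x i) ^ 2 ≤ (M.det * x i) ^ 2 := by
      rw [mul_pow, mul_pow]
      refine mul_le_mul_of_nonneg_right ?_ (sq_nonneg _)
      rw [← sq_abs M.det]
      exact pow_le_pow_left₀ hc.le hdet 2
    have h5 : y ⬝ᵥ y = ∑ j, y j ^ 2 := Finset.sum_congr rfl fun j _ => (pow_two _).symm
    rw [h5]
    calc _ ≤ _ := h4.trans h2
      _ ≤ n * (|B| + 1) ^ 2 * ∑ j, y j ^ 2 :=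
        mul_le_mul_of_nonneg_right h3 (Finset.sum_nonneg fun _ _ => sq_nonneg _)
      _ = _ := by ring
  have hy0 : 0 ≤ y ⬝ᵥ y := Finset.sum_nonneg fun j _ => mul_self_nonneg _
  have hsum : c ^ 2 * (x ⬝ᵥ x) ≤ n * ((|B| + 1) ^ 2 * n * (y ⬝ᵥ y)) := by
    have := Finset.sum_le_card_nsmul Finset.univ (fun i => (c * x i) ^ 2) _ fun i _ => hcs i
    simp only [Finset.card_univ, Fintype.card_fin, nsmul_eq_mul] at this
    refine le_trans (le_of_eq ?_) this
    rw [dotProduct, Finset.mul_sum]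
    exact Finset.sum_congr rfl fun i _ => by ring
  have hpos : 0 < ((|B| + 1) * (n + 1)) ^ 2 := by positivity
  rw [div_pow, div_mul_eq_mul_div, div_le_iff₀ hpos]
  refine hsum.trans ?_
  have hn : (n : ℝ) * n ≤ ((n : ℝ) + 1) ^ 2 := by nlinarith [Nat.cast_nonneg (α := ℝ) n]
  calc _ = (|B| + 1) ^ 2 * (y ⬝ᵥ y) * (n * n) := by ring
    _ ≤ (|B| + 1) ^ 2 * (y ⬝ᵥ y) * ((n : ℝ) + 1) ^ 2 :=
      mul_le_mul_of_nonneg_left hn (by positivity)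
    _ = _ := by ring

/-- The determinant is the product of the `n` complex eigenvalues, counted with multiplicity. -/
theorem pow_le_abs_det {n : ℕ} {M : Matrix (Fin n) (Fin n) ℝ} {c : ℝ} (hc : 0 ≤ c)
    (h : ∀ z ∈ spectrum ℂ (M.map (algebraMap ℝ ℂ)), c ≤ ‖z‖) : c ^ n ≤ |M.det| := by
  have h1 : ‖(M.map (algebraMap ℝ ℂ)).det‖ = |M.det| := by
    have : (M.map (algebraMap ℝ ℂ)).det = algebraMap ℝ ℂ M.det :=
      (RingHom.map_det (algebraMap ℝ ℂ) M).symm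
    rw [this]; simp
  rw [← h1, Matrix.det_eq_prod_roots_charpoly]
  set B := M.map (algebraMap ℝ ℂ)
  have hcard : B.charpoly.roots.card = n := by
    have h2 := (IsAlgClosed.splits B.charpoly).natDegree_eq_card_roots
    rw [← h2, Matrix.charpoly_natDegree_eq_dim, Fintype.card_fin]
  have key : ∀ m : Multiset ℂ, (∀ z ∈ m, c ≤ ‖z‖) → c ^ m.card ≤ ‖m.prod‖ := by
    intro m
    induction m using Multiset.induction_on with
    | empty => simp
    | cons a m ih =>
      intro hm
      rw [Multiset.card_cons, Multiset.prod_cons, norm_mul, pow_succ']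
      exact mul_le_mul (hm a (Multiset.mem_cons_self a m))
        (ih fun z hz => hm z (Multiset.mem_cons_of_mem hz)) (pow_nonneg hc _) (norm_nonneg _)
  have := key B.charpoly.roots fun z hz => h z
    (Matrix.mem_spectrum_iff_isRoot_charpoly.2 (Polynomial.isRoot_of_mem_roots hz))
  rwa [hcard] at this

namespace MDP

variable {S A : Type*} [MeasurableSpace S] [MeasurableSpace A] (mdp : MDP S A)
  {k d : ℕ} {U : Set (Vec k)} (f : Kernel (Vec k) A) [IsMarkovKernel f] (π : ParamPolicy S U d)
  {K : Consts}

/-! ### Invariance of the stationary distribution -/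

section Stationary

variable {θ : Vec d} {μ : Measure S}

/-- Setwise convergence is passed on to bounded functions by the layer-cake formula: the measures of
the level sets `{x ≤ h}` converge for every `x`, and are dominated by `1` on `(0, 1]`. -/
theorem tendsto_cesaro_integral (hμ : mdp.IsStationaryDistribution f π θ μ) {h : S → ℝ}
    (hm : Measurable h) (h0 : ∀ s, 0 ≤ h s) (h1 : ∀ s, h s ≤ 1) :
    Tendsto (fun T : ℕ => (1 / (T : ℝ)) *
      ∑ t ∈ Finset.range T, ∫ s, h s ∂(mdp.stateLaw f π θ mdp.d0 t)) atTop
      (𝓝 (∫ s, h s ∂μ)) := by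
  have hprob := hμ.prob
  have hP : ∀ t, IsProbabilityMeasure (mdp.stateLaw f π θ mdp.d0 t) := fun t => by
    rw [stateLaw_eq]; infer_instance
  have hb : BddMeas h 1 := ⟨hm, fun s => abs_le.2 ⟨by linarith [h0 s], h1 s⟩⟩
  have lc : ∀ ν : Measure S, IsProbabilityMeasure ν →
      ∫ s, h s ∂ν = ∫ x in Set.Ioc 0 1, ν.real {s | x ≤ h s} := fun ν hν =>
    (hb.integrable ν).integral_eq_integral_Ioc_meas_le (ae_of_all _ h0) (ae_of_all _ h1)
  have hanti : ∀ ν : Measure S, IsProbabilityMeasure ν →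
      Measurable fun x : ℝ => ν.real {s | x ≤ h s} := fun ν hν =>
    Antitone.measurable fun x y hxy => measureReal_mono fun s (hs : y ≤ h s) => hxy.trans hs
  have hle1 : ∀ ν : Measure S, IsProbabilityMeasure ν → ∀ B, ν.real B ≤ 1 := fun ν hν B =>
    measureReal_le_one
  have hint : ∀ ν : Measure S, IsProbabilityMeasure ν →
      IntegrableOn (fun x : ℝ => ν.real {s | x ≤ h s}) (Set.Ioc 0 1) := fun ν hν =>
    Measure.integrableOn_of_bounded (M := 1) (by simp) (hanti ν hν).aestronglyMeasurable
      (ae_of_all _ fun x => by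
        rw [Real.norm_of_nonneg measureReal_nonneg]; exact hle1 ν hν _)
  rw [lc μ hprob]
  have e : ∀ T : ℕ, (1 / (T : ℝ)) *
      ∑ t ∈ Finset.range T, ∫ s, h s ∂(mdp.stateLaw f π θ mdp.d0 t) =
      ∫ x in Set.Ioc (0 : ℝ) 1, (1 / (T : ℝ)) *
        ∑ t ∈ Finset.range T, (mdp.stateLaw f π θ mdp.d0 t).real {s | x ≤ h s} := fun T => by
    rw [integral_const_mul, integral_finsetSum _ fun t _ => hint _ (hP t)]
    congr 1
    exact Finset.sum_congr rfl fun t _ => lc _ (hP t)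
  simp_rw [e]
  refine tendsto_integral_of_dominated_convergence (fun _ => (1 : ℝ)) (fun T => ?_) ?_
    (fun T => ?_) ?_
  · exact ((Finset.measurable_sum _ fun t _ => hanti _ (hP t)).const_mul _).aestronglyMeasurable
  · simp
  · refine ae_of_all _ fun x => ?_
    have hs0 : 0 ≤ ∑ t ∈ Finset.range T, (mdp.stateLaw f π θ mdp.d0 t).real {s | x ≤ h s} :=
      Finset.sum_nonneg fun _ _ => measureReal_nonneg
    rw [Real.norm_of_nonneg (by positivity)]
    have := Finset.sum_le_card_nsmul (Finset.range T)
      (fun t => (mdp.stateLaw f π θ mdp.d0 t).real {s | x ≤ h s}) 1 fun t _ => hle1 _ (hP t) _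
    simp only [Finset.card_range, nsmul_eq_mul, mul_one] at this
    rw [one_div, inv_mul_eq_div]
    exact div_le_one_of_le₀ this (Nat.cast_nonneg _)
  · exact ae_of_all _ fun x => hμ.limit _ (measurableSet_le measurable_const hm)

/-- Averaging `s ↦ P(s, B)` along the chain shifts the time average of the probabilities of `B` by
one step. This function is not an indicator, hence the extension of the convergence to bounded
functions. -/
theorem bind_stationary (hμ : mdp.IsStationaryDistribution f π θ μ) :
    μ.bind (mdp.polKernel f π θ) = μ := by
  have hprob := hμ.prob
  have hb : IsProbabilityMeasure (μ.bind (mdp.polKernel f π θ)) :=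
    inferInstanceAs (IsProbabilityMeasure (mdp.polKernel f π θ ∘ₘ μ))
  refine Measure.ext fun B hB => ?_
  have hind : BddMeas (B.indicator fun _ => (1 : ℝ)) 1 :=
    ⟨measurable_const.indicator hB, fun s => by
      by_cases hs : s ∈ B <;> simp [hs]⟩
  have e0 : ∀ ν : Measure S, ∫ s, B.indicator (fun _ => (1 : ℝ)) s ∂ν = ν.real B := fun ν => by
    rw [integral_indicator_const _ hB, smul_eq_mul, mul_one]
  have hk := hind.kop (P := mdp.polKernel f π θ)
  have hk1 : ∀ s, kop (mdp.polKernel f π θ) (B.indicator fun _ => (1 : ℝ)) s =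
      (mdp.polKernel f π θ s).real B := fun s => e0 _
  have hP : ∀ t, IsProbabilityMeasure (mdp.stateLaw f π θ mdp.d0 t) := fun t => by
    rw [stateLaw_eq]; infer_instance
  have h1 := mdp.tendsto_cesaro_integral f π hμ hk.meas
    (fun s => by rw [hk1]; exact measureReal_nonneg)
    (fun s => by rw [hk1]; exact measureReal_le_one)
  have e1 : ∀ t, ∫ s, kop (mdp.polKernel f π θ) (B.indicator fun _ => (1 : ℝ)) s
      ∂(mdp.stateLaw f π θ mdp.d0 t) = (mdp.stateLaw f π θ mdp.d0 (t + 1)).real B := fun t => by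
    have := hP t
    rw [← integral_bind_bddMeas hind, e0, stateLaw_eq, stateLaw_eq]
    rfl
  simp_rw [e1] at h1
  have h2 := hμ.limit B hB
  -- The shifted and unshifted sums differ by two boundary terms in `[0, 1]`, which disappear after
  -- division by `T`.
  have h3 : Tendsto (fun T : ℕ => (1 / (T : ℝ)) * ((mdp.stateLaw f π θ mdp.d0 T).real B -
      (mdp.stateLaw f π θ mdp.d0 0).real B)) atTop (𝓝 0) := by
    refine squeeze_zero_norm (a := fun T : ℕ => 1 / (T : ℝ)) (fun T => ?_)
      tendsto_one_div_atTop_nhds_zero_nat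
    rw [norm_mul, Real.norm_of_nonneg (by positivity)]
    refine mul_le_of_le_one_right (by positivity) ?_
    rw [Real.norm_eq_abs, abs_le]
    have := hP T
    have := hP 0
    have a1 := measureReal_nonneg (μ := mdp.stateLaw f π θ mdp.d0 T) (s := B)
    have a2 := measureReal_nonneg (μ := mdp.stateLaw f π θ mdp.d0 0) (s := B)
    have a3 := measureReal_le_one (μ := mdp.stateLaw f π θ mdp.d0 T) (s := B)
    have a4 := measureReal_le_one (μ := mdp.stateLaw f π θ mdp.d0 0) (s := B)
    constructor <;> linarith
  have h4 := h2.add h3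
  have e2 : ∀ T : ℕ, (1 / (T : ℝ)) * ∑ t ∈ Finset.range T,
        (mdp.stateLaw f π θ mdp.d0 t).real B +
      (1 / (T : ℝ)) * ((mdp.stateLaw f π θ mdp.d0 T).real B -
      (mdp.stateLaw f π θ mdp.d0 0).real B) =
      (1 / (T : ℝ)) * ∑ t ∈ Finset.range T, (mdp.stateLaw f π θ mdp.d0 (t + 1)).real B :=
    fun T => by
      rw [← mul_add]
      congr 1
      have := Finset.sum_range_succ (fun t => (mdp.stateLaw f π θ mdp.d0 t).real B) T
      have h' := Finset.sum_range_succ' (fun t => (mdp.stateLaw f π θ mdp.d0 t).real B) T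
      linarith
  simp_rw [e2, add_zero] at h4
  have h5 := tendsto_nhds_unique h1 h4
  rw [← integral_bind_bddMeas hind, e0] at h5
  rwa [measureReal_eq_measureReal_iff] at h5

end Stationary

/-! ### The mean TD update -/

variable (φ : S → Vec k → Vec d)

/-- Features along the policy. -/
def feat (θ : Vec d) (s : S) : Vec d := φ s (π θ s)

section TD

variable (hφ : Measurable (Function.uncurry φ))
  (hb : ∀ s, ∀ u ∈ U, ‖φ s u‖ ≤ K.Cφ) (θ : Vec d) (μ : Measure S) [IsProbabilityMeasure μ]

instance : IsProbabilityMeasure (mdp.tdLaw f π θ μ) := by unfold tdLaw; infer_instance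

include hφ in
theorem measurable_feat : Measurable (feat π φ θ) :=
  hφ.comp (measurable_id.prodMk (π.measurable θ))

include hb in
theorem norm_feat_le (s : S) : ‖feat π φ θ s‖ ≤ K.Cφ := hb s _ (π.mem θ s)

/-- Linear part of the TD update of a sample. -/
def tdVec (θ v : Vec d) (z : S × (ℝ × S)) : Vec d :=
  (mdp.γ * inner ℝ (feat π φ θ z.2.2) v - inner ℝ (feat π φ θ z.1) v) • feat π φ θ z.1

/-- TD update of a sample. -/
def tdUpd (θ w : Vec d) (z : S × (ℝ × S)) : Vec d :=
  mdp.tdError π φ θ w z • feat π φ θ z.1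

theorem tdUpd_eq (w : Vec d) (z : S × (ℝ × S)) :
    mdp.tdUpd π φ θ w z = mdp.tdVec π φ θ w z + z.2.1 • feat π φ θ z.1 := by
  rw [tdUpd, tdVec, ← add_smul, tdError, feat, feat]
  congr 1; ring

include hφ in
theorem measurable_tdVec (v : Vec d) : Measurable (mdp.tdVec π φ θ v) := by
  have h := measurable_feat π φ hφ θ
  have h1 : Measurable fun z : S × (ℝ × S) => feat π φ θ z.2.2 :=
    h.comp (measurable_snd.comp measurable_snd)
  have h2 : Measurable fun z : S × (ℝ × S) => feat π φ θ z.1 := h.comp measurable_fst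
  exact (((Measurable.inner (𝕜 := ℝ) h1 measurable_const).const_mul _).sub
    (Measurable.inner (𝕜 := ℝ) h2 measurable_const)).smul h2

include hφ in
theorem measurable_tdUpd (w : Vec d) : Measurable (mdp.tdUpd π φ θ w) := by
  have e : mdp.tdUpd π φ θ w = fun z => mdp.tdVec π φ θ w z + z.2.1 • feat π φ θ z.1 :=
    funext fun z => mdp.tdUpd_eq π φ θ w z
  rw [e]
  exact (mdp.measurable_tdVec π φ hφ θ w).add ((measurable_fst.comp measurable_snd).smul
    ((measurable_feat π φ hφ θ).comp measurable_fst))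

include hb in
theorem norm_tdVec_le (v : Vec d) (z : S × (ℝ × S)) :
    ‖mdp.tdVec π φ θ v z‖ ≤ CA K * ‖v‖ := by
  have h1 := norm_feat_le π φ hb θ z.1
  have h2 := norm_feat_le π φ hb θ z.2.2
  have hC : 0 ≤ K.Cφ := (norm_nonneg _).trans h1
  have h3 : |inner ℝ (feat π φ θ z.1) v| ≤ K.Cφ * ‖v‖ :=
    (abs_real_inner_le_norm _ _).trans (mul_le_mul_of_nonneg_right h1 (norm_nonneg _))
  have h4 : |inner ℝ (feat π φ θ z.2.2) v| ≤ K.Cφ * ‖v‖ :=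
    (abs_real_inner_le_norm _ _).trans (mul_le_mul_of_nonneg_right h2 (norm_nonneg _))
  have h5 : |mdp.γ * inner ℝ (feat π φ θ z.2.2) v - inner ℝ (feat π φ θ z.1) v| ≤
      2 * (K.Cφ * ‖v‖) := by
    refine (abs_sub _ _).trans ?_
    rw [abs_mul, abs_of_nonneg mdp.γ_nonneg]
    have := mul_le_mul mdp.γ_lt_one.le h4 (abs_nonneg _) zero_le_one
    linarith
  rw [tdVec, norm_smul, Real.norm_eq_abs, CA]
  calc _ ≤ 2 * (K.Cφ * ‖v‖) * K.Cφ := mul_le_mul h5 h1 (norm_nonneg _) (by positivity)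
    _ = _ := by ring

theorem ae_reward_tdLaw (hR : mdp.RewardBounded K.Rmax) :
    ∀ᵐ z ∂(mdp.tdLaw f π θ μ), |z.2.1| ≤ K.Rmax := by
  refine Measure.ae_compProd_of_ae_ae (measurableSet_le (by fun_prop) measurable_const)
    (ae_of_all _ fun s => ?_)
  exact mdp.ae_reward_paramStep f hR (s, π θ s)

include hb in
theorem ae_norm_tdUpd_le (hR : mdp.RewardBounded K.Rmax) (w : Vec d) :
    ∀ᵐ z ∂(mdp.tdLaw f π θ μ), ‖mdp.tdUpd π φ θ w z‖ ≤ CA K * ‖w‖ + Cb K := by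
  filter_upwards [mdp.ae_reward_tdLaw f π θ μ hR] with z hz
  rw [tdUpd_eq]
  refine (norm_add_le _ _).trans (add_le_add (mdp.norm_tdVec_le π φ hb θ w z) ?_)
  rw [norm_smul, Cb]
  exact mul_le_mul hz (norm_feat_le π φ hb θ z.1) (norm_nonneg _) ((abs_nonneg _).trans hz)

/-- Mean of the linear part of the TD update. -/
def tdMean (θ : Vec d) (μ : Measure S) (v : Vec d) : Vec d :=
  ∫ z, mdp.tdVec π φ θ v z ∂(mdp.tdLaw f π θ μ)

/-- Mean reward part of the TD update. -/
def tdBias (θ : Vec d) (μ : Measure S) : Vec d :=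
  ∫ z, z.2.1 • feat π φ θ z.1 ∂(mdp.tdLaw f π θ μ)

include hφ hb in
theorem integrable_tdVec (v : Vec d) :
    Integrable (mdp.tdVec π φ θ v) (mdp.tdLaw f π θ μ) :=
  Integrable.of_bound (mdp.measurable_tdVec π φ hφ θ v).aestronglyMeasurable _
    (ae_of_all _ (mdp.norm_tdVec_le π φ hb θ v))

include hφ hb in
theorem integrable_tdUpd (hR : mdp.RewardBounded K.Rmax) (w : Vec d) :
    Integrable (mdp.tdUpd π φ θ w) (mdp.tdLaw f π θ μ) :=
  Integrable.of_bound (mdp.measurable_tdUpd π φ hφ θ w).aestronglyMeasurable _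
    (mdp.ae_norm_tdUpd_le f π φ hb θ μ hR w)

include hφ hb in
theorem integrable_reward_smul_feat (hR : mdp.RewardBounded K.Rmax) :
    Integrable (fun z : S × (ℝ × S) => z.2.1 • feat π φ θ z.1) (mdp.tdLaw f π θ μ) := by
  have := (mdp.integrable_tdUpd f π φ hφ hb θ μ hR 0).sub
    (mdp.integrable_tdVec f π φ hφ hb θ μ 0)
  refine this.congr (ae_of_all _ fun z => ?_)
  simp only [Pi.sub_apply, tdUpd_eq]; abel

include hφ hb in
theorem integral_tdUpd (hR : mdp.RewardBounded K.Rmax) (w : Vec d) :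
    ∫ z, mdp.tdUpd π φ θ w z ∂(mdp.tdLaw f π θ μ) =
      mdp.tdMean f π φ θ μ w + mdp.tdBias f π φ θ μ := by
  simp_rw [tdUpd_eq]
  exact integral_add (mdp.integrable_tdVec f π φ hφ hb θ μ w)
    (mdp.integrable_reward_smul_feat f π φ hφ hb θ μ hR)

include hφ hb in
theorem isTDFixedPoint_iff (hR : mdp.RewardBounded K.Rmax) (w : Vec d) :
    mdp.IsTDFixedPoint f π φ θ μ w ↔
      mdp.tdMean f π φ θ μ w + mdp.tdBias f π φ θ μ = 0 := by
  rw [← mdp.integral_tdUpd f π φ hφ hb θ μ hR]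
  rfl

include hb in
theorem norm_tdMean_le (v : Vec d) : ‖mdp.tdMean f π φ θ μ v‖ ≤ CA K * ‖v‖ := by
  have := norm_integral_le_of_norm_le_const (μ := mdp.tdLaw f π θ μ)
    (ae_of_all _ (mdp.norm_tdVec_le π φ hb θ v))
  simpa [tdMean] using this

include hφ hb in
theorem norm_tdBias_le (hR : mdp.RewardBounded K.Rmax) :
    ‖mdp.tdBias f π φ θ μ‖ ≤ Cb K := by
  have h1 : ∀ᵐ z ∂(mdp.tdLaw f π θ μ), ‖z.2.1 • feat π φ θ z.1‖ ≤ Cb K := by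
    filter_upwards [mdp.ae_reward_tdLaw f π θ μ hR] with z hz
    rw [norm_smul, Cb]
    exact mul_le_mul hz (norm_feat_le π φ hb θ z.1) (norm_nonneg _) ((abs_nonneg _).trans hz)
  have := norm_integral_le_of_norm_le_const h1
  simpa [tdBias] using this

include hφ hb in
theorem inner_tdMean (u v : Vec d) : inner ℝ u (mdp.tdMean f π φ θ μ v) =
    u.ofLp ⬝ᵥ (mdp.matA f π φ θ μ).mulVec v.ofLp := by
  have hC : 0 ≤ K.Cφ := by
    obtain ⟨s⟩ := mdp.nonempty_state
    exact (norm_nonneg _).trans (norm_feat_le π φ hb θ s)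
  have hm : ∀ i, Measurable fun s => feat π φ θ s i := fun i =>
    (EuclideanSpace.proj (𝕜 := ℝ) i).continuous.measurable.comp (measurable_feat π φ hφ θ)
  have hbi : ∀ i s, |feat π φ θ s i| ≤ K.Cφ := fun i s =>
    (PiLp.norm_apply_le (feat π φ θ s) i).trans (norm_feat_le π φ hb θ s)
  have hi : ∀ i j, Integrable (fun z : S × (ℝ × S) => feat π φ θ z.1 i *
      (mdp.γ * feat π φ θ z.2.2 j - feat π φ θ z.1 j)) (mdp.tdLaw f π θ μ) := fun i j => by
    refine Integrable.of_bound (Measurable.aestronglyMeasurable ?_)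
      (K.Cφ * (|mdp.γ| * K.Cφ + K.Cφ)) (ae_of_all _ fun z => ?_)
    · exact ((hm i).comp measurable_fst).mul
        ((((hm j).comp (measurable_snd.comp measurable_snd)).const_mul _).sub
          ((hm j).comp measurable_fst))
    · rw [norm_mul]
      refine mul_le_mul (hbi i _) ((norm_sub_le _ _).trans (add_le_add ?_ (hbi j _)))
        (norm_nonneg _) hC
      rw [norm_mul]
      exact mul_le_mul_of_nonneg_left (hbi j _) (abs_nonneg _)
  rw [tdMean, ← integral_inner (mdp.integrable_tdVec f π φ hφ hb θ μ v)]
  have e : ∀ z : S × (ℝ × S), inner ℝ u (mdp.tdVec π φ θ v z) = ∑ i, ∑ j, u i * (feat π φ θ z.1 i *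
      (mdp.γ * feat π φ θ z.2.2 j - feat π φ θ z.1 j) * v j) := fun z => by
    rw [tdVec, inner_smul_right]
    simp only [PiLp.inner_apply, RCLike.inner_apply, conj_trivial]
    rw [Finset.mul_sum Finset.univ _ mdp.γ, ← Finset.sum_sub_distrib, Finset.sum_mul_sum, Finset.sum_comm]
    refine Finset.sum_congr rfl fun i _ => Finset.sum_congr rfl fun j _ => ?_
    ring
  simp_rw [e]
  rw [integral_finsetSum _ fun i _ => integrable_finsetSum _ fun j _ =>
    ((hi i j).mul_const _).const_mul _]
  simp only [dotProduct, Matrix.mulVec]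
  refine Finset.sum_congr rfl fun i _ => ?_
  rw [integral_finsetSum _ fun j _ => ((hi i j).mul_const _).const_mul _, Finset.mul_sum]
  refine Finset.sum_congr rfl fun j _ => ?_
  rw [integral_const_mul, integral_mul_const]
  rfl

include hφ hb in
theorem tdMean_eq (v : Vec d) : mdp.tdMean f π φ θ μ v =
    WithLp.toLp 2 ((mdp.matA f π φ θ μ).mulVec v.ofLp) := by
  refine ext_inner_left ℝ fun u => ?_
  rw [mdp.inner_tdMean f π φ hφ hb]
  simp only [PiLp.inner_apply, RCLike.inner_apply, conj_trivial, dotProduct]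
  exact Finset.sum_congr rfl fun i _ => mul_comm _ _

include hφ hb in
theorem existsUnique_tdFixedPoint (hR : mdp.RewardBounded K.Rmax)
    (hA : (mdp.matA f π φ θ μ).det ≠ 0) : ∃! w, mdp.IsTDFixedPoint f π φ θ μ w := by
  simp_rw [mdp.isTDFixedPoint_iff f π φ hφ hb θ μ hR, mdp.tdMean_eq f π φ hφ hb]
  set M := mdp.matA f π φ θ μ
  set b := mdp.tdBias f π φ θ μ
  have hu : IsUnit M.det := isUnit_iff_ne_zero.2 hA
  refine ⟨WithLp.toLp 2 (M⁻¹.mulVec (-b.ofLp)), ?_, fun w hw => ?_⟩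
  · simp only [Matrix.mulVec_mulVec, Matrix.mul_nonsing_inv M hu, Matrix.one_mulVec]
    ext i; simp
  · have h1 : M.mulVec w.ofLp = -b.ofLp := by
      have := eq_neg_of_add_eq_zero_left hw
      exact congrArg WithLp.ofLp this
    rw [← h1, Matrix.mulVec_mulVec, Matrix.nonsing_inv_mul M hu, Matrix.one_mulVec]

/-- Curvature in terms of the mean TD update. -/
theorem IsCurvature.inner_tdMean_le {stat : Vec d → Measure S}
    [∀ θ, IsProbabilityMeasure (stat θ)] {lam : ℝ}
    (hlam : mdp.IsCurvature f π φ stat lam) (hφ : Measurable (Function.uncurry φ))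
    (hb : ∀ s, ∀ u ∈ U, ‖φ s u‖ ≤ K.Cφ) (θ v : Vec d) :
    2 * inner ℝ v (mdp.tdMean f π φ θ (stat θ) v) ≤ -lam * ‖v‖ ^ 2 := by
  have h := hlam θ v.ofLp
  rw [Matrix.add_mulVec, dotProduct_add, Matrix.mulVec_transpose,
    dotProduct_comm _ (Matrix.vecMul _ _), ← Matrix.dotProduct_mulVec,
    ← mdp.inner_tdMean f π φ hφ hb] at h
  have e : v.ofLp ⬝ᵥ v.ofLp = ‖v‖ ^ 2 := by
    rw [EuclideanSpace.norm_sq_eq, dotProduct]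
    exact Finset.sum_congr rfl fun i _ => by rw [Real.norm_eq_abs, sq_abs, pow_two]
  rw [e] at h
  linarith

include hφ hb in
theorem inner_tdMean_eq_integral (u v : Vec d) : inner ℝ u (mdp.tdMean f π φ θ μ v) =
    ∫ z, (mdp.γ * inner ℝ (feat π φ θ z.2.2) v - inner ℝ (feat π φ θ z.1) v) *
      inner ℝ (feat π φ θ z.1) u ∂(mdp.tdLaw f π θ μ) := by
  rw [tdMean, ← integral_inner (mdp.integrable_tdVec f π φ hφ hb θ μ v)]
  refine integral_congr_ae (ae_of_all _ fun z => ?_)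
  simp only [tdVec]
  rw [inner_smul_right, real_inner_comm u]

include hφ hb in
-- Under the invariant law, the features of the current and of the next state have the same second
-- moment along `v`. With `2 x y ≤ x² + y²` the cross term is at most `γ` times this moment, against
-- `-1` times it from the diagonal term.
theorem inner_tdMean_self_le (hμ : mdp.IsStationaryDistribution f π θ μ) (v : Vec d) :
    inner ℝ v (mdp.tdMean f π φ θ μ v) ≤
      -(1 - mdp.γ) * ∫ s, (inner ℝ (feat π φ θ s) v) ^ 2 ∂μ := by
  have hm : Measurable fun s => inner ℝ (feat π φ θ s) v :=
    (measurable_feat π φ hφ θ).inner measurable_const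
  have hbd : ∀ s, |inner ℝ (feat π φ θ s) v| ≤ K.Cφ * ‖v‖ := fun s =>
    (abs_real_inner_le_norm _ _).trans
      (mul_le_mul_of_nonneg_right (norm_feat_le π φ hb θ s) (norm_nonneg _))
  have hsq : BddMeas (fun s => (inner ℝ (feat π φ θ s) v) ^ 2) ((K.Cφ * ‖v‖) ^ 2) :=
    ⟨hm.pow_const 2, fun s => by
      rw [abs_pow]; exact pow_le_pow_left₀ (abs_nonneg _) (hbd s) 2⟩
  have i1 : Integrable (fun z : S × (ℝ × S) => (inner ℝ (feat π φ θ z.1) v) ^ 2)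
      (mdp.tdLaw f π θ μ) :=
    Integrable.of_bound (hsq.meas.comp measurable_fst).aestronglyMeasurable _
      (ae_of_all _ fun z => hsq.bound z.1)
  have i2 : Integrable (fun z : S × (ℝ × S) => (inner ℝ (feat π φ θ z.2.2) v) ^ 2)
      (mdp.tdLaw f π θ μ) :=
    Integrable.of_bound (hsq.meas.comp
      (measurable_snd.comp measurable_snd)).aestronglyMeasurable _
      (ae_of_all _ fun z => hsq.bound z.2.2)
  have e1 : ∫ z, (inner ℝ (feat π φ θ z.1) v) ^ 2 ∂(mdp.tdLaw f π θ μ) =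
      ∫ s, (inner ℝ (feat π φ θ s) v) ^ 2 ∂μ := by
    rw [tdLaw, Measure.integral_compProd i1]
    simp
  have e2 : ∫ z, (inner ℝ (feat π φ θ z.2.2) v) ^ 2 ∂(mdp.tdLaw f π θ μ) =
      ∫ s, (inner ℝ (feat π φ θ s) v) ^ 2 ∂μ := by
    rw [tdLaw, Measure.integral_compProd i2]
    conv_rhs => rw [← mdp.bind_stationary f π hμ, integral_bind_bddMeas hsq]
    refine integral_congr_ae (ae_of_all _ fun s => ?_)
    simp only [kop, polKernel_apply]
    rw [integral_map measurable_snd.aemeasurable hsq.meas.aestronglyMeasurable]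
  rw [mdp.inner_tdMean_eq_integral f π φ hφ hb]
  have i3 : Integrable (fun z : S × (ℝ × S) =>
      mdp.γ / 2 * (inner ℝ (feat π φ θ z.2.2) v) ^ 2 +
        (mdp.γ / 2 - 1) * (inner ℝ (feat π φ θ z.1) v) ^ 2) (mdp.tdLaw f π θ μ) :=
    (i2.const_mul _).add (i1.const_mul _)
  have i4 : Integrable (fun z : S × (ℝ × S) => (mdp.γ * inner ℝ (feat π φ θ z.2.2) v -
      inner ℝ (feat π φ θ z.1) v) * inner ℝ (feat π φ θ z.1) v) (mdp.tdLaw f π θ μ) := by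
    refine ((mdp.integrable_tdVec f π φ hφ hb θ μ v).const_inner v).congr
      (ae_of_all _ fun z => ?_)
    simp only [tdVec]
    rw [inner_smul_right, real_inner_comm v (feat π φ θ z.1)]
  refine (integral_mono i4 i3 fun z => ?_).trans (le_of_eq ?_)
  · have := mul_nonneg mdp.γ_nonneg
      (sq_nonneg (inner ℝ (feat π φ θ z.2.2) v - inner ℝ (feat π φ θ z.1) v))
    simp only
    nlinarith
  · rw [integral_add (i2.const_mul _) (i1.const_mul _), integral_const_mul, integral_const_mul,
      e1, e2]
    ring

include hφ hb in
-- With `y = Aᵀ u`, `‖y‖² = ⟨u, A y⟩` is at most `2 Cφ ‖y‖ E|⟨φ,u⟩|`; one factor `‖y‖` cancels and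
-- Jensen's inequality finishes. This bounds the second moment of the features from below by means
-- of `A`, with no quantitative assumption on `D`.
theorem norm_transpose_sq_le (u : Vec d) :
    ((mdp.matA f π φ θ μ).transpose.mulVec u.ofLp) ⬝ᵥ
      ((mdp.matA f π φ θ μ).transpose.mulVec u.ofLp) ≤
      (2 * K.Cφ) ^ 2 * ∫ s, (inner ℝ (feat π φ θ s) u) ^ 2 ∂μ := by
  set y : Vec d := WithLp.toLp 2 ((mdp.matA f π φ θ μ).transpose.mulVec u.ofLp) with hy
  have hC : 0 ≤ K.Cφ := by
    obtain ⟨s⟩ := mdp.nonempty_state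
    exact (norm_nonneg _).trans (norm_feat_le π φ hb θ s)
  have e1 : ((mdp.matA f π φ θ μ).transpose.mulVec u.ofLp) ⬝ᵥ
      ((mdp.matA f π φ θ μ).transpose.mulVec u.ofLp) = ‖y‖ ^ 2 := by
    rw [EuclideanSpace.norm_sq_eq, dotProduct]
    exact Finset.sum_congr rfl fun i _ => by rw [Real.norm_eq_abs, sq_abs, pow_two]
  have e2 : ‖y‖ ^ 2 = inner ℝ u (mdp.tdMean f π φ θ μ y) := by
    conv_rhs => rw [mdp.inner_tdMean f π φ hφ hb, Matrix.dotProduct_mulVec,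
      ← Matrix.mulVec_transpose]
    exact e1.symm
  have hm : Measurable fun s => inner ℝ (feat π φ θ s) u :=
    (measurable_feat π φ hφ θ).inner measurable_const
  have hbd : ∀ s, |inner ℝ (feat π φ θ s) u| ≤ K.Cφ * ‖u‖ := fun s =>
    (abs_real_inner_le_norm _ _).trans
      (mul_le_mul_of_nonneg_right (norm_feat_le π φ hb θ s) (norm_nonneg _))
  have habs : BddMeas (fun s => |inner ℝ (feat π φ θ s) u|) (K.Cφ * ‖u‖) :=
    ⟨continuous_abs.measurable.comp hm, fun s => by rw [abs_abs]; exact hbd s⟩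
  have hsq : BddMeas (fun s => (inner ℝ (feat π φ θ s) u) ^ 2) ((K.Cφ * ‖u‖) ^ 2) :=
    ⟨hm.pow_const 2, fun s => by
      rw [abs_pow]; exact pow_le_pow_left₀ (abs_nonneg _) (hbd s) 2⟩
  set m := ∫ s, |inner ℝ (feat π φ θ s) u| ∂μ with hmdef
  have hm0 : 0 ≤ m := integral_nonneg fun s => abs_nonneg _
  -- Jensen's inequality, as nonnegativity of the variance.
  have h1 : m ^ 2 ≤ ∫ s, (inner ℝ (feat π φ θ s) u) ^ 2 ∂μ := by
    have h0 : 0 ≤ ∫ s, (|inner ℝ (feat π φ θ s) u| - m) ^ 2 ∂μ :=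
      integral_nonneg fun s => sq_nonneg _
    have e3 : ∀ s, (|inner ℝ (feat π φ θ s) u| - m) ^ 2 =
        (inner ℝ (feat π φ θ s) u) ^ 2 - (2 * m * |inner ℝ (feat π φ θ s) u| - m ^ 2) :=
      fun s => by rw [sub_sq, sq_abs]; ring
    simp_rw [e3] at h0
    have i5 : Integrable (fun s => 2 * m * |inner ℝ (feat π φ θ s) u| - m ^ 2) μ :=
      ((habs.integrable _).const_mul _).sub (integrable_const _)
    rw [integral_sub (hsq.integrable _) i5, integral_sub ((habs.integrable _).const_mul _) (integrable_const _),
      integral_const_mul, ← hmdef] at h0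
    simp only [integral_const, probReal_univ, smul_eq_mul, one_mul] at h0
    linarith
  have h2 : ‖y‖ ^ 2 ≤ 2 * K.Cφ * ‖y‖ * m := by
    rw [e2, mdp.inner_tdMean_eq_integral f π φ hφ hb]
    have i1 : Integrable (fun z : S × (ℝ × S) => |inner ℝ (feat π φ θ z.1) u|)
        (mdp.tdLaw f π θ μ) :=
      Integrable.of_bound (habs.meas.comp measurable_fst).aestronglyMeasurable _
        (ae_of_all _ fun z => habs.bound z.1)
    have e4 : ∫ z, |inner ℝ (feat π φ θ z.1) u| ∂(mdp.tdLaw f π θ μ) = m := by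
      rw [tdLaw, Measure.integral_compProd i1]
      simp [hmdef]
    rw [← e4, ← integral_const_mul]
    refine (le_abs_self _).trans ((abs_integral_le_integral_abs).trans ?_)
    refine integral_mono_of_nonneg (ae_of_all _ fun z => abs_nonneg _) (i1.const_mul _)
      (ae_of_all _ fun z => ?_)
    simp only
    rw [abs_mul]
    refine mul_le_mul_of_nonneg_right ?_ (abs_nonneg _)
    have h3 : |inner ℝ (feat π φ θ z.1) y| ≤ K.Cφ * ‖y‖ :=
      (abs_real_inner_le_norm _ _).trans
        (mul_le_mul_of_nonneg_right (norm_feat_le π φ hb θ z.1) (norm_nonneg _))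
    have h4 : |inner ℝ (feat π φ θ z.2.2) y| ≤ K.Cφ * ‖y‖ :=
      (abs_real_inner_le_norm _ _).trans
        (mul_le_mul_of_nonneg_right (norm_feat_le π φ hb θ z.2.2) (norm_nonneg _))
    refine (abs_sub _ _).trans ?_
    rw [abs_mul, abs_of_nonneg mdp.γ_nonneg]
    have := mul_le_mul mdp.γ_lt_one.le h4 (abs_nonneg _) zero_le_one
    linarith
  have h3 : ‖y‖ ≤ 2 * K.Cφ * m := by
    rcases eq_or_lt_of_le (norm_nonneg y) with h | h
    · rw [← h]; positivity
    · rw [pow_two] at h2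
      have : ‖y‖ * ‖y‖ ≤ (2 * K.Cφ * m) * ‖y‖ := by linarith
      exact le_of_mul_le_mul_right this h
  rw [e1]
  calc ‖y‖ ^ 2 ≤ (2 * K.Cφ * m) ^ 2 := pow_le_pow_left₀ (norm_nonneg _) h3 2
    _ = (2 * K.Cφ) ^ 2 * m ^ 2 := by ring
    _ ≤ _ := mul_le_mul_of_nonneg_left h1 (sq_nonneg _)

end TD

/-- Uniform negative definiteness of the TD matrices. -/
theorem exists_isCurvature (hφ : Measurable (Function.uncurry φ)) {stat : Vec d → Measure S}
    (hstat : ∀ θ, mdp.IsStationaryDistribution f π θ (stat θ))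
    (hfeat : mdp.FeatureAssumption f π φ stat K) :
    ∃ lam > 0, mdp.IsCurvature f π φ stat lam := by
  have hb := hfeat.bounded
  have hC := hfeat.Cφ_pos
  have hg := mdp.one_sub_γ_pos
  have hp : ∀ θ, IsProbabilityMeasure (stat θ) := fun θ => (hstat θ).prob
  obtain ⟨κ, hκ, hM⟩ := exists_pos_mul_dotProduct_le d (CA K) (K.lamA ^ d)
    (pow_pos hfeat.lamA_pos d)
  -- `κ` is the uniform lower bound for `‖Aᵀ x‖² / ‖x‖²`; division by `(2 Cφ)²` makes it one for
  -- `E⟨φ,x⟩² / ‖x‖²`, and the factor `2` comes from `A + Aᵀ`.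
  refine ⟨2 * (1 - mdp.γ) * (κ / (2 * K.Cφ) ^ 2), by positivity, fun θ x => ?_⟩
  have hdet : K.lamA ^ d ≤ |((mdp.matA f π φ θ (stat θ)).transpose).det| := by
    rw [Matrix.det_transpose]
    exact pow_le_abs_det hfeat.lamA_pos.le (hfeat.eigenvalue θ)
  have hent : ∀ i j, |(mdp.matA f π φ θ (stat θ)).transpose i j| ≤ CA K := fun i j => by
    have h1 : (mdp.matA f π φ θ (stat θ)) j i =
        inner ℝ (EuclideanSpace.single j (1 : ℝ))
          (mdp.tdMean f π φ θ (stat θ) (EuclideanSpace.single i (1 : ℝ))) := by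
      rw [mdp.inner_tdMean f π φ hφ hb]
      simp
    rw [Matrix.transpose_apply, h1]
    refine (abs_real_inner_le_norm _ _).trans ?_
    have := mdp.norm_tdMean_le f π φ hb θ (stat θ) (EuclideanSpace.single i (1 : ℝ))
    simpa using this
  have h1 := hM _ hent hdet x
  have h2 := mdp.norm_transpose_sq_le f π φ hφ hb θ (stat θ) (WithLp.toLp 2 x)
  have h3 := mdp.inner_tdMean_self_le f π φ hφ hb θ (stat θ) (hstat θ) (WithLp.toLp 2 x)
  rw [mdp.inner_tdMean f π φ hφ hb] at h3
  rw [Matrix.add_mulVec, dotProduct_add, Matrix.mulVec_transpose,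
    dotProduct_comm _ (Matrix.vecMul _ _), ← Matrix.dotProduct_mulVec]
  simp only at h2 h3
  set I := ∫ s, (inner ℝ (feat π φ θ s) (WithLp.toLp 2 x)) ^ 2 ∂(stat θ)
  have h4 : κ / (2 * K.Cφ) ^ 2 * (x ⬝ᵥ x) ≤ I := by
    rw [div_mul_eq_mul_div, div_le_iff₀ (by positivity)]
    linarith
  have h5 := mul_le_mul_of_nonneg_left h4 (by linarith : 0 ≤ 2 * (1 - mdp.γ))
  linarith

/-- Bound on the TD fixed point in terms of the curvature. -/
theorem norm_tdFixedPoint_le (hR : mdp.RewardBounded K.Rmax)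
    (hφ : Measurable (Function.uncurry φ)) {stat : Vec d → Measure S}
    [∀ θ, IsProbabilityMeasure (stat θ)] (hb : ∀ s, ∀ u ∈ U, ‖φ s u‖ ≤ K.Cφ) {lam : ℝ}
    (h0 : 0 < lam) (hlam : mdp.IsCurvature f π φ stat lam) {θ w : Vec d}
    (hw : mdp.IsTDFixedPoint f π φ θ (stat θ) w) : ‖w‖ ≤ 2 * Cb K / lam := by
  rw [mdp.isTDFixedPoint_iff f π φ hφ hb θ (stat θ) hR] at hw
  -- The equation `A w = -b` is paired with `w`. For a non-normal `A` the eigenvalue bound alone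
  -- would not give `‖A⁻¹‖ ≤ 1 / lamA`.
  have h1 := hlam.inner_tdMean_le mdp f π φ hφ hb θ w
  rw [eq_neg_of_add_eq_zero_left hw, inner_neg_right] at h1
  have h2 := real_inner_le_norm w (mdp.tdBias f π φ θ (stat θ))
  have h3 := mul_le_mul_of_nonneg_left (mdp.norm_tdBias_le f π φ hφ hb θ (stat θ) hR)
    (norm_nonneg w)
  have h4 : lam * ‖w‖ * ‖w‖ ≤ 2 * Cb K * ‖w‖ := by nlinarith
  rcases eq_or_lt_of_le (norm_nonneg w) with h | h
  · rw [← h]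
    have : 0 ≤ Cb K := (norm_nonneg _).trans (mdp.norm_tdBias_le f π φ hφ hb θ (stat θ) hR)
    positivity
  · rw [le_div_iff₀ h0, mul_comm]
    exact le_of_mul_le_mul_right h4 h

end MDP
end DPPG
end

noncomputable section
namespace DPPG

/-! ### Averages of independent samples -/

section Batch

variable {X : Type*} [MeasurableSpace X] {ν : Measure X} [IsProbabilityMeasure ν] {n M : ℕ}
  {g : X → Vec n} {C : ℝ}

/-- A step from `c` along the average of `g` over a batch. -/
def batchStep (c : Vec n) (α : ℝ) (g : X → Vec n) (x : Fin M → X) : Vec n :=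
  c + (α / M) • ∑ j, g (x j)

theorem measurable_batchStep (c : Vec n) (α : ℝ) (hg : Measurable g) :
    Measurable (batchStep (M := M) c α g) :=
  measurable_const.add (Measurable.fun_const_smul (Finset.measurable_sum _ fun j _ =>
    hg.comp (measurable_pi_apply j)) _)

theorem ae_norm_batchStep_le (c : Vec n) (α : ℝ) (hC : ∀ᵐ x ∂ν, ‖g x‖ ≤ C) :
    ∀ᵐ x ∂(Measure.pi fun _ : Fin M => ν), ‖batchStep c α g x‖ ≤ ‖c‖ + |α / M| * (M * C) := by
  have h : ∀ᵐ x ∂(Measure.pi fun _ : Fin M => ν), ∀ j, ‖g (x j)‖ ≤ C :=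
    ae_all_iff.2 fun j => (measurePreserving_eval (fun _ : Fin M => ν) j).quasiMeasurePreserving.ae hC
  filter_upwards [h] with x hx
  refine (norm_add_le _ _).trans (add_le_add_right ?_ _)
  rw [norm_smul, Real.norm_eq_abs]
  refine mul_le_mul_of_nonneg_left ((norm_sum_le _ _).trans ?_) (abs_nonneg _)
  exact (Finset.sum_le_sum fun j _ => hx j).trans (by simp)

theorem memLp_batchStep (c : Vec n) (α : ℝ) (hg : Measurable g) (hC : ∀ᵐ x ∂ν, ‖g x‖ ≤ C)
    (p : ENNReal) : MemLp (batchStep c α g) p (Measure.pi fun _ : Fin M => ν) :=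
  MemLp.of_bound (measurable_batchStep c α hg).aestronglyMeasurable _
    (ae_norm_batchStep_le c α hC)

theorem integral_batchStep (hM : 0 < M) (c : Vec n) (α : ℝ) (hg : Integrable g ν) :
    ∫ x, batchStep c α g x ∂(Measure.pi fun _ : Fin M => ν) = c + α • ∫ x, g x ∂ν := by
  have hi : ∀ j : Fin M, Integrable (fun x : Fin M → X => g (x j)) (Measure.pi fun _ => ν) :=
    fun j => integrable_comp_eval (μ := fun _ : Fin M => ν) (i := j) hg
  have hs : Integrable (fun x : Fin M → X => (α / M) • ∑ j, g (x j)) (Measure.pi fun _ => ν) :=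
    (integrable_finsetSum _ fun j _ => hi j).smul (α / M : ℝ)
  unfold batchStep
  rw [integral_add (integrable_const _) hs,
    integral_smul, integral_finsetSum _ fun j _ => hi j]
  simp_rw [integral_comp_eval (μ := fun _ : Fin M => ν) hg.aestronglyMeasurable]
  have : (M : ℝ) ≠ 0 := by positivity
  simp only [integral_const, probReal_univ, one_smul, Finset.sum_const, Finset.card_univ,
    Fintype.card_fin, ← Nat.cast_smul_eq_nsmul ℝ, smul_smul]
  rw [div_mul_cancel₀ _ this]

/-- Bias plus variance, coordinate by coordinate: the variance of a sum over independent samples is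
`M` times that of one sample, which is at most its second moment, and the second moments of the
coordinates add up to at most `C²`. -/
theorem integral_norm_sq_batchStep_le (hM : 0 < M) (c : Vec n) (α : ℝ) (hg : Measurable g)
    (hC : ∀ᵐ x ∂ν, ‖g x‖ ≤ C) :
    ∫ x, ‖batchStep c α g x‖ ^ 2 ∂(Measure.pi fun _ : Fin M => ν) ≤
      ‖c + α • ∫ x, g x ∂ν‖ ^ 2 + α ^ 2 / M * C ^ 2 := by
  have hM0 : (M : ℝ) ≠ 0 := by positivity
  have hgi : Integrable g ν := Integrable.of_bound hg.aestronglyMeasurable C hC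
  have hL := memLp_batchStep (M := M) c α hg hC 2
  have hgm : ∀ i, Measurable fun x => g x i := fun i => by fun_prop
  have hg2 : ∀ i, MemLp (fun x => g x i) 2 ν := fun i =>
    MemLp.of_bound (hgm i).aestronglyMeasurable C
      (hC.mono fun x hx => (PiLp.norm_apply_le (g x) i).trans hx)
  have hYi : ∀ i, MemLp (fun x : Fin M → X => batchStep c α g x i) 2
      (Measure.pi fun _ : Fin M => ν) := fun i =>
    hL.mono ((EuclideanSpace.proj (𝕜 := ℝ) i).continuous.measurable.comp
      (measurable_batchStep c α hg)).aestronglyMeasurable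
      (ae_of_all _ fun x => PiLp.norm_apply_le _ i)
  have hmean : ∀ i, ∫ x, batchStep c α g x i ∂(Measure.pi fun _ : Fin M => ν) =
      (c + α • ∫ x, g x ∂ν) i := fun i => by
    have := (EuclideanSpace.proj (𝕜 := ℝ) i).integral_comp_comm
      (hL.integrable (by norm_num) : Integrable (batchStep c α g) _)
    rw [integral_batchStep hM c α hgi] at this
    simpa using this
  have hvar : ∀ i, Var[fun x : Fin M → X => batchStep c α g x i; Measure.pi fun _ => ν] ≤
      α ^ 2 / M * ∫ x, g x i ^ 2 ∂ν := fun i => by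
    have e : (fun x : Fin M → X => batchStep c α g x i) =
        fun x => c i + (α / M) * (∑ j, fun x : Fin M → X => g (x j) i) x := by
      ext x; simp [batchStep]
    have hms : Measurable (∑ j, fun x : Fin M → X => g (x j) i) := by
        rw [Finset.sum_fn]
        exact Finset.measurable_sum _ fun j _ => (hgm i).comp (measurable_pi_apply j)
    rw [e, variance_const_add (hms.const_mul _).aestronglyMeasurable, variance_const_mul,
      variance_sum_pi (μ := fun _ : Fin M => ν) (X := fun _ x => g x i) fun _ => hg2 i]
    have h1 := variance_le_expectation_sq (hgm i).aestronglyMeasurable (μ := ν)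
    simp only [Finset.sum_const, Finset.card_univ, Fintype.card_fin, nsmul_eq_mul]
    calc (α / M) ^ 2 * (M * Var[fun x => g x i; ν]) = α ^ 2 / M * Var[fun x => g x i; ν] := by
          field_simp
      _ ≤ _ := mul_le_mul_of_nonneg_left h1 (by positivity)
  have hsq : ∀ i, ∫ x, batchStep c α g x i ^ 2 ∂(Measure.pi fun _ : Fin M => ν) ≤
      (c + α • ∫ x, g x ∂ν) i ^ 2 + α ^ 2 / M * ∫ x, g x i ^ 2 ∂ν := fun i => by
    have h := variance_eq_sub (hYi i)
    have h1 := hvar i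
    rw [h, hmean] at h1
    have : ∫ x, batchStep c α g x i ^ 2 ∂(Measure.pi fun _ : Fin M => ν) =
      (∫ x, ((fun x : Fin M → X => batchStep c α g x i) ^ 2) x ∂(Measure.pi fun _ => ν)) := rfl
    linarith
  have hsum : ∑ i, ∫ x, g x i ^ 2 ∂ν ≤ C ^ 2 := by
    rw [← integral_finsetSum _ fun i _ => (hg2 i).integrable_sq]
    have : ∀ᵐ x ∂ν, ‖∑ i, g x i ^ 2‖ ≤ C ^ 2 := by
      filter_upwards [hC] with x hx
      rw [← EuclideanSpace.real_norm_sq_eq, Real.norm_eq_abs, abs_of_nonneg (sq_nonneg _)]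
      exact pow_le_pow_left₀ (norm_nonneg _) hx 2
    have := norm_integral_le_of_norm_le_const this
    rw [probReal_univ, mul_one] at this
    exact (le_abs_self _).trans this
  simp only [EuclideanSpace.real_norm_sq_eq]
  rw [integral_finsetSum _ fun i _ => (hYi i).integrable_sq]
  refine (Finset.sum_le_sum fun i _ => hsq i).trans ?_
  rw [Finset.sum_add_distrib, ← Finset.mul_sum]
  exact add_le_add_right (mul_le_mul_of_nonneg_left hsum (by positivity)) _

end Batch

end DPPG
end

/-! ### One-step estimates for the actor and the critic -/

noncomputable section
namespace DPPG

theorem batchStep_sub {X : Type*} {n M : ℕ} (c e : Vec n) (α : ℝ) (g : X → Vec n)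
    (x : Fin M → X) : batchStep c α g x - e = batchStep (c - e) α g x := by
  unfold batchStep; abel

theorem batchStep_eq_add {X : Type*} {n M : ℕ} (c : Vec n) (α : ℝ) (g : X → Vec n)
    (x : Fin M → X) : batchStep c α g x = c + batchStep 0 α g x := by
  unfold batchStep; abel

/-- An upper bound that separates the two coordinates reduces the expectation over a joint batch to
one expectation per batch. `Φ` is only bounded from above, so its measurability plays no role. -/
theorem lintegral_prod_ofReal_add_le {X Y : Type*} [MeasurableSpace X] [MeasurableSpace Y]
    {μ : Measure X} {ν : Measure Y} [IsProbabilityMeasure μ] [IsProbabilityMeasure ν]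
    {F₁ : X → ℝ} {F₂ : Y → ℝ} (h₁ : Integrable F₁ μ) (h₂ : Integrable F₂ ν) {Φ : X × Y → ℝ}
    (hΦ0 : ∀ p, 0 ≤ Φ p) (hΦ : ∀ p, Φ p ≤ F₁ p.1 + F₂ p.2) {N C : ℝ} (hN : 0 ≤ N)
    (hC : ∫ x, F₁ x ∂μ + ∫ y, F₂ y ∂ν + N ≤ C) :
    ∫⁻ p, ENNReal.ofReal (Φ p) ∂(μ.prod ν) + ENNReal.ofReal N ≤ ENNReal.ofReal C := by
  have i₁ : Integrable (fun p : X × Y => F₁ p.1) (μ.prod ν) := h₁.comp_fst ν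
  have i₂ : Integrable (fun p : X × Y => F₂ p.2) (μ.prod ν) := h₂.comp_snd μ
  have h0 : ∀ p : X × Y, 0 ≤ F₁ p.1 + F₂ p.2 := fun p => (hΦ0 p).trans (hΦ p)
  have e : ∫ p, (F₁ p.1 + F₂ p.2) ∂(μ.prod ν) = ∫ x, F₁ x ∂μ + ∫ y, F₂ y ∂ν := by
    rw [integral_add i₁ i₂, integral_fun_fst, integral_fun_snd]; simp
  calc _ ≤ ∫⁻ p, ENNReal.ofReal (F₁ p.1 + F₂ p.2) ∂(μ.prod ν) + ENNReal.ofReal N :=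
        add_le_add_left (lintegral_mono fun p => ENNReal.ofReal_le_ofReal (hΦ p)) _
    _ = ENNReal.ofReal (∫ x, F₁ x ∂μ + ∫ y, F₂ y ∂ν + N) := by
        rw [← ofReal_integral_eq_lintegral_ofReal (by exact i₁.add i₂) (ae_of_all _ h0),
          ← ENNReal.ofReal_add (integral_nonneg h0) hN, e]
    _ ≤ _ := ENNReal.ofReal_le_ofReal hC

section Quadratic

variable {E : Type*} [NormedAddCommGroup E] [InnerProductSpace ℝ E]

theorem norm_add_sq_le_of_pos (x y : E) {ε : ℝ} (hε : 0 < ε) :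
    ‖x + y‖ ^ 2 ≤ (1 + ε) * ‖x‖ ^ 2 + (1 + 1 / ε) * ‖y‖ ^ 2 := by
  have h1 := norm_add_le x y
  have h2 : ‖x + y‖ ^ 2 ≤ (‖x‖ + ‖y‖) ^ 2 := pow_le_pow_left₀ (norm_nonneg _) h1 2
  have h3 : 0 ≤ (ε * ‖x‖ - ‖y‖) ^ 2 / ε := by positivity
  have h4 : (ε * ‖x‖ - ‖y‖) ^ 2 / ε = ε * ‖x‖ ^ 2 - 2 * ‖x‖ * ‖y‖ + 1 / ε * ‖y‖ ^ 2 := by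
    field_simp
    ring
  nlinarith

/-- Contraction of a perturbed step along a direction of negative curvature. -/
theorem norm_step_sq_le {u y z : E} {lam C α κ : ℝ} (hα : 0 < α) (hlam : 0 < lam)
    (hαC : α * C ^ 2 ≤ lam / 2) (ha : α * lam ≤ 2)
    (hy : 2 * inner ℝ u y ≤ -lam * ‖u‖ ^ 2) (hyC : ‖y‖ ≤ C * ‖u‖) (hz : ‖z‖ ≤ C * κ) :
    ‖u + α • (y - z)‖ ^ 2 ≤ (1 - 3 * (α * lam) / 8) * ‖u‖ ^ 2 + 5 * κ ^ 2 := by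
  have hapos : 0 < α * lam := mul_pos hα hlam
  have h1 : ‖u + α • y‖ ^ 2 ≤ (1 - α * lam / 2) * ‖u‖ ^ 2 := by
    rw [norm_add_sq_real, inner_smul_right, norm_smul, Real.norm_eq_abs, mul_pow, sq_abs]
    have e1 : ‖y‖ ^ 2 ≤ C ^ 2 * ‖u‖ ^ 2 := by
      rw [← mul_pow]; exact pow_le_pow_left₀ (norm_nonneg _) hyC 2
    have e2 : α * ‖y‖ ^ 2 ≤ lam / 2 * ‖u‖ ^ 2 := by
      calc α * ‖y‖ ^ 2 ≤ α * (C ^ 2 * ‖u‖ ^ 2) := mul_le_mul_of_nonneg_left e1 hα.le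
        _ = (α * C ^ 2) * ‖u‖ ^ 2 := by ring
        _ ≤ _ := mul_le_mul_of_nonneg_right hαC (sq_nonneg _)
    have e3 : α * (2 * inner ℝ u y + α * ‖y‖ ^ 2) ≤ α * (-lam * ‖u‖ ^ 2 + lam / 2 * ‖u‖ ^ 2) :=
      mul_le_mul_of_nonneg_left (add_le_add hy e2) hα.le
    linarith
  have h2 : ‖-(α • z)‖ ^ 2 ≤ α * lam / 2 * κ ^ 2 := by
    rw [norm_neg, norm_smul, Real.norm_eq_abs, mul_pow, sq_abs]
    have e1 : ‖z‖ ^ 2 ≤ C ^ 2 * κ ^ 2 := by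
      rw [← mul_pow]; exact pow_le_pow_left₀ (norm_nonneg _) hz 2
    calc α ^ 2 * ‖z‖ ^ 2 ≤ α ^ 2 * (C ^ 2 * κ ^ 2) := mul_le_mul_of_nonneg_left e1 (sq_nonneg _)
      _ = α * (α * C ^ 2) * κ ^ 2 := by ring
      _ ≤ α * (lam / 2) * κ ^ 2 := by gcongr
      _ = _ := by ring
  -- With `a = α * lam`, Young's inequality at `ε = a/8` turns the contraction `1 - a/2` into at
  -- most `1 - 3a/8`, and multiplies the perturbation `(a/2) κ²` by `1 + 8/a`; the result is at most
  -- `5 κ²` as `a ≤ 2`.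
  have h3 := norm_add_sq_le_of_pos (u + α • y) (-(α • z)) (ε := α * lam / 8) (by positivity)
  have e : u + α • (y - z) = u + α • y + -(α • z) := by rw [smul_sub]; abel
  rw [e]
  refine h3.trans ?_
  set a := α * lam
  have h4 : (1 + a / 8) * ‖u + α • y‖ ^ 2 ≤ (1 + a / 8) * ((1 - a / 2) * ‖u‖ ^ 2) :=
    mul_le_mul_of_nonneg_left h1 (by positivity)
  have h5 : (1 + 1 / (a / 8)) * ‖-(α • z)‖ ^ 2 ≤ (1 + 1 / (a / 8)) * (a / 2 * κ ^ 2) :=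
    mul_le_mul_of_nonneg_left h2 (by positivity)
  have h6 : (1 + 1 / (a / 8)) * (a / 2 * κ ^ 2) = (a / 2 + 4) * κ ^ 2 := by
    field_simp
    ring
  have h7 : (a / 2 + 4) * κ ^ 2 ≤ 5 * κ ^ 2 := mul_le_mul_of_nonneg_right (by linarith) (sq_nonneg _)
  have h8 : (1 + a / 8) * ((1 - a / 2) * ‖u‖ ^ 2) ≤ (1 - 3 * a / 8) * ‖u‖ ^ 2 := by
    have : 0 ≤ a ^ 2 * ‖u‖ ^ 2 := by positivity
    linarith
  linarith

end Quadratic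

namespace MDP

variable {S A : Type*} [MeasurableSpace S] [MeasurableSpace A] (mdp : MDP S A)
  {k d : ℕ} {U : Set (Vec k)} (f : Kernel (Vec k) A) [IsMarkovKernel f] (π : ParamPolicy S U d)
  {K : Consts}

/-- Actor direction at a sampled state. -/
def actorDir (θ w : Vec d) (s : S) : Vec d :=
  ContinuousLinearMap.adjoint (π.jac θ s) (π.jac θ s w)

/-- The critic weights after one iteration. -/
def nextW (φ : S → Vec k → Vec d) {M : ℕ} (αw : ℝ) (θ w : Vec d)
    (x : (Fin M → S × (ℝ × S)) × (Fin M → S)) : Vec d :=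
  batchStep w αw (mdp.tdUpd π φ θ w) x.1

/-- The policy parameter after one iteration. -/
def nextθ {M : ℕ} (αθ : ℝ) (θ w : Vec d) (x : (Fin M → S × (ℝ × S)) × (Fin M → S)) : Vec d :=
  batchStep θ αθ (actorDir π θ w) x.2

theorem measurable_actorDir (θ w : Vec d) : Measurable (actorDir π θ w) :=
  (ContinuousLinearMap.apply ℝ (Vec d) w).continuous.measurable.comp
    (measurable_adjoint_jac_comp_jac π θ)

section Actor

variable (hpolicy : mdp.PolicyAssumption f π K)
include hpolicy

theorem norm_actorDir_le (θ w : Vec d) (s : S) : ‖actorDir π θ w s‖ ≤ Lh K * ‖w‖ :=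
  ContinuousLinearMap.le_of_opNorm_le _ (mdp.norm_adjoint_jac_comp_jac_le f π hpolicy θ s) w

theorem integral_actorDir (θ w : Vec d) :
    ∫ s, actorDir π θ w s ∂(mdp.occProb f π θ) = (1 - mdp.γ) • mdp.Psi f π θ w := by
  rw [mdp.Psi_apply f π hpolicy, occProb, integral_smul_measure,
    ENNReal.toReal_ofReal mdp.one_sub_γ_pos.le]
  rfl

theorem norm_smul_Psi_sub_le (θ x : Vec d) :
    ‖(1 - mdp.γ) • mdp.Psi f π θ x‖ ≤ Lh K * ‖x‖ := by
  have h := mdp.norm_Psi_apply_le f π hpolicy θ x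
  have hg := mdp.one_sub_γ_pos
  rw [norm_smul, Real.norm_eq_abs, abs_of_pos hg]
  calc _ ≤ (1 - mdp.γ) * (K.Lπ ^ 2 / (1 - mdp.γ) * ‖x‖) := mul_le_mul_of_nonneg_left h hg.le
    _ = _ := by rw [Lh]; field_simp

end Actor

section Critic

variable (φ : S → Vec k → Vec d) (hφ : Measurable (Function.uncurry φ))
  {stat : Vec d → Measure S} [∀ θ, IsProbabilityMeasure (stat θ)]
  (hb : ∀ s, ∀ u ∈ U, ‖φ s u‖ ≤ K.Cφ) (hR : mdp.RewardBounded K.Rmax)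
include hφ hb

theorem tdMean_sub (θ : Vec d) (μ : Measure S) [IsProbabilityMeasure μ] (x y : Vec d) :
    mdp.tdMean f π φ θ μ (x - y) = mdp.tdMean f π φ θ μ x - mdp.tdMean f π φ θ μ y := by
  simp only [mdp.tdMean_eq f π φ hφ hb θ μ]
  ext i
  simp [Matrix.mulVec_sub]

variable {lam αw κ : ℝ} {M : ℕ} (hlam0 : 0 < lam) (hlam : mdp.IsCurvature f π φ stat lam)
  (hαw : 0 < αw) (hM : 0 < M) (hαC : αw * CA K ^ 2 ≤ lam / 2) (ha : αw * lam ≤ 2)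
  (hMC : 48 * αw * CA K ^ 2 ≤ lam * M)
include hR hlam0 hlam hαw hM hαC ha hMC

/-- Mean square distance to `e` after a critic step. -/
theorem integral_norm_critic_sub_sq_le {θ w e wTD : Vec d} {c : ℝ}
    (hTD : mdp.IsTDFixedPoint f π φ θ (stat θ) wTD) (hκ : ‖wTD - e‖ ≤ κ) (he : ‖e‖ ≤ c) :
    ∫ x, ‖batchStep (w - e) αw (mdp.tdUpd π φ θ w) x‖ ^ 2
        ∂(Measure.pi fun _ : Fin M => mdp.tdLaw f π θ (stat θ)) ≤
      (1 - 5 * (αw * lam) / 16) * ‖w - e‖ ^ 2 + 5 * κ ^ 2 + 3 * (αw * lam) / 2 * c ^ 2 / M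
        + 3 * αw ^ 2 * Cb K ^ 2 / M := by
  have hM0 : (0 : ℝ) < M := by positivity
  have hCA : 0 ≤ CA K := by unfold CA; positivity
  have hCb : 0 ≤ Cb K := by
    obtain ⟨s⟩ := mdp.nonempty_state
    exact mul_nonneg (mdp.Rmax_nonneg f hR)
      ((norm_nonneg _).trans (norm_feat_le π φ hb θ s))
  refine (integral_norm_sq_batchStep_le hM _ _ (mdp.measurable_tdUpd π φ hφ θ w)
    (mdp.ae_norm_tdUpd_le f π φ hb θ (stat θ) hR w)).trans ?_
  rw [mdp.integral_tdUpd f π φ hφ hb θ (stat θ) hR]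
  have hbias : mdp.tdBias f π φ θ (stat θ) = -mdp.tdMean f π φ θ (stat θ) wTD :=
    (neg_eq_of_add_eq_zero_right ((mdp.isTDFixedPoint_iff f π φ hφ hb θ (stat θ) hR wTD).1 hTD)).symm
  have e1 : mdp.tdMean f π φ θ (stat θ) w + mdp.tdBias f π φ θ (stat θ) =
      mdp.tdMean f π φ θ (stat θ) (w - e) - mdp.tdMean f π φ θ (stat θ) (wTD - e) := by
    rw [hbias, mdp.tdMean_sub f π φ hφ hb, mdp.tdMean_sub f π φ hφ hb]; abel
  have h1 : ‖w - e + αw • (mdp.tdMean f π φ θ (stat θ) w + mdp.tdBias f π φ θ (stat θ))‖ ^ 2 ≤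
      (1 - 3 * (αw * lam) / 8) * ‖w - e‖ ^ 2 + 5 * κ ^ 2 := by
    rw [e1]
    exact norm_step_sq_le hαw hlam0 hαC ha (hlam.inner_tdMean_le mdp f π φ hφ hb θ _)
      (mdp.norm_tdMean_le f π φ hb θ _ _) ((mdp.norm_tdMean_le f π φ hb θ _ _).trans
        (mul_le_mul_of_nonneg_left hκ hCA))
  have h2 : (CA K * ‖w‖ + Cb K) ^ 2 ≤
      3 * CA K ^ 2 * ‖w - e‖ ^ 2 + 3 * CA K ^ 2 * c ^ 2 + 3 * Cb K ^ 2 := by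
    have e2 : ‖w‖ ≤ ‖w - e‖ + c := by
      have := norm_le_norm_sub_add w e
      linarith
    have e3 : CA K * ‖w‖ + Cb K ≤ CA K * ‖w - e‖ + CA K * c + Cb K := by nlinarith
    refine (pow_le_pow_left₀ (by positivity) e3 2).trans ?_
    nlinarith [sq_nonneg (CA K * ‖w - e‖ - CA K * c), sq_nonneg (CA K * ‖w - e‖ - Cb K),
      sq_nonneg (CA K * c - Cb K)]
  -- The lower bound on `M` makes the part of the variance growing with `‖w - e‖²` at most `a/16` of
  -- it, with `a = αw * lam`; the contraction worsens from `1 - 3a/8` to `1 - 5a/16`. For the `c²`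
  -- part the step-size bound is used instead, so that the decay in `1/M` is kept.
  have h3 : αw ^ 2 / M * (CA K * ‖w‖ + Cb K) ^ 2 ≤ αw * lam / 16 * ‖w - e‖ ^ 2
      + 3 * (αw * lam) / 2 * c ^ 2 / M + 3 * αw ^ 2 * Cb K ^ 2 / M := by
    have e4 : αw ^ 2 / M * (3 * CA K ^ 2) ≤ αw * lam / 16 := by
      rw [div_mul_eq_mul_div, div_le_iff₀ hM0]
      nlinarith
    have e5 : αw ^ 2 / M * (3 * CA K ^ 2) ≤ 3 * (αw * lam) / 2 / M := by
      rw [div_mul_eq_mul_div, div_le_div_iff_of_pos_right hM0]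
      nlinarith
    calc _ ≤ αw ^ 2 / M *
          (3 * CA K ^ 2 * ‖w - e‖ ^ 2 + 3 * CA K ^ 2 * c ^ 2 + 3 * Cb K ^ 2) :=
          mul_le_mul_of_nonneg_left h2 (by positivity)
      _ = αw ^ 2 / M * (3 * CA K ^ 2) * ‖w - e‖ ^ 2 + αw ^ 2 / M * (3 * CA K ^ 2) * c ^ 2
          + 3 * αw ^ 2 * Cb K ^ 2 / M := by ring
      _ ≤ αw * lam / 16 * ‖w - e‖ ^ 2 + 3 * (αw * lam) / 2 / M * c ^ 2
          + 3 * αw ^ 2 * Cb K ^ 2 / M := by gcongr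
      _ = _ := by ring
  linarith

end Critic

end MDP

end DPPG
end

/-! ### The Lyapunov function of the joint iteration -/

noncomputable section
namespace DPPG
namespace MDP

variable {S A : Type*} [MeasurableSpace S] [MeasurableSpace A] (mdp : MDP S A)
  {k d : ℕ} {U : Set (Vec k)} (f : Kernel (Vec k) A) [IsMarkovKernel f] (π : ParamPolicy S U d)
  {K : Consts}

/-- Lyapunov function of the joint actor-critic iteration, where `a = α_w λ`. -/
def lyap (K : Consts) (a αθ : ℝ) (wξ : Vec d → Vec d) (θ w : Vec d) : ℝ :=
  2 * (1 - mdp.γ) / αθ * (K.Rmax / (1 - mdp.γ) - mdp.J f π θ)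
    + 48 * Lh K ^ 2 / (5 * a) * ‖w - wξ θ‖ ^ 2

/-- Bound on the increase of the Lyapunov function in one iteration, where `a = α_w λ`. -/
def lyapErr (K : Consts) (a αw κ : ℝ) (M : ℕ) : ℝ :=
  54 * Lh K ^ 2 * κ ^ 2 / a + 18 * Lh K ^ 2 * mdp.Cwξ K ^ 2 / M
    + 33 * Lh K ^ 2 * αw ^ 2 * Cb K ^ 2 / (a * M)

theorem Lh_pos (hpolicy : mdp.PolicyAssumption f π K) : 0 < Lh K := pow_pos hpolicy.Lπ_pos 2

theorem lyap_nonneg (hR : mdp.RewardBounded K.Rmax) {a αθ : ℝ} (ha : 0 < a) (hαθ : 0 < αθ)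
    (wξ : Vec d → Vec d) (θ w : Vec d) : 0 ≤ mdp.lyap f π K a αθ wξ θ w := by
  have h := (abs_le.1 (mdp.abs_J_le f π hR θ)).2
  have hg := mdp.one_sub_γ_pos
  exact add_nonneg (mul_nonneg (by positivity) (sub_nonneg.2 h)) (by positivity)

theorem lyapErr_nonneg {a αw κ : ℝ} (ha : 0 < a) (M : ℕ) : 0 ≤ mdp.lyapErr K a αw κ M := by
  unfold lyapErr; positivity

/-- Pointwise growth of the Lyapunov function along a step `δ` of the policy parameter. -/
theorem lyap_add_le (hU : U ⊆ closure (interior U)) (hR : mdp.RewardBounded K.Rmax)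
    (henv : mdp.EnvAssumption f U K) (hq : mdp.QAssumption f π K)
    (hpolicy : mdp.PolicyAssumption f π K)
    {wξ : Vec d → Vec d} (hw : ∀ θ, mdp.Psi f π θ (wξ θ) = mdp.gradJ f π θ)
    {a αθ : ℝ} (ha : 0 < a) (ha2 : a ≤ 2) (hαθ : 0 < αθ) (θ δ w' : Vec d) :
    mdp.lyap f π K a αθ wξ (θ + δ) w' ≤
      48 * Lh K ^ 2 / (5 * a) * (1 + a / 16) * ‖w' - wξ θ‖ ^ 2 +
      (2 * (1 - mdp.γ) / αθ * (K.Rmax / (1 - mdp.γ) - mdp.J f π θ)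
        - 2 * (1 - mdp.γ) / αθ * inner ℝ (mdp.gradJ f π θ) δ
        + ((1 - mdp.γ) / αθ * mdp.lipGradJ K
          + 48 * Lh K ^ 2 / (5 * a) * (18 / a * mdp.lipWeight K ^ 2)) * ‖δ‖ ^ 2) := by
  have hg := mdp.one_sub_γ_pos
  have h1 := sub_sub_inner_ge (mdp.hasGradientAt_J f π hU hR henv hq hpolicy)
    (mdp.norm_gradJ_sub_le f π hU hR henv hq hpolicy) θ δ
  have h2 := mdp.norm_compatibleWeight_sub_le f π hU hR henv hq hpolicy hw θ (θ + δ)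
  rw [show θ - (θ + δ) = -δ by abel, norm_neg] at h2
  -- The target `wξ` moves with the actor. Taking `ε = a/16` spends only a small part of the
  -- critic's contraction on this drift, whose own weight `1 + 16/a` is at most `18/a` since `a ≤
  -- 2`.
  have h3 := norm_add_sq_le_of_pos (w' - wξ θ) (wξ θ - wξ (θ + δ)) (ε := a / 16) (by positivity)
  rw [sub_add_sub_cancel] at h3
  have h4 : (1 + 1 / (a / 16)) * ‖wξ θ - wξ (θ + δ)‖ ^ 2 ≤
      18 / a * mdp.lipWeight K ^ 2 * ‖δ‖ ^ 2 := by
    have e1 : 1 + 1 / (a / 16) ≤ 18 / a := by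
      rw [one_div_div, le_div_iff₀ ha, add_mul, div_mul_cancel₀ _ ha.ne']; linarith
    have e2 := pow_le_pow_left₀ (norm_nonneg _) h2 2
    rw [mul_pow] at e2
    calc _ ≤ 18 / a * (mdp.lipWeight K ^ 2 * ‖δ‖ ^ 2) :=
          mul_le_mul e1 e2 (by positivity) (by positivity)
      _ = _ := by ring
  have h5 : 48 * Lh K ^ 2 / (5 * a) * ‖w' - wξ (θ + δ)‖ ^ 2 ≤ 48 * Lh K ^ 2 / (5 * a) *
      ((1 + a / 16) * ‖w' - wξ θ‖ ^ 2 + 18 / a * mdp.lipWeight K ^ 2 * ‖δ‖ ^ 2) :=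
    mul_le_mul_of_nonneg_left (h3.trans (by linarith)) (by positivity)
  have h6 : 2 * (1 - mdp.γ) / αθ * (mdp.J f π θ + inner ℝ (mdp.gradJ f π θ) δ
      - mdp.lipGradJ K / 2 * ‖δ‖ ^ 2) ≤ 2 * (1 - mdp.γ) / αθ * mdp.J f π (θ + δ) :=
    mul_le_mul_of_nonneg_left h1 (by positivity)
  unfold lyap
  have e : (1 - mdp.γ) / αθ = 2 * (1 - mdp.γ) / αθ / 2 := by ring
  rw [e]
  linarith

/-- The real inequality that combines the actor and critic estimates. -/
theorem actor_critic_combine {g a L αθ Lh c κ2 V M N HH GH D σ x Cw Cb2 Δ2 lw : ℝ}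
    (hg : 0 < g) (hg1 : g ≤ 1) (ha : 0 < a) (ha2 : a ≤ 2) (hαθ : 0 < αθ)
    (hL0 : 0 ≤ L) (hL : αθ * L ≤ 1 / 2) (hLh : 0 < Lh) (hM : 1 ≤ M) (hx : 0 ≤ x)
    (hHH : 0 ≤ HH) (hσ0 : 0 ≤ σ) (hκ : 0 ≤ κ2) (hc : 0 ≤ c) (hCb : 0 ≤ Cb2)
    (hD : N + HH - 2 * GH = D) (hDx : D ≤ Lh ^ 2 * x)
    (hσ : σ ≤ 2 * Lh ^ 2 / M * (x + c))
    (hlw : 18 / a * lw ^ 2 * αθ ^ 2 ≤ a / (48 * Lh ^ 2))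
    (hΔ : Δ2 ≤ αθ ^ 2 * (HH + σ))
    (hV : V ≤ (1 - 5 * a / 16) * x + 5 * κ2 + 3 * a / 2 * c / M + 3 * Cb2 / M) :
    48 * Lh ^ 2 / (5 * a) * (1 + a / 16) * V
      + (Cw - 2 * GH + (g / αθ * L + 48 * Lh ^ 2 / (5 * a) * (18 / a * lw ^ 2)) * Δ2) + N ≤
    Cw + 48 * Lh ^ 2 / (5 * a) * x +
      (54 * Lh ^ 2 * κ2 / a + 18 * Lh ^ 2 * c / M + 33 * Lh ^ 2 * Cb2 / (a * M)) := by
  have hM0 : 0 < M := by linarith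
  have h1 : (g / αθ * L + 48 * Lh ^ 2 / (5 * a) * (18 / a * lw ^ 2)) * Δ2 ≤
      7 / 10 * (HH + σ) := by
    have e1 : g / αθ * L * αθ ^ 2 ≤ 1 / 2 := by
      have : g / αθ * L * αθ ^ 2 = g * (αθ * L) := by field_simp
      rw [this]
      nlinarith [mul_nonneg hαθ.le hL0]
    -- The drift of `wξ` takes `1/5` and the curvature of `J` takes `1/2`. Their sum `7/10` stays
    -- below the full `HH` gained from `-2 * GH = D - N - HH`.
    have e2 : 48 * Lh ^ 2 / (5 * a) * (18 / a * lw ^ 2) * αθ ^ 2 ≤ 1 / 5 := by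
      calc _ = 48 * Lh ^ 2 / (5 * a) * (18 / a * lw ^ 2 * αθ ^ 2) := by ring
        _ ≤ 48 * Lh ^ 2 / (5 * a) * (a / (48 * Lh ^ 2)) :=
          mul_le_mul_of_nonneg_left hlw (by positivity)
        _ = _ := by field_simp
    calc _ ≤ (g / αθ * L + 48 * Lh ^ 2 / (5 * a) * (18 / a * lw ^ 2)) * (αθ ^ 2 * (HH + σ)) :=
          mul_le_mul_of_nonneg_left hΔ (by positivity)
      _ = (g / αθ * L * αθ ^ 2 + 48 * Lh ^ 2 / (5 * a) * (18 / a * lw ^ 2) * αθ ^ 2)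
          * (HH + σ) := by ring
      _ ≤ 7 / 10 * (HH + σ) := mul_le_mul_of_nonneg_right (by linarith) (by positivity)
  have hσ' : σ ≤ 2 * Lh ^ 2 * x + 2 * Lh ^ 2 * c / M := by
    have : 2 * Lh ^ 2 / M * x ≤ 2 * Lh ^ 2 * x := by
      rw [div_mul_eq_mul_div]; exact div_le_self (by positivity) hM
    calc σ ≤ _ := hσ
      _ = 2 * Lh ^ 2 / M * x + 2 * Lh ^ 2 * c / M := by ring
      _ ≤ _ := by linarith
  -- Contraction and drift combine to at most `1 - a/4`, so the weight `48/(5a)` releases `12/5 *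
  -- Lh² x`. This is exactly what `D ≤ Lh² x` and `7/10 * σ ≤ 7/5 * Lh² x + ...` require.
  have h2 : 48 * Lh ^ 2 / (5 * a) * (1 + a / 16) * V ≤
      48 * Lh ^ 2 / (5 * a) * x - 12 / 5 * Lh ^ 2 * x + 54 * Lh ^ 2 * κ2 / a
      + 81 / 5 * Lh ^ 2 * c / M + 33 * Lh ^ 2 * Cb2 / (a * M) := by
    calc _ ≤ 48 * Lh ^ 2 / (5 * a) * (1 + a / 16) *
          ((1 - 5 * a / 16) * x + 5 * κ2 + 3 * a / 2 * c / M + 3 * Cb2 / M) :=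
          mul_le_mul_of_nonneg_left hV (by positivity)
      _ = 48 * Lh ^ 2 / (5 * a) * ((1 + a / 16) * ((1 - 5 * a / 16) * x))
          + 48 * Lh ^ 2 / (5 * a) * ((1 + a / 16) *
            (5 * κ2 + 3 * a / 2 * c / M + 3 * Cb2 / M)) := by ring
      _ ≤ 48 * Lh ^ 2 / (5 * a) * ((1 - a / 4) * x)
          + 48 * Lh ^ 2 / (5 * a) * (9 / 8 *
            (5 * κ2 + 3 * a / 2 * c / M + 3 * Cb2 / M)) := by
          have e3 : (1 + a / 16) * ((1 - 5 * a / 16) * x) ≤ (1 - a / 4) * x := by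
            have : 0 ≤ a ^ 2 * x := by positivity
            linarith
          have e4 : 1 + a / 16 ≤ 9 / 8 := by linarith
          gcongr
      _ = 48 * Lh ^ 2 / (5 * a) * x - 12 / 5 * Lh ^ 2 * x + 54 * Lh ^ 2 * κ2 / a
          + 81 / 5 * Lh ^ 2 * c / M + 162 / 5 * (Lh ^ 2 * Cb2 / (a * M)) := by
          field_simp
          ring
      _ ≤ _ := by
          have : 0 ≤ Lh ^ 2 * Cb2 / (a * M) := by positivity
          have e5 : 33 * Lh ^ 2 * Cb2 / (a * M) = 33 * (Lh ^ 2 * Cb2 / (a * M)) := by ring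
          rw [e5]
          linarith
  have h3 : 0 ≤ Lh ^ 2 * c / M := by positivity
  have e6 : 81 / 5 * Lh ^ 2 * c / M = 81 / 5 * (Lh ^ 2 * c / M) := by ring
  have e7 : 18 * Lh ^ 2 * c / M = 18 * (Lh ^ 2 * c / M) := by ring
  have e8 : 2 * Lh ^ 2 * c / M = 2 * (Lh ^ 2 * c / M) := by ring
  rw [e6] at h2
  rw [e8] at hσ'
  rw [e7]
  linarith

/-- One iteration decreases the Lyapunov function on average by the squared gradient norm, up to
the error. -/
theorem lintegral_lyap_next_le (hU : U ⊆ closure (interior U)) (hR : mdp.RewardBounded K.Rmax)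
    (henv : mdp.EnvAssumption f U K) (hq : mdp.QAssumption f π K)
    (hpolicy : mdp.PolicyAssumption f π K)
    {wξ : Vec d → Vec d} (hw : ∀ θ, mdp.Psi f π θ (wξ θ) = mdp.gradJ f π θ)
    (φ : S → Vec k → Vec d) (hφ : Measurable (Function.uncurry φ))
    {stat : Vec d → Measure S} [∀ θ, IsProbabilityMeasure (stat θ)]
    (hb : ∀ s, ∀ u ∈ U, ‖φ s u‖ ≤ K.Cφ)
    {lam αw αθ κ : ℝ} {M : ℕ} (hlam0 : 0 < lam) (hlam : mdp.IsCurvature f π φ stat lam)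
    (hαw : 0 < αw) (hM : 0 < M) (hαC : αw * CA K ^ 2 ≤ lam / 2) (ha : αw * lam ≤ 2)
    (hMC : 48 * αw * CA K ^ 2 ≤ lam * M) (hαθ : 0 < αθ) (hL : αθ * mdp.lipGradJ K ≤ 1 / 2)
    (hlw : 18 / (αw * lam) * mdp.lipWeight K ^ 2 * αθ ^ 2 ≤ αw * lam / (48 * Lh K ^ 2))
    {θ wTD : Vec d} (hTD : mdp.IsTDFixedPoint f π φ θ (stat θ) wTD)
    (hκ : ‖wTD - wξ θ‖ ≤ κ) (w : Vec d) :
    ∫⁻ x, ENNReal.ofReal (mdp.lyap f π K (αw * lam) αθ wξ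
        (nextθ π αθ θ w x) (mdp.nextW π φ αw θ w x)) ∂(mdp.batchLaw f π M θ (stat θ))
      + ENNReal.ofReal ((1 - mdp.γ) ^ 2 * ‖mdp.gradJ f π θ‖ ^ 2) ≤
    ENNReal.ofReal (mdp.lyap f π K (αw * lam) αθ wξ θ w
      + mdp.lyapErr K (αw * lam) αw κ M) := by
  have hg := mdp.one_sub_γ_pos
  have hg1 : 1 - mdp.γ ≤ 1 := by linarith [mdp.γ_nonneg]
  have hapos : 0 < αw * lam := mul_pos hαw hlam0
  have hM1 : (1 : ℝ) ≤ M := by exact_mod_cast hM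
  have hLh := mdp.Lh_pos f π hpolicy
  have hcξ := mdp.norm_compatibleWeight_le f π hU hR henv hq hpolicy hw θ
  have hmA := measurable_actorDir π θ w
  have hbA := mdp.norm_actorDir_le f π hpolicy θ w
  set ν := mdp.occProb f π θ
  set H : Vec d := (1 - mdp.γ) • mdp.Psi f π θ w
  have hHint : ∫ s, actorDir π θ w s ∂ν = H := mdp.integral_actorDir f π hpolicy θ w
  have hAi : Integrable (actorDir π θ w) ν :=
    Integrable.of_bound hmA.aestronglyMeasurable _ (ae_of_all _ hbA)
  have hΔL := memLp_batchStep (ν := ν) (M := M) 0 αθ hmA (ae_of_all _ hbA) 2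
  have hΔi : Integrable (batchStep 0 αθ (actorDir π θ w)) (Measure.pi fun _ : Fin M => ν) :=
    hΔL.integrable (by norm_num)
  have hΔmean := integral_batchStep hM 0 αθ hAi
  have hΔsq := integral_norm_sq_batchStep_le (ν := ν) hM 0 αθ hmA (ae_of_all _ hbA)
  rw [zero_add, hHint] at hΔmean hΔsq
  rw [norm_smul, Real.norm_eq_abs, mul_pow, sq_abs] at hΔsq
  have hVL := memLp_batchStep (M := M) (w - wξ θ) αw (mdp.measurable_tdUpd π φ hφ θ w)
    (mdp.ae_norm_tdUpd_le f π φ hb θ (stat θ) hR w) 2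
  have hV := mdp.integral_norm_critic_sub_sq_le f π φ hφ hb hR hlam0 hlam hαw hM hαC ha hMC
    (w := w) hTD hκ hcξ
  have iV : Integrable (fun x => ‖batchStep (w - wξ θ) αw (mdp.tdUpd π φ θ w) x‖ ^ 2)
      (Measure.pi fun _ : Fin M => mdp.tdLaw f π θ (stat θ)) := hVL.integrable_norm_pow two_ne_zero
  have iΔ : Integrable (fun y => ‖batchStep 0 αθ (actorDir π θ w) y‖ ^ 2)
      (Measure.pi fun _ : Fin M => ν) := hΔL.integrable_norm_pow two_ne_zero
  have iG : Integrable (fun y => inner ℝ (mdp.gradJ f π θ) (batchStep 0 αθ (actorDir π θ w) y))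
      (Measure.pi fun _ : Fin M => ν) := hΔi.const_inner _
  set B := 48 * Lh K ^ 2 / (5 * (αw * lam))
  set c₀ := 2 * (1 - mdp.γ) / αθ * (K.Rmax / (1 - mdp.γ) - mdp.J f π θ)
  set c₂ := (1 - mdp.γ) / αθ * mdp.lipGradJ K + B * (18 / (αw * lam) * mdp.lipWeight K ^ 2)
  -- The new weights depend on the transition batch alone and the new parameter on the state batch
  -- alone, so the pointwise bound `lyap_add_le` separates.
  refine lintegral_prod_ofReal_add_le
    (F₁ := fun x => B * (1 + αw * lam / 16) * ‖batchStep (w - wξ θ) αw (mdp.tdUpd π φ θ w) x‖ ^ 2)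
    (F₂ := fun y => c₀ - 2 * (1 - mdp.γ) / αθ *
      inner ℝ (mdp.gradJ f π θ) (batchStep 0 αθ (actorDir π θ w) y)
      + c₂ * ‖batchStep 0 αθ (actorDir π θ w) y‖ ^ 2)
    (iV.const_mul _) (((integrable_const _).sub (iG.const_mul _)).add (iΔ.const_mul _))
    (fun p => mdp.lyap_nonneg f π hR hapos hαθ wξ _ _) (fun p => ?_) (by positivity) ?_
  · have h := mdp.lyap_add_le f π hU hR henv hq hpolicy hw hapos ha hαθ θ
      (batchStep 0 αθ (actorDir π θ w) p.2) (mdp.nextW π φ αw θ w p)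
    rw [nextθ, batchStep_eq_add]
    rwa [nextW, batchStep_sub] at h
  · have i₁ : Integrable (fun y => c₀ - 2 * (1 - mdp.γ) / αθ *
        inner ℝ (mdp.gradJ f π θ) (batchStep 0 αθ (actorDir π θ w) y))
        (Measure.pi fun _ : Fin M => ν) := (integrable_const _).sub (iG.const_mul _)
    rw [integral_const_mul, integral_add i₁ (iΔ.const_mul _),
      integral_sub (integrable_const _) (iG.const_mul _), integral_const, probReal_univ, one_smul,
      integral_const_mul, integral_const_mul, integral_inner hΔi, hΔmean, inner_smul_right]
    set G := mdp.gradJ f π θ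
    have e : 2 * (1 - mdp.γ) / αθ * (αθ * inner ℝ G H) = 2 * inner ℝ ((1 - mdp.γ) • G) H := by
      rw [real_inner_smul_left]; field_simp
    rw [e]
    have key := actor_critic_combine (g := 1 - mdp.γ) (a := αw * lam) (L := mdp.lipGradJ K)
      (αθ := αθ) (Lh := Lh K) (c := mdp.Cwξ K ^ 2) (κ2 := κ ^ 2) (M := M)
      (N := (1 - mdp.γ) ^ 2 * ‖G‖ ^ 2) (HH := ‖H‖ ^ 2) (GH := inner ℝ ((1 - mdp.γ) • G) H)
      (D := ‖(1 - mdp.γ) • G - H‖ ^ 2) (σ := (Lh K * ‖w‖) ^ 2 / M) (x := ‖w - wξ θ‖ ^ 2)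
      (Cw := c₀) (Cb2 := αw ^ 2 * Cb K ^ 2) (lw := mdp.lipWeight K)
      hg hg1 hapos ha hαθ (mdp.lipGradJ_pos f π hR henv hq hpolicy).le hL hLh hM1
      (sq_nonneg _) (sq_nonneg _) (by positivity) (sq_nonneg _) (sq_nonneg _) (by positivity)
      ?_ ?_ ?_ hlw (hΔsq.trans_eq (by ring)) (hV.trans_eq (by ring))
    · refine key.trans_eq ?_
      unfold lyap lyapErr
      ring
    · have e1 : ‖(1 - mdp.γ) • G‖ ^ 2 = (1 - mdp.γ) ^ 2 * ‖G‖ ^ 2 := by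
        rw [norm_smul, Real.norm_eq_abs, mul_pow, sq_abs]
      rw [norm_sub_sq_real, e1]; ring
    -- The normal equation turns the error of the actor direction into `Ψ` applied to the critic
    -- error.
    · have e2 : (1 - mdp.γ) • G - H = (1 - mdp.γ) • mdp.Psi f π θ (wξ θ - w) := by
        rw [map_sub, hw, smul_sub]
      rw [e2, norm_sub_rev w, ← mul_pow]
      exact pow_le_pow_left₀ (norm_nonneg _) (mdp.norm_smul_Psi_sub_le f π hpolicy θ _) 2
    · have e3 : ‖w‖ ≤ ‖w - wξ θ‖ + mdp.Cwξ K := by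
        have := norm_le_norm_sub_add w (wξ θ)
        linarith
      have e4 : ‖w‖ ^ 2 ≤ 2 * (‖w - wξ θ‖ ^ 2 + mdp.Cwξ K ^ 2) := by
        refine (pow_le_pow_left₀ (norm_nonneg _) e3 2).trans ?_
        nlinarith [sq_nonneg (‖w - wξ θ‖ - mdp.Cwξ K)]
      calc (Lh K * ‖w‖) ^ 2 / M = Lh K ^ 2 / M * ‖w‖ ^ 2 := by ring
        _ ≤ Lh K ^ 2 / M * (2 * (‖w - wξ θ‖ ^ 2 + mdp.Cwξ K ^ 2)) := by gcongr
        _ = _ := by ring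

end MDP
end DPPG
end

noncomputable section
namespace DPPG

/-! ### Integration against a conditional law -/

section CondLaw

variable {Ω E F : Type*} [MeasurableSpace E] [MeasurableSpace F] {m mΩ : MeasurableSpace Ω}
  {P : Measure Ω} [IsProbabilityMeasure P] {Y : Ω → E} {X : Ω → F} {κ : Ω → Measure F}
  [∀ ω, IsProbabilityMeasure (κ ω)]

/-- `κ` need not be a kernel: nothing is assumed on how the laws depend on `ω`. Almost everywhere
measurability on product sets is inherited from the conditional probabilities, and the π-λ induction
carries it together with the identity to all measurable sets. -/
theorem measure_prodMk_eq_lintegral (hm : m ≤ mΩ) (hY : Measurable[m] Y) (hX : Measurable X)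
    (law : ∀ B, MeasurableSet B → P⟦X ⁻¹' B | m⟧ =ᵐ[P] fun ω => (κ ω).real B)
    {D : Set (E × F)} (hD : MeasurableSet D) :
    AEMeasurable (fun ω => κ ω (Prod.mk (Y ω) ⁻¹' D)) P ∧
      P {ω | (Y ω, X ω) ∈ D} = ∫⁻ ω, κ ω (Prod.mk (Y ω) ⁻¹' D) ∂P := by
  have hYX : Measurable fun ω => (Y ω, X ω) := (hY.mono hm le_rfl).prodMk hX
  have hsec : ∀ {D : Set (E × F)}, MeasurableSet D → ∀ ω, MeasurableSet (Prod.mk (Y ω) ⁻¹' D) :=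
    fun hD ω => measurable_prodMk_left hD
  induction D, hD using MeasurableSpace.induction_on_inter generateFrom_prod.symm isPiSystem_prod with
  | empty => simp [aemeasurable_const]
  | basic D hD =>
    obtain ⟨C, hC, B, hB, rfl⟩ := hD
    have hC' : MeasurableSet[m] (Y ⁻¹' C) := hY hC
    have e : (fun ω => κ ω (Prod.mk (Y ω) ⁻¹' C ×ˢ B)) =
        (Y ⁻¹' C).indicator fun ω => ENNReal.ofReal ((κ ω).real B) := by
      ext ω
      by_cases h : Y ω ∈ C
      · rw [Set.indicator_of_mem (by exact h), Set.mk_preimage_prod_right h, ofReal_measureReal]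
      · rw [Set.indicator_of_notMem (by exact h), Set.mk_preimage_prod_right_eq_empty h,
          measure_empty]
    have hae : AEMeasurable (fun ω => ENNReal.ofReal ((κ ω).real B)) P :=
      ENNReal.measurable_ofReal.comp_aemeasurable
        ⟨_, (stronglyMeasurable_condExp.mono hm).measurable, (law B hB).symm⟩
    rw [e]
    refine ⟨hae.indicator (hm _ hC'), ?_⟩
    have hi : Integrable ((X ⁻¹' B).indicator fun _ => (1 : ℝ)) P :=
      (integrable_const 1).indicator (hX hB)
    have h1 := setIntegral_condExp hm hi hC'
    have h2 : ∫ ω in Y ⁻¹' C, (P⟦X ⁻¹' B | m⟧) ω ∂P = ∫ ω in Y ⁻¹' C, (κ ω).real B ∂P :=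
      integral_congr_ae (ae_restrict_of_ae (law B hB))
    have hκi : Integrable (fun ω => (κ ω).real B) P := integrable_condExp.congr (law B hB)
    rw [lintegral_indicator (hm _ hC'),
      ← ofReal_integral_eq_lintegral_ofReal hκi.integrableOn (ae_of_all _ fun _ => measureReal_nonneg),
      ← h2, h1, integral_indicator (hX hB), integral_const, smul_eq_mul, mul_one,
      measureReal_restrict_apply_univ, measureReal_def, Measure.restrict_apply (hX hB),
      ENNReal.ofReal_toReal (measure_ne_top _ _)]
    congr 1
    ext ω; simp [and_comm]
  | compl D hD ih =>
    have e : ∀ ω, κ ω (Prod.mk (Y ω) ⁻¹' Dᶜ) = 1 - κ ω (Prod.mk (Y ω) ⁻¹' D) := fun ω => by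
      rw [Set.preimage_compl, prob_compl_eq_one_sub (hsec hD ω)]
    simp only [e]
    refine ⟨aemeasurable_const.sub ih.1, ?_⟩
    rw [lintegral_sub' ih.1 (by rw [← ih.2]; exact measure_ne_top _ _)
      (ae_of_all _ fun ω => prob_le_one), ← ih.2, lintegral_one, measure_univ]
    exact prob_compl_eq_one_sub (hYX hD)
  | iUnion D hdis hD ih =>
    have e : ∀ ω, κ ω (Prod.mk (Y ω) ⁻¹' ⋃ i, D i) = ∑' i, κ ω (Prod.mk (Y ω) ⁻¹' D i) :=
      fun ω => by
        rw [Set.preimage_iUnion, measure_iUnion (fun i j hij => (hdis hij).preimage _)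
          fun i => hsec (hD i) ω]
    simp only [e]
    refine ⟨AEMeasurable.tsum fun i => (ih i).1, ?_⟩
    rw [lintegral_tsum fun i => (ih i).1]
    have : {ω | (Y ω, X ω) ∈ ⋃ i, D i} = ⋃ i, (fun ω => (Y ω, X ω)) ⁻¹' D i := by ext; simp
    rw [this, measure_iUnion (fun i j hij => (hdis hij).preimage _) fun i => hYX (hD i)]
    exact tsum_congr fun i => (ih i).2

theorem lintegral_condLaw (hm : m ≤ mΩ) (hY : Measurable[m] Y) (hX : Measurable X)
    (law : ∀ B, MeasurableSet B → P⟦X ⁻¹' B | m⟧ =ᵐ[P] fun ω => (κ ω).real B)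
    {G : E × F → ENNReal} (hG : Measurable G) :
    AEMeasurable (fun ω => ∫⁻ x, G (Y ω, x) ∂(κ ω)) P ∧
      ∫⁻ ω, G (Y ω, X ω) ∂P = ∫⁻ ω, ∫⁻ x, G (Y ω, x) ∂(κ ω) ∂P := by
  have hYX : Measurable fun ω => (Y ω, X ω) := (hY.mono hm le_rfl).prodMk hX
  refine Measurable.ennreal_induction (motive := fun G =>
    AEMeasurable (fun ω => ∫⁻ x, G (Y ω, x) ∂(κ ω)) P ∧
      ∫⁻ ω, G (Y ω, X ω) ∂P = ∫⁻ ω, ∫⁻ x, G (Y ω, x) ∂(κ ω) ∂P) ?_ ?_ ?_ hG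
  · intro c D hD
    have h := measure_prodMk_eq_lintegral hm hY hX law hD
    have e : ∀ ω, ∫⁻ x, D.indicator (fun _ => c) (Y ω, x) ∂(κ ω) =
        c * κ ω (Prod.mk (Y ω) ⁻¹' D) := fun ω =>
      lintegral_indicator_const_comp measurable_prodMk_left hD c
    simp only [e]
    refine ⟨h.1.const_mul c, ?_⟩
    rw [lintegral_const_mul'' _ h.1, ← h.2]
    exact lintegral_indicator_const_comp hYX hD c
  · intro G₁ G₂ _ h₁ h₂ i₁ i₂
    have e : ∀ ω, ∫⁻ x, (G₁ + G₂) (Y ω, x) ∂(κ ω) =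
        ∫⁻ x, G₁ (Y ω, x) ∂(κ ω) + ∫⁻ x, G₂ (Y ω, x) ∂(κ ω) := fun ω =>
      lintegral_add_left (h₁.comp measurable_prodMk_left) _
    simp only [e]
    refine ⟨i₁.1.add i₂.1, ?_⟩
    rw [lintegral_add_left' i₁.1, ← i₁.2, ← i₂.2]
    exact lintegral_add_left (h₁.comp hYX) _
  · intro G hG hmono ih
    have e : ∀ ω, ∫⁻ x, (⨆ n, G n (Y ω, x)) ∂(κ ω) = ⨆ n, ∫⁻ x, G n (Y ω, x) ∂(κ ω) := fun ω =>
      lintegral_iSup (fun n => (hG n).comp measurable_prodMk_left)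
        fun i j hij x => hmono hij _
    simp only [e]
    refine ⟨AEMeasurable.iSup fun n => (ih n).1, ?_⟩
    rw [lintegral_iSup' (fun n => (ih n).1) (ae_of_all _ fun ω i j hij =>
      lintegral_mono fun x => hmono hij _)]
    refine (lintegral_iSup (fun n => (hG n).comp hYX) fun i j hij ω => hmono hij _).trans ?_
    exact iSup_congr fun n => (ih n).2

end CondLaw

/-- Telescoping of a supermartingale-type recursion in the extended reals. -/
theorem sum_le_of_add_le {a n : ℕ → ENNReal} {c : ENNReal} (h : ∀ t, a (t + 1) + n t ≤ a t + c)
    (T : ℕ) : ∑ t ∈ Finset.range T, n t + a T ≤ a 0 + T * c := by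
  induction T with
  | zero => simp
  | succ T ih =>
    rw [Finset.sum_range_succ]
    calc ∑ t ∈ Finset.range T, n t + n T + a (T + 1)
        = ∑ t ∈ Finset.range T, n t + (a (T + 1) + n T) := by ring
      _ ≤ ∑ t ∈ Finset.range T, n t + (a T + c) := add_le_add_right (h T) _
      _ = (∑ t ∈ Finset.range T, n t + a T) + c := by ring
      _ ≤ a 0 + T * c + c := add_le_add_left ih _
      _ = _ := by push_cast; ring

namespace MDP

variable {S A : Type*} [MeasurableSpace S] [MeasurableSpace A] (mdp : MDP S A)
  {k d : ℕ} {U : Set (Vec k)} (f : Kernel (Vec k) A) [IsMarkovKernel f] (π : ParamPolicy S U d)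
  {K : Consts}

/-! ### Joint measurability of the update maps -/

section Measurability

variable (hpolicy : mdp.PolicyAssumption f π K)
include hpolicy

theorem measurable_uncurry_actorDir :
    Measurable fun y : (Vec d × Vec d) × S => actorDir π y.1.1 y.1.2 y.2 := by
  have hj : Measurable fun y : (Vec d × Vec d) × S => π.jac y.1.1 y.2 :=
    (mdp.measurable_uncurry_jac f π hpolicy).comp
      ((measurable_fst.comp measurable_fst).prodMk measurable_snd)
  refine measurable_of_inner fun x => ?_
  simp only [actorDir, ContinuousLinearMap.adjoint_inner_left]
  have h1 : Measurable fun y : (Vec d × Vec d) × S => π.jac y.1.1 y.2 y.1.2 :=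
    (isBoundedBilinearMap_apply (𝕜 := ℝ) (E := Vec d) (F := Vec k)).continuous.measurable.comp
      (hj.prodMk (measurable_snd.comp measurable_fst))
  have h2 : Measurable fun y : (Vec d × Vec d) × S => π.jac y.1.1 y.2 x :=
    (ContinuousLinearMap.apply ℝ (Vec k) x).continuous.measurable.comp hj
  exact h1.inner h2

theorem measurable_nextθ {M : ℕ} (αθ : ℝ) : Measurable
    fun z : (Vec d × Vec d) × ((Fin M → S × (ℝ × S)) × (Fin M → S)) =>
      nextθ π αθ z.1.1 z.1.2 z.2 := by
  have h := mdp.measurable_uncurry_actorDir f π hpolicy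
  have hj : ∀ j, Measurable
      fun z : (Vec d × Vec d) × ((Fin M → S × (ℝ × S)) × (Fin M → S)) =>
        actorDir π z.1.1 z.1.2 (z.2.2 j) := fun j => by
    have hz : Measurable fun z : (Vec d × Vec d) × ((Fin M → S × (ℝ × S)) × (Fin M → S)) =>
      (z.1, z.2.2 j) := by fun_prop
    have h' := h.comp hz
    simp only [Function.comp_def] at h'
    exact h'
  have hs : Measurable fun z : (Vec d × Vec d) × ((Fin M → S × (ℝ × S)) × (Fin M → S)) =>
      ∑ j, actorDir π z.1.1 z.1.2 (z.2.2 j) := Finset.measurable_sum _ fun j _ => hj j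
  have h1 : Measurable fun z : (Vec d × Vec d) × ((Fin M → S × (ℝ × S)) × (Fin M → S)) =>
      z.1.1 := measurable_fst.comp measurable_fst
  have h2 := h1.add (hs.fun_const_smul (αθ / M))
  simp only [nextθ, batchStep]
  exact h2

theorem measurable_nextW {φ : S → Vec k → Vec d} (hφ : Measurable (Function.uncurry φ)) {M : ℕ}
    (αw : ℝ) : Measurable
    fun z : (Vec d × Vec d) × ((Fin M → S × (ℝ × S)) × (Fin M → S)) =>
      mdp.nextW π φ αw z.1.1 z.1.2 z.2 := by
  have hf : Measurable fun y : Vec d × S => feat π φ y.1 y.2 :=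
    hφ.comp (measurable_snd.prodMk (measurable_uncurry_policy π))
  have h : Measurable fun y : (Vec d × Vec d) × (S × (ℝ × S)) =>
      mdp.tdUpd π φ y.1.1 y.1.2 y.2 := by
    have h1 : Measurable fun y : (Vec d × Vec d) × (S × (ℝ × S)) => feat π φ y.1.1 y.2.1 :=
      hf.comp ((measurable_fst.comp measurable_fst).prodMk (measurable_fst.comp measurable_snd))
    have h2 : Measurable fun y : (Vec d × Vec d) × (S × (ℝ × S)) => feat π φ y.1.1 y.2.2.2 :=
      hf.comp ((measurable_fst.comp measurable_fst).prodMk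
        (measurable_snd.comp (measurable_snd.comp measurable_snd)))
    have h3 : Measurable fun y : (Vec d × Vec d) × (S × (ℝ × S)) => y.1.2 :=
      measurable_snd.comp measurable_fst
    have h4 : Measurable fun y : (Vec d × Vec d) × (S × (ℝ × S)) => y.2.2.1 := by fun_prop
    exact ((h4.add ((Measurable.inner (𝕜 := ℝ) h2 h3).const_mul _)).sub
      (Measurable.inner (𝕜 := ℝ) h1 h3)).smul h1
  have hj : ∀ j, Measurable
      fun z : (Vec d × Vec d) × ((Fin M → S × (ℝ × S)) × (Fin M → S)) =>
        mdp.tdUpd π φ z.1.1 z.1.2 (z.2.1 j) := fun j =>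
    h.comp (measurable_fst.prodMk ((measurable_pi_apply j).comp (measurable_fst.comp measurable_snd)))
  exact (measurable_snd.comp measurable_fst).add
    (Measurable.fun_const_smul (Finset.measurable_sum _ fun j _ => hj j) _)

end Measurability

/-! ### Runs as adapted processes -/

section Run

variable {φ : S → Vec k → Vec d}
  {stat : Vec d → Measure S} {M : ℕ} {αw αθ : ℝ} {w0 θ0 : Vec d} {Ω : Type*}
  {mΩ : MeasurableSpace Ω} {P : Measure Ω} {ℱ : Filtration ℕ mΩ}
  {X : ℕ → Ω → (Fin M → S × (ℝ × S)) × (Fin M → S)} {w θ : ℕ → Ω → Vec d}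

theorem IsRun.measurable (hrun : mdp.IsRun P ℱ f π φ stat M αw αθ w0 θ0 X w θ)
    (hφ : Measurable (Function.uncurry φ)) (hpolicy : mdp.PolicyAssumption f π K) (t : ℕ) :
    Measurable[ℱ t] fun ω => (θ t ω, w t ω) := by
  induction t with
  | zero =>
    simp only [hrun.θ_zero, hrun.w_zero]
    exact measurable_const
  | succ t ih =>
    have hz : Measurable[ℱ (t + 1)] fun ω => ((θ t ω, w t ω), X t ω) :=
      (ih.mono (ℱ.mono t.le_succ) le_rfl).prodMk (hrun.adapted t)
    have h1 := (mdp.measurable_nextθ f π hpolicy (M := M) αθ).comp hz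
    have h2 := (mdp.measurable_nextW f π hpolicy hφ (M := M) αw).comp hz
    have e1 : θ (t + 1) = fun ω => nextθ π αθ (θ t ω) (w t ω) (X t ω) :=
      funext fun ω => hrun.θ_succ t ω
    have e2 : w (t + 1) = fun ω => mdp.nextW π φ αw (θ t ω) (w t ω) (X t ω) :=
      funext fun ω => hrun.w_succ t ω
    rw [e1, e2]
    exact h1.prodMk h2

instance [∀ θ, IsProbabilityMeasure (stat θ)] (θ : Vec d) :
    IsProbabilityMeasure (mdp.batchLaw f π M θ (stat θ)) := by
  unfold batchLaw; infer_instance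

/-- Expectation of a function of the next iterate. -/
theorem IsRun.lintegral_succ [IsProbabilityMeasure P] [∀ θ, IsProbabilityMeasure (stat θ)]
    (hrun : mdp.IsRun P ℱ f π φ stat M αw αθ w0 θ0 X w θ)
    (hφ : Measurable (Function.uncurry φ)) (hpolicy : mdp.PolicyAssumption f π K)
    {G : Vec d × Vec d → ENNReal} (hG : Measurable G) (t : ℕ) :
    ∫⁻ ω, G (θ (t + 1) ω, w (t + 1) ω) ∂P =
      ∫⁻ ω, ∫⁻ x, G (nextθ π αθ (θ t ω) (w t ω) x, mdp.nextW π φ αw (θ t ω) (w t ω) x)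
        ∂(mdp.batchLaw f π M (θ t ω) (stat (θ t ω))) ∂P := by
  have h := (lintegral_condLaw (κ := fun ω => mdp.batchLaw f π M (θ t ω) (stat (θ t ω)))
    (ℱ.le t) (hrun.measurable mdp f π hφ hpolicy t)
    ((hrun.adapted t).mono (ℱ.le _) le_rfl) (hrun.law t)
    (hG.comp ((mdp.measurable_nextθ f π hpolicy (M := M) αθ).prodMk
      (mdp.measurable_nextW f π hpolicy hφ (M := M) αw)))).2
  simp only [Function.comp_def] at h
  rw [← h]
  refine lintegral_congr fun ω => ?_
  rw [hrun.θ_succ, hrun.w_succ]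
  rfl

end Run

end MDP
end DPPG
end

noncomputable section
namespace DPPG
namespace MDP

variable {S A : Type*} [MeasurableSpace S] [MeasurableSpace A] (mdp : MDP S A)
  {k d : ℕ} {U : Set (Vec k)} (f : Kernel (Vec k) A) [IsMarkovKernel f] (π : ParamPolicy S U d)
  {K : Consts}

/-! ### Admissible step sizes -/

theorem CA_pos (hCφ : 0 < K.Cφ) : 0 < CA K := by unfold CA; positivity

/-- A nonzero vector forces `lam ≤ 2 CA` by Cauchy–Schwarz, so that `(αw CA²) lam ≤ lam² / 2 ≤ 2
CA²`. In dimension zero the curvature condition is vacuous and the claim fails. -/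
theorem IsCurvature.mul_le_two [Nontrivial (Vec d)] {φ : S → Vec k → Vec d}
    (hφ : Measurable (Function.uncurry φ)) {stat : Vec d → Measure S}
    [∀ θ, IsProbabilityMeasure (stat θ)] (hb : ∀ s, ∀ u ∈ U, ‖φ s u‖ ≤ K.Cφ) (hCφ : 0 < K.Cφ)
    {lam αw : ℝ} (hlam0 : 0 < lam) (hlam : mdp.IsCurvature f π φ stat lam)
    (hα : αw * CA K ^ 2 ≤ lam / 2) : αw * lam ≤ 2 := by
  obtain ⟨v, hv⟩ := exists_ne (0 : Vec d)
  have hCA := CA_pos hCφ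
  have hv2 : 0 < ‖v‖ ^ 2 := pow_pos (norm_pos_iff.2 hv) 2
  have h1 := hlam.inner_tdMean_le mdp f π φ hφ hb 0 v
  have h2 := abs_real_inner_le_norm v (mdp.tdMean f π φ 0 (stat 0) v)
  have h3 := mdp.norm_tdMean_le f π φ hb 0 (stat 0) v
  have h4 : ‖v‖ * ‖mdp.tdMean f π φ 0 (stat 0) v‖ ≤ ‖v‖ * (CA K * ‖v‖) :=
    mul_le_mul_of_nonneg_left h3 (norm_nonneg _)
  have h5 := neg_abs_le (inner ℝ v (mdp.tdMean f π φ 0 (stat 0) v))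
  have h6 : lam ≤ 2 * CA K := le_of_mul_le_mul_right (by nlinarith) hv2
  have h7 : αw * lam * CA K ^ 2 ≤ 2 * CA K ^ 2 := by
    calc αw * lam * CA K ^ 2 = (αw * CA K ^ 2) * lam := by ring
      _ ≤ lam / 2 * lam := mul_le_mul_of_nonneg_right hα hlam0.le
      _ ≤ 2 * CA K ^ 2 := by nlinarith
  exact le_of_mul_le_mul_right h7 (by positivity)

/-- The factor `√6` in the step-size condition is chosen for this: `lw αθ ≤ a / (12 √6 Lh)` has
square `a² / (864 Lh²)`, and `18 / 864 = 1 / 48`. -/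
theorem drift_coefficient_le {a lw Lw αθ Lh : ℝ} (ha : 0 < a) (hLh : 0 < Lh) (hLw : 0 < Lw)
    (hlw0 : 0 ≤ lw) (hlw : lw ≤ 2 * Lw) (hαθ : 0 < αθ)
    (h : αθ ≤ a / (24 * Real.sqrt 6 * Lh * Lw)) :
    18 / a * lw ^ 2 * αθ ^ 2 ≤ a / (48 * Lh ^ 2) := by
  have h6 : 0 < Real.sqrt 6 := Real.sqrt_pos.2 (by norm_num)
  have hs : Real.sqrt 6 ^ 2 = 6 := Real.sq_sqrt (by norm_num)
  have h1 : lw * αθ ≤ a / (12 * Real.sqrt 6 * Lh) := by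
    calc lw * αθ ≤ 2 * Lw * (a / (24 * Real.sqrt 6 * Lh * Lw)) :=
          mul_le_mul hlw h hαθ.le (by positivity)
      _ = _ := by field_simp; norm_num
  have h2 := pow_le_pow_left₀ (by positivity) h1 2
  calc 18 / a * lw ^ 2 * αθ ^ 2 = 18 / a * (lw * αθ) ^ 2 := by ring
    _ ≤ 18 / a * (a / (12 * Real.sqrt 6 * Lh)) ^ 2 := mul_le_mul_of_nonneg_left h2 (by positivity)
    _ = a / (48 * Lh ^ 2) := by
        rw [div_pow, mul_pow, mul_pow, hs]; field_simp; norm_num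

/-! ### Summation along a run -/

section Run

theorem continuous_gradJ (hU : U ⊆ closure (interior U)) (hR : mdp.RewardBounded K.Rmax)
    (henv : mdp.EnvAssumption f U K) (hq : mdp.QAssumption f π K)
    (hpolicy : mdp.PolicyAssumption f π K) : Continuous (mdp.gradJ f π) :=
  (LipschitzWith.of_dist_le' fun θ₁ θ₂ => by
    rw [dist_eq_norm, dist_eq_norm]
    exact mdp.norm_gradJ_sub_le f π hU hR henv hq hpolicy θ₁ θ₂).continuous

variable {φ : S → Vec k → Vec d}
  {stat : Vec d → Measure S} {M : ℕ} {αw αθ : ℝ} {w0 θ0 : Vec d} {Ω : Type*}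
  {mΩ : MeasurableSpace Ω} {P : Measure Ω} {ℱ : Filtration ℕ mΩ}
  {X : ℕ → Ω → (Fin M → S × (ℝ × S)) × (Fin M → S)} {w θ : ℕ → Ω → Vec d}

theorem IsRun.integrable_norm_gradJ_sq [IsProbabilityMeasure P]
    (hrun : mdp.IsRun P ℱ f π φ stat M αw αθ w0 θ0 X w θ)
    (hφ : Measurable (Function.uncurry φ)) (hU : U ⊆ closure (interior U))
    (hR : mdp.RewardBounded K.Rmax) (henv : mdp.EnvAssumption f U K)
    (hq : mdp.QAssumption f π K) (hpolicy : mdp.PolicyAssumption f π K) (t : ℕ) :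
    Integrable (fun ω => ‖mdp.gradJ f π (θ t ω)‖ ^ 2) P := by
  have hm : Measurable fun ω => mdp.gradJ f π (θ t ω) :=
    (mdp.continuous_gradJ f π hU hR henv hq hpolicy).measurable.comp
      (measurable_fst.comp ((hrun.measurable mdp f π hφ hpolicy t).mono (ℱ.le t) le_rfl))
  refine Integrable.of_bound (hm.norm.pow_const 2).aestronglyMeasurable
    ((K.Lπ * mdp.Cq K / (1 - mdp.γ)) ^ 2) (ae_of_all _ fun ω => ?_)
  rw [Real.norm_eq_abs, abs_of_nonneg (sq_nonneg _)]
  exact pow_le_pow_left₀ (norm_nonneg _) (mdp.norm_gradJ_le f π hU hR henv hq hpolicy _) 2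

/-- The Lyapunov function is nonnegative, so the recursion is run with extended nonnegative
integrals; square integrability of the iterates need not be known in advance. -/
theorem IsRun.sum_integral_le [IsProbabilityMeasure P] [∀ θ, IsProbabilityMeasure (stat θ)]
    (hrun : mdp.IsRun P ℱ f π φ stat M αw αθ w0 θ0 X w θ)
    (hφ : Measurable (Function.uncurry φ)) (hU : U ⊆ closure (interior U))
    (hR : mdp.RewardBounded K.Rmax) (henv : mdp.EnvAssumption f U K)
    (hq : mdp.QAssumption f π K) (hpolicy : mdp.PolicyAssumption f π K)
    {wTD wξ : Vec d → Vec d} (hw : ∀ θ, mdp.Psi f π θ (wξ θ) = mdp.gradJ f π θ)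
    (hTD : ∀ θ, mdp.IsTDFixedPoint f π φ θ (stat θ) (wTD θ))
    (hb : ∀ s, ∀ u ∈ U, ‖φ s u‖ ≤ K.Cφ)
    {lam κ : ℝ} (hκ : ∀ θ, ‖wTD θ - wξ θ‖ ≤ κ)
    (hlam0 : 0 < lam) (hlam : mdp.IsCurvature f π φ stat lam)
    (hαw : 0 < αw) (hM : 0 < M) (hαC : αw * CA K ^ 2 ≤ lam / 2) (ha : αw * lam ≤ 2)
    (hMC : 48 * αw * CA K ^ 2 ≤ lam * M) (hαθ : 0 < αθ) (hL : αθ * mdp.lipGradJ K ≤ 1 / 2)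
    (hlw : 18 / (αw * lam) * mdp.lipWeight K ^ 2 * αθ ^ 2 ≤ αw * lam / (48 * Lh K ^ 2)) (T : ℕ) :
    ∑ t ∈ Finset.range T, (1 - mdp.γ) ^ 2 * ∫ ω, ‖mdp.gradJ f π (θ t ω)‖ ^ 2 ∂P ≤
      mdp.lyap f π K (αw * lam) αθ wξ θ0 w0 + T * mdp.lyapErr K (αw * lam) αw κ M := by
  have hapos : 0 < αw * lam := mul_pos hαw hlam0
  have hJ : Continuous (mdp.J f π) := continuous_iff_continuousAt.2 fun θ =>
    (mdp.hasGradientAt_J f π hU hR henv hq hpolicy θ).continuousAt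
  have hwξ : Continuous wξ := (LipschitzWith.of_dist_le' fun θ₁ θ₂ => by
    rw [dist_eq_norm, dist_eq_norm]
    exact mdp.norm_compatibleWeight_sub_le f π hU hR henv hq hpolicy hw θ₁ θ₂).continuous
  have hΦ : Measurable fun z : Vec d × Vec d =>
      ENNReal.ofReal (mdp.lyap f π K (αw * lam) αθ wξ z.1 z.2) := by
    refine ENNReal.measurable_ofReal.comp (Continuous.measurable ?_)
    unfold lyap
    fun_prop
  have hErr : 0 ≤ mdp.lyapErr K (αw * lam) αw κ M := mdp.lyapErr_nonneg hapos M
  have hΦ0 := fun θ w => mdp.lyap_nonneg f π (K := K) hR hapos hαθ wξ θ w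
  have hint := fun t => hrun.integrable_norm_gradJ_sq mdp f π hφ hU hR henv hq hpolicy t
  have step : ∀ t, ∫⁻ ω, ENNReal.ofReal (mdp.lyap f π K (αw * lam) αθ wξ (θ (t + 1) ω)
      (w (t + 1) ω)) ∂P + ENNReal.ofReal
        ((1 - mdp.γ) ^ 2 * ∫ ω, ‖mdp.gradJ f π (θ t ω)‖ ^ 2 ∂P) ≤
      ∫⁻ ω, ENNReal.ofReal (mdp.lyap f π K (αw * lam) αθ wξ (θ t ω) (w t ω)) ∂P
        + ENNReal.ofReal (mdp.lyapErr K (αw * lam) αw κ M) := fun t => by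
    have h1 := hrun.lintegral_succ mdp f π hφ hpolicy hΦ t
    have h2 : ENNReal.ofReal ((1 - mdp.γ) ^ 2 * ∫ ω, ‖mdp.gradJ f π (θ t ω)‖ ^ 2 ∂P) =
        ∫⁻ ω, ENNReal.ofReal ((1 - mdp.γ) ^ 2 * ‖mdp.gradJ f π (θ t ω)‖ ^ 2) ∂P := by
      rw [← integral_const_mul, ofReal_integral_eq_lintegral_ofReal ((hint t).const_mul _)
        (ae_of_all _ fun ω => by positivity)]
    have h3 : AEMeasurable
        (fun ω => ENNReal.ofReal ((1 - mdp.γ) ^ 2 * ‖mdp.gradJ f π (θ t ω)‖ ^ 2)) P :=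
      ((hint t).const_mul _).aemeasurable.ennreal_ofReal
    simp only [] at h1
    rw [h1, h2, ← lintegral_add_right' _ h3]
    have h4 : ENNReal.ofReal (mdp.lyapErr K (αw * lam) αw κ M) =
        ∫⁻ _, ENNReal.ofReal (mdp.lyapErr K (αw * lam) αw κ M) ∂P := by simp
    rw [h4, ← lintegral_add_right _ measurable_const]
    refine lintegral_mono fun ω => ?_
    simp only []
    rw [← ENNReal.ofReal_add (hΦ0 _ _) hErr]
    exact mdp.lintegral_lyap_next_le f π hU hR henv hq hpolicy hw φ hφ hb hlam0 hlam hαw hM hαC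
      ha hMC hαθ hL hlw (hTD _) (hκ _) _
  have hsum := sum_le_of_add_le (a := fun t => ∫⁻ ω, ENNReal.ofReal
    (mdp.lyap f π K (αw * lam) αθ wξ (θ t ω) (w t ω)) ∂P) step T
  have hN : ∀ t, 0 ≤ (1 - mdp.γ) ^ 2 * ∫ ω, ‖mdp.gradJ f π (θ t ω)‖ ^ 2 ∂P := fun t =>
    mul_nonneg (sq_nonneg _) (integral_nonneg fun ω => sq_nonneg _)
  simp only [hrun.θ_zero, hrun.w_zero, lintegral_const, measure_univ, mul_one] at hsum
  rw [← ENNReal.ofReal_sum_of_nonneg fun t _ => hN t, ← ENNReal.ofReal_natCast T,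
    ← ENNReal.ofReal_mul (Nat.cast_nonneg T), ← ENNReal.ofReal_add (hΦ0 _ _) (by positivity)] at hsum
  -- The last Lyapunov value is nonnegative and is dropped before returning to real numbers.
  exact (ENNReal.ofReal_le_ofReal_iff (add_nonneg (hΦ0 _ _) (by positivity))).1
    (le_self_add.trans hsum)

end Run

/-! ### Comparison with the stated constants -/

/-- Passes from the distance to `wξ` to the distance to the TD fixed point, in which the stated
bound is expressed, at the price of `κ²`. -/
theorem lyap_le (hR : mdp.RewardBounded K.Rmax) {a αθ κ : ℝ} (ha : 0 < a)
    (hαθ : 0 < αθ) (wξ : Vec d → Vec d) (θ w wTD : Vec d) (hκ : ‖wTD - wξ θ‖ ≤ κ) :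
    mdp.lyap f π K a αθ wξ θ w ≤ 4 * K.Rmax / αθ
      + 96 * Lh K ^ 2 / (5 * a) * (‖w - wTD‖ ^ 2 + κ ^ 2) := by
  have hg := mdp.one_sub_γ_pos
  have h1 := (abs_le.1 (mdp.abs_J_le f π hR θ)).1
  have h2 : 2 * (1 - mdp.γ) / αθ * (K.Rmax / (1 - mdp.γ) - mdp.J f π θ) ≤ 4 * K.Rmax / αθ := by
    calc _ ≤ 2 * (1 - mdp.γ) / αθ * (2 * (K.Rmax / (1 - mdp.γ))) :=
          mul_le_mul_of_nonneg_left (by linarith) (by positivity)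
      _ = _ := by field_simp; ring
  have h3 : ‖w - wξ θ‖ ^ 2 ≤ 2 * (‖w - wTD‖ ^ 2 + κ ^ 2) := by
    have e : w - wξ θ = (w - wTD) + (wTD - wξ θ) := by abel
    have h4 := norm_add_sq_le_of_pos (w - wTD) (wTD - wξ θ) one_pos
    rw [← e] at h4
    have h5 := pow_le_pow_left₀ (norm_nonneg _) hκ 2
    norm_num at h4
    linarith
  have h6 : 48 * Lh K ^ 2 / (5 * a) * ‖w - wξ θ‖ ^ 2 ≤
      48 * Lh K ^ 2 / (5 * a) * (2 * (‖w - wTD‖ ^ 2 + κ ^ 2)) :=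
    mul_le_mul_of_nonneg_left h3 (by positivity)
  unfold lyap
  refine (add_le_add h2 h6).trans_eq (by ring)

theorem lyap_add_lyapErr_le (hR0 : 0 ≤ K.Rmax) {lam αw αθ κ e Φ : ℝ} {M T : ℕ} (hlam : 0 < lam)
    (hαw : 0 < αw) (hαθ : 0 < αθ) (ha2 : αw * lam ≤ 2) (hT : 1 ≤ T)
    (hΦ : Φ ≤ 4 * K.Rmax / αθ + 96 * Lh K ^ 2 / (5 * (αw * lam)) * (e ^ 2 + κ ^ 2)) :
    Φ + (T + 1 : ℕ) * mdp.lyapErr K (αw * lam) αw κ M ≤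
      T * (c1 K lam αw αθ e / T + mdp.c2 K lam αw αθ / M + mdp.c3 K lam αw αθ * κ ^ 2) := by
  have hT1 : (1 : ℝ) ≤ T := by exact_mod_cast hT
  have hT0 : (T : ℝ) ≠ 0 := by positivity
  have ha : 0 < αw * lam := mul_pos hαw hlam
  set a := αw * lam with ha_def
  have hErr := mdp.lyapErr_nonneg (K := K) (αw := αw) (κ := κ) ha M
  -- The telescoped sum starts at `t = 0` while the minimum starts at `t = 1`; the extra iteration
  -- costs at most a factor `2` as `T ≥ 1`.
  have hE : ((T + 1 : ℕ) : ℝ) * mdp.lyapErr K a αw κ M ≤ T * (2 * mdp.lyapErr K a αw κ M) := by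
    push_cast; nlinarith
  have hc1 : 4 * K.Rmax / αθ + 96 * Lh K ^ 2 / (5 * a) * e ^ 2 ≤ c1 K lam αw αθ e := by
    rw [c1, mul_comm lam αw, ← ha_def]
    have : 96 * Lh K ^ 2 / (5 * a) = 96 / 5 * (Lh K ^ 2 / a) := by field_simp
    have h0 : 0 ≤ Lh K ^ 2 / a * e ^ 2 := by positivity
    have h1 : 0 ≤ K.Rmax / αθ := by positivity
    calc _ = 4 * (K.Rmax / αθ) + 96 / 5 * (Lh K ^ 2 / a * e ^ 2) := by rw [this]; ring
      _ ≤ 8 * (K.Rmax / αθ) + 144 * (Lh K ^ 2 / a * e ^ 2) := by linarith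
      _ = _ := by ring
  have hc3 : 96 * Lh K ^ 2 / (5 * a) + 108 * Lh K ^ 2 / a ≤ mdp.c3 K lam αw αθ := by
    rw [c3, mul_comm lam αw, ← ha_def]
    -- One factor `1/a` is given up using `a ≤ 2`; the `1728` that remains far exceeds the `636/5`
    -- needed.
    have h1 : 1728 * (Lh K ^ 2 / a) ≤ 24 / a * (144 * Lh K ^ 2 / a) := by
      have : 24 / a * (144 * Lh K ^ 2 / a) = 3456 / a * (Lh K ^ 2 / a) := by field_simp; ring
      rw [this]
      refine mul_le_mul_of_nonneg_right ?_ (by positivity)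
      rw [le_div_iff₀ ha]; linarith
    have h2 : 96 * Lh K ^ 2 / (5 * a) + 108 * Lh K ^ 2 / a = 636 / 5 * (Lh K ^ 2 / a) := by
      field_simp; norm_num
    have h3 : 0 ≤ 24 * mdp.Lw K ^ 2 * Lh K ^ 2 * αθ ^ 2 / a * (144 * Lh K ^ 2 / a) := by positivity
    have h4 : 0 ≤ Lh K ^ 2 / a := by positivity
    have h5 : 0 ≤ Lh K ^ 2 := by positivity
    rw [h2, add_mul]
    linarith
  have hc2 : 36 * Lh K ^ 2 * mdp.Cwξ K ^ 2 + 66 * Lh K ^ 2 * αw ^ 2 * Cb K ^ 2 / a ≤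
      mdp.c2 K lam αw αθ := by
    rw [c2, mul_comm lam αw, ← ha_def]
    have e1 : 72 * K.Lπ ^ 4 * mdp.Cwξ K ^ 2 = 72 * (Lh K ^ 2 * mdp.Cwξ K ^ 2) := by
      rw [Lh]; ring
    have e2 : (48 * αw ^ 2 * (CA K ^ 2 * Cw K ^ 2 + Cb K ^ 2)
        + 96 * mdp.Lw K ^ 2 * K.Lπ ^ 4 * mdp.Cwξ K ^ 2 * αθ ^ 2 / a) * (144 * Lh K ^ 2 / a) =
        6912 * (Lh K ^ 2 * αw ^ 2 * Cb K ^ 2 / a) +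
        (48 * αw ^ 2 * (CA K ^ 2 * Cw K ^ 2)
        + 96 * mdp.Lw K ^ 2 * K.Lπ ^ 4 * mdp.Cwξ K ^ 2 * αθ ^ 2 / a) * (144 * Lh K ^ 2 / a) := by
      ring
    have h1 : 0 ≤ Lh K ^ 2 * αw ^ 2 * Cb K ^ 2 / a := by positivity
    have h2 : 0 ≤ (48 * αw ^ 2 * (CA K ^ 2 * Cw K ^ 2)
        + 96 * mdp.Lw K ^ 2 * K.Lπ ^ 4 * mdp.Cwξ K ^ 2 * αθ ^ 2 / a) * (144 * Lh K ^ 2 / a) := by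
      positivity
    have h3 : 0 ≤ Lh K ^ 2 * mdp.Cwξ K ^ 2 := by positivity
    have e3 : 66 * Lh K ^ 2 * αw ^ 2 * Cb K ^ 2 / a =
      66 * (Lh K ^ 2 * αw ^ 2 * Cb K ^ 2 / a) := by ring
    rw [e1, e2, e3]
    linarith
  have hκT : 96 * Lh K ^ 2 / (5 * a) * κ ^ 2 ≤ T * (96 * Lh K ^ 2 / (5 * a) * κ ^ 2) :=
    le_mul_of_one_le_left (by positivity) hT1
  have h2E : 2 * mdp.lyapErr K a αw κ M + 96 * Lh K ^ 2 / (5 * a) * κ ^ 2 ≤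
      mdp.c2 K lam αw αθ / M + mdp.c3 K lam αw αθ * κ ^ 2 := by
    have e1 : 2 * mdp.lyapErr K a αw κ M + 96 * Lh K ^ 2 / (5 * a) * κ ^ 2 =
        (36 * Lh K ^ 2 * mdp.Cwξ K ^ 2 + 66 * Lh K ^ 2 * αw ^ 2 * Cb K ^ 2 / a) / M
        + (96 * Lh K ^ 2 / (5 * a) + 108 * Lh K ^ 2 / a) * κ ^ 2 := by
      unfold lyapErr; ring
    rw [e1]
    gcongr
  have h3E := mul_le_mul_of_nonneg_left h2E (Nat.cast_nonneg (α := ℝ) T)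
  calc Φ + (T + 1 : ℕ) * mdp.lyapErr K a αw κ M
      ≤ c1 K lam αw αθ e + T * (mdp.c2 K lam αw αθ / M + mdp.c3 K lam αw αθ * κ ^ 2) := by
        linarith
    _ = _ := by field_simp; ring

theorem bound_nonneg (hR0 : 0 ≤ K.Rmax) {lam αw αθ : ℝ} (e κ T M : ℝ) (hlam : 0 < lam)
    (hαw : 0 < αw) (hαθ : 0 < αθ) (hT : 0 ≤ T) (hM : 0 ≤ M) :
    0 ≤ c1 K lam αw αθ e / T + mdp.c2 K lam αw αθ / M + mdp.c3 K lam αw αθ * κ ^ 2 := by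
  unfold c1 c2 c3
  positivity

end MDP
end DPPG
end

/-! ### Assembly of the convergence theorem -/

theorem mainTheorem5
    {S A : Type*} [MeasurableSpace S] [MeasurableSpace A] {d k : ℕ}
    (mdp : MDP S A) (U : Set (Vec k)) (hU : U ⊆ closure (interior U))
    (f : Kernel (Vec k) A) [IsMarkovKernel f] (π : ParamPolicy S U d)
    (φ : S → Vec k → Vec d) (hφ : Measurable (Function.uncurry φ))
    (stat : Vec d → Measure S)
    (hstat : ∀ θ, mdp.IsStationaryDistribution f π θ (stat θ))
    (K : Consts) (hR : mdp.RewardBounded K.Rmax)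
    (hpolicy : mdp.PolicyAssumption f π K)
    (henv : mdp.EnvAssumption f U K)
    (hq : mdp.QAssumption f π K)
    (hfeat : mdp.FeatureAssumption f π φ stat K) :
    Differentiable ℝ (mdp.J f π) ∧
    (∃ lam > 0, mdp.IsCurvature f π φ stat lam) ∧
    (∀ θ, ∃! w, mdp.IsTDFixedPoint f π φ θ (stat θ) w) ∧
    (∀ θ, ∃! w, mdp.IsCompatibleWeight f π θ w) ∧
    ∀ wTD wξ : Vec d → Vec d,
      (∀ θ, mdp.IsTDFixedPoint f π φ θ (stat θ) (wTD θ)) →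
      (∀ θ, mdp.IsCompatibleWeight f π θ (wξ θ)) →
      BddAbove (Set.range fun θ => ‖wTD θ - wξ θ‖) ∧
      ∀ lam > 0, mdp.IsCurvature f π φ stat lam →
      ∀ (αw αθ : ℝ) (M : ℕ), 0 < αw → 0 < αθ → 0 < M →
        αw ≤ lam / (2 * MDP.CA K ^ 2) →
        48 * αw * MDP.CA K ^ 2 / lam ≤ M →
        αθ ≤ min (1 / (4 * mdp.LJ K))
          (lam * αw / (24 * Real.sqrt 6 * MDP.Lh K * mdp.Lw K)) →
      ∀ (w0 θ0 : Vec d) {Ω : Type*} {mΩ : MeasurableSpace Ω} (P : Measure Ω)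
        [IsProbabilityMeasure P] (ℱ : Filtration ℕ mΩ)
        (X : ℕ → Ω → (Fin M → S × (ℝ × S)) × (Fin M → S)) (w θ : ℕ → Ω → Vec d),
        mdp.IsRun P ℱ f π φ stat M αw αθ w0 θ0 X w θ →
        (∀ t, Integrable (fun ω => ‖gradient (mdp.J f π) (θ t ω)‖ ^ 2) P) ∧
        ∀ T : ℕ, 1 ≤ T → ∃ t ∈ Finset.Icc 1 T,
          ∫ ω, ‖gradient (mdp.J f π) (θ t ω)‖ ^ 2 ∂P ≤
            (MDP.c1 K lam αw αθ ‖w0 - wTD θ0‖ / T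
              + mdp.c2 K lam αw αθ / M
              + mdp.c3 K lam αw αθ * (⨆ θ, ‖wTD θ - wξ θ‖) ^ 2)
              / (1 - mdp.γ) ^ 2 := by
  have hst : ∀ θ, IsProbabilityMeasure (stat θ) := fun θ => (hstat θ).prob
  have hb := hfeat.bounded
  have hgrad := mdp.hasGradientAt_J f π hU hR henv hq hpolicy
  refine ⟨fun θ => (hgrad θ).differentiableAt, mdp.exists_isCurvature f π φ hφ hstat hfeat,
    fun θ => mdp.existsUnique_tdFixedPoint f π φ hφ hb θ (stat θ) hR (hfeat.A_nonsing θ),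
    mdp.existsUnique_compatibleWeight f π hU hR henv hq hpolicy, fun wTD wξ hTD hξ => ?_⟩
  have hw : ∀ θ, mdp.Psi f π θ (wξ θ) = mdp.gradJ f π θ := fun θ =>
    (mdp.isCompatibleWeight_iff f π hU hR henv hq hpolicy θ _).1 (hξ θ)
  -- Both weight vectors are bounded uniformly in `θ`. Without this the supremum `κ` would take the
  -- default value `0`.
  have hbdd : BddAbove (Set.range fun θ => ‖wTD θ - wξ θ‖) := by
    obtain ⟨lam, hlam0, hlam⟩ := mdp.exists_isCurvature f π φ hφ hstat hfeat
    refine ⟨2 * MDP.Cb K / lam + mdp.Cwξ K, ?_⟩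
    rintro _ ⟨θ, rfl⟩
    exact (norm_sub_le _ _).trans (add_le_add
      (mdp.norm_tdFixedPoint_le f π φ hR hφ hb hlam0 hlam (hTD θ))
      (mdp.norm_compatibleWeight_le f π hU hR henv hq hpolicy hw θ))
  refine ⟨hbdd, fun lam hlam0 hlam αw αθ M hαw hαθ hM hαwle hMle hαθle w0 θ0 Ω mΩ P _ ℱ X w θ
    hrun => ?_⟩
  have hgJ : ∀ θ, gradient (mdp.J f π) θ = mdp.gradJ f π θ := fun θ => (hgrad θ).gradient
  simp only [hgJ]
  have hint := fun t => hrun.integrable_norm_gradJ_sq mdp f π hφ hU hR henv hq hpolicy t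
  refine ⟨hint, fun T hT => ?_⟩
  have hg := mdp.one_sub_γ_pos
  have hR0 := mdp.Rmax_nonneg f hR
  set κ := ⨆ θ, ‖wTD θ - wξ θ‖ with hκdef
  have hκ : ∀ θ, ‖wTD θ - wξ θ‖ ≤ κ := fun θ => le_ciSup hbdd θ
  have hnn := mdp.bound_nonneg (K := K) hR0 ‖w0 - wTD θ0‖ κ T M hlam0 hαw hαθ
    (Nat.cast_nonneg T) (Nat.cast_nonneg M)
  rcases subsingleton_or_nontrivial (Vec d) with hd | hd
  -- For `d = 0` the bound `αw * lam ≤ 2` is not available, but the gradient vanishes and the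
  -- right-hand side is nonnegative.
  · refine ⟨1, Finset.mem_Icc.2 ⟨le_rfl, hT⟩, ?_⟩
    have h0 : ∀ θ, mdp.gradJ f π θ = 0 := fun θ => Subsingleton.elim _ _
    simp only [h0, norm_zero, ne_eq, OfNat.ofNat_ne_zero, not_false_eq_true, zero_pow,
      integral_zero]
    positivity
  have hCA := MDP.CA_pos hfeat.Cφ_pos
  have hLh := mdp.Lh_pos f π hpolicy
  have hαC : αw * MDP.CA K ^ 2 ≤ lam / 2 := by
    rw [le_div_iff₀ (by positivity)] at hαwle; linarith
  have hMC : 48 * αw * MDP.CA K ^ 2 ≤ lam * M := by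
    rw [div_le_iff₀ hlam0] at hMle; linarith
  have ha := hlam.mul_le_two mdp f π hφ hb hfeat.Cφ_pos hlam0 hαC
  have hLJ := mdp.LJ_pos f π hR henv hq hpolicy
  have hL : αθ * mdp.lipGradJ K ≤ 1 / 2 := by
    have h1 := hαθle.trans (min_le_left _ _)
    rw [le_div_iff₀ (by positivity)] at h1
    have h2 := mul_le_mul_of_nonneg_left (mdp.lipGradJ_le f π hR henv hq hpolicy) hαθ.le
    linarith
  have hlw := MDP.drift_coefficient_le (a := αw * lam) (mul_pos hαw hlam0) hLh
    (mdp.Lw_pos f π hR henv hq hpolicy) (mdp.lipWeight_pos f π hR henv hq hpolicy).le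
    (mdp.lipWeight_le f π hR henv hq hpolicy) hαθ
    (by rw [mul_comm αw]; exact hαθle.trans (min_le_right _ _))
  have hsum := hrun.sum_integral_le mdp f π hφ hU hR henv hq hpolicy hw hTD hb hκ hlam0 hlam hαw hM
    hαC ha hMC hαθ hL hlw (T + 1)
  have htot := hsum.trans (mdp.lyap_add_lyapErr_le (M := M) hR0 hlam0 hαw hαθ ha hT
    (mdp.lyap_le f π hR (mul_pos hαw hlam0) hαθ wξ θ0 w0 (wTD θ0) (hκ θ0)))
  set bd := MDP.c1 K lam αw αθ ‖w0 - wTD θ0‖ / T + mdp.c2 K lam αw αθ / M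
    + mdp.c3 K lam αw αθ * κ ^ 2
  -- The nonnegative term `t = 0` is discarded; some remaining term is then at most the average
  -- `bd`.
  have hsub : ∑ t ∈ Finset.Icc 1 T, (1 - mdp.γ) ^ 2 * ∫ ω, ‖mdp.gradJ f π (θ t ω)‖ ^ 2 ∂P ≤
      ∑ _t ∈ Finset.Icc 1 T, bd := by
    rw [Finset.sum_const, Nat.card_Icc, Nat.add_sub_cancel, nsmul_eq_mul]
    refine le_trans (Finset.sum_le_sum_of_subset_of_nonneg (fun t ht => ?_) fun t _ _ => ?_) htot
    · rw [Finset.mem_Icc] at ht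
      exact Finset.mem_range.2 (by omega)
    · exact mul_nonneg (sq_nonneg _) (integral_nonneg fun ω => sq_nonneg _)
  obtain ⟨t, ht, hle⟩ := Finset.exists_le_of_sum_le (Finset.nonempty_Icc.2 hT) hsub
  exact ⟨t, ht, by rw [le_div_iff₀ (by positivity), mul_comm]; exact hle⟩
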